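/- Let $R$ be a commutative artinian ring, let $E$ be its minimal injective cogenerator, and write $D=\mathrm{Hom}_R(-,E)$. Let $A$ and $B$ be artin $R$-algebras (algebras that are finitely generated as $R$-modules), and write $A\text{-mod}$ for the category of finitely generated left $A$-modules. Let ${}_AT_B$ be a finitely generated $A$-$B$-bimodule on which $R$ acts centrally, and assume that it is faithfully balanced, i.e. the structure maps $A\to \mathrm{End}_{B^{op}}(T)$ and $B^{op}\to\mathrm{End}_A(T)$ are isomorphisms. Let $(\mathcal W,\mathcal V)$ be a cotorsion pair in $A\text{-mod}$ (that is, $\mathcal W=\{X:\mathrm{Ext}^1_A(X,\mathcal V)=0\}$ and $\mathcal V=\{Y:\mathrm{Ext}^1_A(\mathcal W,Y)=0\}$) which is * complete: every $X\in A\text{-mod}$ has a special $\mathcal V$-preenvelope, i.e. a monomorphism $X\to V$ with $V\in\mathcal V$ whose cokernel $C$ satisfies $\mathrm{Ext}^1_A(C,\mathcal V)=0$; * hereditary: $\mathrm{Ext}^i_A(W,V)=0$ for all $i\ge 1$, $W\in\mathcal W$, $V\in\mathcal V$; and which satisfies $\mathcal W\cap\mathcal V=\mathrm{add}\,T$, the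 class of direct summands of finite direct sums of copies of $T$. Fix a special $\mathcal V$-preenvelope $\alpha_X\colon X\to V(X)$ of every $X\in A\text{-mod}$. Let $T(A)=A\oplus DA$ and $T(B)=B\oplus DB$ be the trivial extension algebras, with multiplication $(a,f)(a',f')=(aa',af'+fa')$. For a $T(A)$-module $X$ let $\phi\colon DA\otimes_A X\to X$, $\phi(f\otimes x)=(0,f)x$. Let $\delta\colon DT\otimes_A T\to DB$ and $\delta'\colon T\otimes_B DT\to DA$ be the canonical maps $\delta(f\otimes t)(b)=f(tb)$ and $\delta'(t\otimes f)(a)=f(at)$. The map $\delta$ is bijective, and $T(A)\text{-mod}$ and $T(B)\text{-mod}$ are Frobenius categories (abelian, with enough projectives and enough injectives, projective objects and injective objects coinciding). For $V\in A\text{-mod}$ let $L(V)=\mathrm{Hom}_A(T,V)\oplus(DT\otimes_A V)$, a $T(B)$-module in which $f\in DB$ with $\delta^{-1}(f)=\sum_i g_i\otimes t_i$ acts by $f\cdot(h,z)=(0,\sum_i g_i\otimes h(t_i))$. For a $T(A)$-module $X$, the $B$-module $DT\otimes_A X$ is a $T(B)$-module in which such an $f$ acts by $f\cdot(k\otimes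 x)=-\sum_i g_i\otimes\phi(\delta'(t_i\otimes k)\otimes x)$. Let $\mathcal S(X)$ be the cokernel of the $T(B)$-linear map $$DT\otimes_A X\to L(V(X)),\qquad k\otimes x\mapsto \big(t\mapsto -\alpha_X(\phi(\delta'(t\otimes k)\otimes x)),\ k\otimes\alpha_X(x)\big).$$ For a morphism $f\colon X\to X'$ in $T(A)\text{-mod}$, choose an $A$-linear map $f_V\colon V(X)\to V(X')$ with $\alpha_{X'}\circ f=f_V\circ\alpha_X$, and let $\mathcal S(f)\colon\mathcal S(X)\to\mathcal S(X')$ be the morphism induced on cokernels by $L(f_V)=\mathrm{Hom}_A(T,f_V)\oplus(DT\otimes f_V)$. For a Frobenius category $\mathcal A$, its stable category $\underline{\mathcal A}$ (morphisms modulo those factoring through projectives) has the translation functor $\Sigma$ given by fixed exact sequences $0\to X\xrightarrow{i_X} I(X)\xrightarrow{d_X}\Sigma X\to0$ with $I(X)$ injective. Its exact triangles are those isomorphic to $X\xrightarrow{\underline f}Y\xrightarrow{\underline g}Z\xrightarrow{\underline\omega}\Sigma X$ for a short exact sequence $0\to X\xrightarrow{f}Y\xrightarrow{g}Z\to0$ in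 $\mathcal A$ and a morphism $\omega$ such that $\omega g=d_Xm$ for some $m\colon Y\to I(X)$ with $mf=i_X$. Then the class of $\mathcal S(f)$ in $T(B)\text{-}\underline{\mathrm{mod}}$ does not depend on the choice of $f_V$, and $\mathcal S$ is a functor $T(A)\text{-mod}\to T(B)\text{-}\underline{\mathrm{mod}}$ (Wakamatsu's functor associated to $(\mathcal W,\mathcal V)$). Moreover $\mathcal S$ is a $\partial$-functor: it is additive, and for all short exact sequences $\xi\colon0\to X\xrightarrow{f}Y\xrightarrow{g}Z\to0$ in $T(A)\text{-mod}$ there are morphisms $\omega_\xi\colon\mathcal S(Z)\to\Sigma\mathcal S(X)$, functorial in $\xi$, such that $\mathcal S(X)\xrightarrow{\mathcal S(f)}\mathcal S(Y)\xrightarrow{\mathcal S(g)}\mathcal S(Z)\xrightarrow{\omega_\xi}\Sigma\mathcal S(X)$ is an exact triangle. In particular, $\mathcal S$ induces a triangle functor $\mathcal S'\colon T(A)\text{-}\underline{\mathrm{mod}}\to T(B)\text{-}\underline{\mathrm{mod}}$: $\mathcal S$ is the composition of the canonical functor $T(A)\text{-mod}\to T(A)\text{-}\underline{\mathrm{mod}}$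 with an additive functor $\mathcal S'$ for which there is a natural isomorphism $\theta\colon\mathcal S'\Sigma\cong\Sigma\mathcal S'$ such that, for every exact triangle $X\xrightarrow{u}Y\xrightarrow{v}Z\xrightarrow{w}\Sigma X$, the triangle $\mathcal S'X\xrightarrow{\mathcal S'u}\mathcal S'Y\xrightarrow{\mathcal S'v}\mathcal S'Z\xrightarrow{\theta_X\circ\mathcal S'w}\Sigma\mathcal S'X$ is exact. -/

import Mathlib

universe u

noncomputable section

namespace Wakamatsu

open MulOpposite (op unop)
open scoped TensorProduct

/-! ### The minimal injective cogenerator and Matlis duality -/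

section Cogenerator

/-- `E` is a cogenerator of the category of `R`-modules: nonzero elements are detected by
linear maps to `E`. -/
def IsCogenerator (R E : Type u) [CommRing R] [AddCommGroup E] [Module R E] : Prop :=
  ∀ (M : Type u) [AddCommGroup M] [Module R M] (m : M), m ≠ 0 → ∃ f : M →ₗ[R] E, f m ≠ 0

/-- `E` is the minimal injective cogenerator of `R` (it is unique up to isomorphism): an injective
cogenerator none of whose proper submodules is an injective cogenerator. -/
class IsMinimalInjectiveCogenerator (R E : Type u) [CommRing R] [AddCommGroup E] [Module R E] :
    Prop where
  injective : Module.Injective R E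
  cogenerator : IsCogenerator R E
  minimal : ∀ N : Submodule R E, Module.Injective R N → IsCogenerator R N → N = ⊤

end Cogenerator

/-- The Matlis dual `D M = Hom_R(M, E)`. -/
def Dual (R E M : Type u) [CommRing R] [AddCommGroup E] [Module R E] [AddCommGroup M]
    [Module R M] : Type u := M →ₗ[R] E

namespace Dual

variable {R E M : Type u} [CommRing R] [AddCommGroup E] [Module R E] [AddCommGroup M] [Module R M]

instance : AddCommGroup (Dual R E M) := inferInstanceAs (AddCommGroup (M →ₗ[R] E))

instance : FunLike (Dual R E M) M E := inferInstanceAs (FunLike (M →ₗ[R] E) M E)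

instance : LinearMapClass (Dual R E M) R M E := inferInstanceAs (LinearMapClass (M →ₗ[R] E) R M E)

@[ext] theorem ext {f g : Dual R E M} (h : ∀ m, f m = g m) : f = g := LinearMap.ext h

@[simp] theorem add_apply (f g : Dual R E M) (m : M) : (f + g) m = f m + g m := rfl

@[simp] theorem zero_apply (m : M) : (0 : Dual R E M) m = 0 := rfl

/-- A right `B`-action on `M` induces the left `B`-action `(b f)(m) = f(m b)` on `D M`. -/
instance leftModule {B : Type u} [Ring B] [Algebra R B] [Module Bᵐᵒᵖ M] [IsScalarTower R Bᵐᵒᵖ M] :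
    Module B (Dual R E M) where
  smul b f := LinearMap.comp (show M →ₗ[R] E from f) (DistribSMul.toLinearMap R M (op b))
  one_smul f := by ext m; exact congrArg f (one_smul Bᵐᵒᵖ m)
  mul_smul b c f := by
    ext m; exact congrArg f (mul_smul (op c) (op b) m)
  smul_zero b := rfl
  smul_add b f g := rfl
  add_smul b c f := by
    ext m
    exact (congrArg f (add_smul (op b) (op c) m)).trans (map_add f _ _)
  zero_smul f := by ext m; exact (congrArg f (zero_smul Bᵐᵒᵖ m)).trans (map_zero f)

/-- A left `A`-action on `M` induces the right `A`-action `(f a)(m) = f(a m)` on `D M`. -/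
instance rightModule {A : Type u} [Ring A] [Algebra R A] [Module A M] [IsScalarTower R A M] :
    Module Aᵐᵒᵖ (Dual R E M) where
  smul a f := LinearMap.comp (show M →ₗ[R] E from f) (DistribSMul.toLinearMap R M (unop a))
  one_smul f := by ext m; exact congrArg f (one_smul A m)
  mul_smul b c f := by
    ext m; exact congrArg f (mul_smul (unop c) (unop b) m)
  smul_zero b := rfl
  smul_add b f g := rfl
  add_smul b c f := by
    ext m
    exact (congrArg f (add_smul (unop b) (unop c) m)).trans (map_add f _ _)
  zero_smul f := by ext m; exact (congrArg f (zero_smul A m)).trans (map_zero f)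

@[simp] theorem smul_apply {B : Type u} [Ring B] [Algebra R B] [Module Bᵐᵒᵖ M]
    [IsScalarTower R Bᵐᵒᵖ M] (b : B) (f : Dual R E M) (m : M) : (b • f) m = f (op b • m) := rfl

@[simp] theorem op_smul_apply {A : Type u} [Ring A] [Algebra R A] [Module A M]
    [IsScalarTower R A M] (a : A) (f : Dual R E M) (m : M) : (op a • f) m = f (a • m) := rfl

instance {A B : Type u} [Ring A] [Algebra R A] [Module A M] [IsScalarTower R A M]
    [Ring B] [Algebra R B] [Module Bᵐᵒᵖ M] [IsScalarTower R Bᵐᵒᵖ M] [SMulCommClass A Bᵐᵒᵖ M] :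
    SMulCommClass B Aᵐᵒᵖ (Dual R E M) where
  smul_comm b a f := by
    ext m; exact congrArg f (smul_comm (unop a) (op b) m)

end Dual

/-! ### Tensor products over a noncommutative ring -/

section BalTensor

variable (A : Type u) [Ring A]

/-- The tensor product `M ⊗_A X` of a right `A`-module `M` and a left `A`-module `X`:
the quotient of `M ⊗_ℤ X` by the relations `m a ⊗ x = m ⊗ a x`. -/
def BalTensor (M X : Type u) [AddCommGroup M] [Module Aᵐᵒᵖ M] [AddCommGroup X] [Module A X] :
    Type u :=
  (M ⊗[ℤ] X) ⧸ Submodule.span ℤ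
    {z : M ⊗[ℤ] X | ∃ (m : M) (a : A) (x : X), z = (op a • m) ⊗ₜ[ℤ] x - m ⊗ₜ[ℤ] (a • x)}

namespace BalTensor

variable {A} {M X Y : Type u} [AddCommGroup M] [Module Aᵐᵒᵖ M] [AddCommGroup X] [Module A X]
  [AddCommGroup Y] [Module A Y]

instance : AddCommGroup (BalTensor A M X) := by unfold BalTensor; infer_instance

variable (A) in
/-- The pure tensor `m ⊗ x`. -/
def tmul (m : M) (x : X) : BalTensor A M X := Submodule.Quotient.mk (m ⊗ₜ[ℤ] x)

theorem smul_tmul (m : M) (a : A) (x : X) : tmul A (op a • m) x = tmul A m (a • x) :=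
  (Submodule.Quotient.eq _).2 (Submodule.subset_span ⟨m, a, x, rfl⟩)

theorem add_tmul (m n : M) (x : X) : tmul A (m + n) x = tmul A m x + tmul A n x :=
  congrArg Submodule.Quotient.mk (TensorProduct.add_tmul m n x)

theorem tmul_add (m : M) (x y : X) : tmul A m (x + y) = tmul A m x + tmul A m y :=
  congrArg Submodule.Quotient.mk (TensorProduct.tmul_add m x y)

theorem tmul_zero (m : M) : tmul A m (0 : X) = 0 :=
  congrArg Submodule.Quotient.mk (TensorProduct.tmul_zero X m)

theorem zero_tmul (x : X) : tmul A (0 : M) x = 0 :=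
  congrArg Submodule.Quotient.mk (TensorProduct.zero_tmul M x)

theorem induction {p : BalTensor A M X → Prop} (h0 : p 0) (ht : ∀ m x, p (tmul A m x))
    (ha : ∀ u v, p u → p v → p (u + v)) (u : BalTensor A M X) : p u := by
  obtain ⟨z, rfl⟩ := Submodule.Quotient.mk_surjective _ u
  induction z using TensorProduct.induction_on with
  | zero => exact h0
  | tmul m x => exact ht m x
  | add a b h1 h2 => exact ha _ _ h1 h2

/-- Additive maps out of `M ⊗_A X` are balanced biadditive maps. -/
def lift {P : Type u} [AddCommGroup P] (f : M →+ X →+ P)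
    (hf : ∀ m (a : A) x, f (op a • m) x = f m (a • x)) : BalTensor A M X →+ P :=
  (Submodule.liftQ _
    (TensorProduct.liftAddHom f fun r m x => by
      rw [map_zsmul, map_zsmul]; rfl).toIntLinearMap (by
      rw [Submodule.span_le]
      rintro _ ⟨m, a, x, rfl⟩
      simpa [sub_eq_zero] using hf m a x) :
    (M ⊗[ℤ] X) ⧸ Submodule.span ℤ _ →ₗ[ℤ] P).toAddMonoidHom

theorem lift_tmul {P : Type u} [AddCommGroup P] (f : M →+ X →+ P)
    (hf : ∀ m (a : A) x, f (op a • m) x = f m (a • x)) (m : M) (x : X) :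
    lift f hf (tmul A m x) = f m x := rfl

/-- The pure tensor as a biadditive map. -/
def mk : M →+ X →+ BalTensor A M X :=
  AddMonoidHom.mk' (fun m => AddMonoidHom.mk' (tmul A m) (tmul_add m))
    fun m n => by ext x; exact add_tmul m n x

@[simp] theorem mk_apply (m : M) (x : X) : mk (A := A) m x = tmul A m x := rfl

variable {B : Type u} [Ring B] [Module B M] [SMulCommClass B Aᵐᵒᵖ M]

/-- Left multiplication by `b` on the first factor. -/
def lsmul (b : B) : BalTensor A M X →+ BalTensor A M X :=
  lift (mk.comp (DistribSMul.toAddMonoidHom M b)) fun m a x => by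
    change tmul A (b • op a • m) x = tmul A (b • m) (a • x)
    rw [smul_comm, smul_tmul]

/-- For a `B`-`A`-bimodule `M`, the tensor product `M ⊗_A X` is a left `B`-module through `M`. -/
instance module : Module B (BalTensor A M X) where
  smul b := lsmul b
  smul_zero b := map_zero (lsmul b)
  smul_add b := map_add (lsmul b)
  one_smul u := by
    refine induction (p := fun u => lsmul (1 : B) u = u) (map_zero _) (fun m x => ?_)
      (fun u v hu hv => ?_) u
    · exact congrArg (tmul A · x) (one_smul B m)
    · rw [map_add, hu, hv]
  mul_smul b c u := by
    refine induction (p := fun u => lsmul (b * c) u = lsmul b (lsmul c u)) (by simp)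
      (fun m x => ?_) (fun u v hu hv => ?_) u
    · exact congrArg (tmul A · x) (mul_smul b c m)
    · simp only [map_add, hu, hv]
  add_smul b c u := by
    refine induction (p := fun u => lsmul (b + c) u = lsmul b u + lsmul c u) (by simp)
      (fun m x => ?_) (fun u v hu hv => ?_) u
    · exact (congrArg (tmul A · x) (add_smul b c m)).trans (add_tmul _ _ _)
    · simp only [map_add, hu, hv]; abel
  zero_smul u := by
    refine induction (p := fun u => lsmul (0 : B) u = 0) (by simp)
      (fun m x => ?_) (fun u v hu hv => ?_) u
    · exact (congrArg (tmul A · x) (zero_smul B m)).trans (zero_tmul _)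
    · simp only [map_add, hu, hv, add_zero]

theorem smul_tmul_left (b : B) (m : M) (x : X) : b • tmul A m x = tmul A (b • m) x := rfl

/-- A balanced biadditive map which is `B`-linear in the first variable. -/
def liftLinear {P : Type u} [AddCommGroup P] [Module B P] (f : M →+ X →+ P)
    (hf : ∀ m (a : A) x, f (op a • m) x = f m (a • x))
    (hB : ∀ (b : B) m x, f (b • m) x = b • f m x) : BalTensor A M X →ₗ[B] P where
  toFun := lift f hf
  map_add' := map_add _
  map_smul' b u := by
    refine induction (p := fun u => lift f hf (b • u) = b • lift f hf u) (by simp)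
      (fun m x => ?_) (fun u v hu hv => ?_) u
    · rw [smul_tmul_left, lift_tmul, lift_tmul, hB]
    · simp only [smul_add, map_add, hu, hv]

variable (M B) in
/-- The `B`-linear map `M ⊗ g : M ⊗_A X → M ⊗_A Y` induced by an `A`-linear map `g : X → Y`. -/
def map (g : X →ₗ[A] Y) : BalTensor A M X →ₗ[B] BalTensor A M Y :=
  liftLinear (AddMonoidHom.mk' (fun m => (mk m).comp g.toAddMonoidHom)
      fun m n => by ext x; exact add_tmul m n (g x))
    (fun m a x => by
      change tmul A (op a • m) (g x) = tmul A m (g (a • x))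
      rw [smul_tmul, map_smul])
    (fun _ _ _ => rfl)

@[simp] theorem map_tmul (g : X →ₗ[A] Y) (m : M) (x : X) :
    map M B g (tmul A m x) = tmul A m (g x) := rfl

theorem map_map {Z : Type u} [AddCommGroup Z] [Module A Z] (g : X →ₗ[A] Y) (h : Y →ₗ[A] Z)
    (u : BalTensor A M X) : map M B h (map M B g u) = map M B (h.comp g) u := by
  refine induction (p := fun u => map M B h (map M B g u) = map M B (h.comp g) u) (by simp)
    (fun m x => rfl) (fun u v hu hv => ?_) u
  simp only [map_add, hu, hv]

theorem map_add_left (g h : X →ₗ[A] Y) (u : BalTensor A M X) :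
    map M B (g + h) u = map M B g u + map M B h u := by
  refine induction (p := fun u => map M B (g + h) u = map M B g u + map M B h u) (by simp)
    (fun m x => tmul_add m (g x) (h x)) (fun u v hu hv => ?_) u
  simp only [map_add, hu, hv]; abel

theorem map_zero_left (u : BalTensor A M X) : map M B (0 : X →ₗ[A] Y) u = 0 := by
  refine induction (p := fun u => map M B (0 : X →ₗ[A] Y) u = 0) (by simp)
    (fun m x => tmul_zero m) (fun u v hu hv => ?_) u
  simp only [map_add, hu, hv, add_zero]

end BalTensor

end BalTensor

/-! ### Trivial extensions -/

/-- Modules over a trivial extension `B ⊕ M`: a `B`-module `Y` with a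
structure map `ψ : M ⊗_B Y → Y` (given as a balanced `B`-linear biadditive map) such that
`ψ ∘ (M ⊗ ψ) = 0`. The action is `(b, m) y = b y + ψ(m ⊗ y)`. -/
@[reducible]
def moduleOfStructureMap {B M Y : Type u} [Ring B] [AddCommGroup M] [Module B M] [Module Bᵐᵒᵖ M]
    [SMulCommClass B Bᵐᵒᵖ M] [AddCommGroup Y] [Module B Y] (ψ : M →+ Y →+ Y)
    (hl : ∀ (b : B) m y, ψ (b • m) y = b • ψ m y)
    (hb : ∀ (b : B) m y, ψ (op b • m) y = ψ m (b • y))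
    (hz : ∀ m n y, ψ m (ψ n y) = 0) : Module (TrivSqZeroExt B M) Y where
  smul τ y := τ.fst • y + ψ τ.snd y
  one_smul y := by
    change (1 : B) • y + ψ 0 y = y
    simp
  mul_smul τ σ y := by
    change (τ.fst * σ.fst) • y + ψ (τ.fst • σ.snd + op σ.fst • τ.snd) y =
      τ.fst • (σ.fst • y + ψ σ.snd y) + ψ τ.snd (σ.fst • y + ψ σ.snd y)
    simp only [map_add, AddMonoidHom.add_apply, hl, hb, hz, smul_add, mul_smul]
    abel
  smul_zero τ := by
    change τ.fst • (0 : Y) + ψ τ.snd 0 = 0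
    simp
  smul_add τ y z := by
    change τ.fst • (y + z) + ψ τ.snd (y + z) = (τ.fst • y + ψ τ.snd y) + (τ.fst • z + ψ τ.snd z)
    simp only [smul_add, map_add]; abel
  add_smul τ σ y := by
    change (τ.fst + σ.fst) • y + ψ (τ.snd + σ.snd) y =
      (τ.fst • y + ψ τ.snd y) + (σ.fst • y + ψ σ.snd y)
    simp only [add_smul, map_add, AddMonoidHom.add_apply]; abel
  zero_smul y := by
    change (0 : B) • y + ψ 0 y = 0
    simp

section TrivExt

variable (R E A : Type u) [CommRing R] [AddCommGroup E] [Module R E] [Ring A] [Algebra R A]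

instance : IsScalarTower R Aᵐᵒᵖ A where
  smul_assoc r a x := by
    change x * unop (r • a) = r • (x * unop a)
    simp

/-- The trivial extension algebra `T(A) = A ⊕ D A`, with multiplication
`(a, f)(b, g) = (ab, a g + f b)`. -/
abbrev TrivExt : Type u := TrivSqZeroExt A (Dual R E A)

/-- The restriction of a `T(A)`-module to a module over the subalgebra `A`; it keeps both
actions. -/
def Res (_R _E _A X : Type u) : Type u := X

variable (X : Type u) [AddCommGroup X] [Module (TrivExt R E A) X]

instance : AddCommGroup (Res R E A X) := inferInstanceAs (AddCommGroup X)

instance : Module (TrivExt R E A) (Res R E A X) := inferInstanceAs (Module (TrivExt R E A) X)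

instance : Module A (Res R E A X) :=
  Module.compHom X (TrivSqZeroExt.inlHom A (Dual R E A))

instance : IsScalarTower A (TrivExt R E A) (Res R E A X) where
  smul_assoc a τ x := by
    have h : a • τ = TrivSqZeroExt.inl a * τ := by
      ext <;> simp
    rw [h, mul_smul]; rfl

end TrivExt

/-! ### The bimodule `T` and the canonical maps -/

section Bimodule

variable (R E A B T : Type u) [CommRing R] [AddCommGroup E] [Module R E]
  [Ring A] [Algebra R A] [Ring B] [Algebra R B]
  [AddCommGroup T] [Module R T] [Module A T] [Module Bᵐᵒᵖ T]
  [IsScalarTower R A T] [IsScalarTower R Bᵐᵒᵖ T] [SMulCommClass A Bᵐᵒᵖ T]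

/-- The `A`-`B`-bimodule `T` is faithfully balanced: the structure maps
`A → End_{Bᵒᵖ}(T)` and `Bᵒᵖ → End_A(T)` are isomorphisms. -/
def IsFaithfullyBalanced (A B T : Type u) [Ring A] [Ring B] [AddCommGroup T] [Module A T]
    [Module Bᵐᵒᵖ T] [SMulCommClass A Bᵐᵒᵖ T] : Prop :=
  haveI : SMulCommClass Bᵐᵒᵖ A T := SMulCommClass.symm A Bᵐᵒᵖ T
  Function.Bijective (Module.toModuleEnd Bᵐᵒᵖ (S := A) T) ∧
    Function.Bijective (Module.toModuleEnd A (S := Bᵐᵒᵖ) T)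

/-- Right multiplication by `b`, an endomorphism of the left `A`-module `T`. -/
def rightMul {A B T : Type u} [Ring A] [Ring B] [AddCommGroup T] [Module A T]
    [Module Bᵐᵒᵖ T] [SMulCommClass A Bᵐᵒᵖ T] (b : B) : T →ₗ[A] T where
  toFun t := op b • t
  map_add' := smul_add _
  map_smul' a t := (smul_comm a (op b) t).symm

/-- The `B`-linear map `δ : D T ⊗_A T → D B`, `δ(f ⊗ t)(b) = f(t b)`. -/
def delta : BalTensor A (Dual R E T) T →ₗ[B] Dual R E B :=
  BalTensor.liftLinear
    (AddMonoidHom.mk' (fun f => AddMonoidHom.mk'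
      (fun t => (show Dual R E B from
        { toFun := fun b => f (op b • t)
          map_add' := fun b c => by rw [MulOpposite.op_add, add_smul, map_add]
          map_smul' := fun r b => by
            rw [MulOpposite.op_smul, smul_assoc, map_smul]; rfl }))
      fun s t => by
        ext b
        exact (congrArg f (smul_add (op b) s t)).trans (map_add f _ _))
      fun f g => by ext t b; rfl)
    (fun f a t => by
      ext b
      exact congrArg f (smul_comm a (op b) t))
    (fun b f t => by
      ext c
      exact congrArg f (mul_smul (op b) (op c) t).symm)

theorem delta_tmul (f : Dual R E T) (t : T) (b : B) :
    delta R E A B T (BalTensor.tmul A f t) b = f (op b • t) := rfl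

variable {R E A B T}

/-- The element `δ'(t ⊗ f)` of `D A`, where `δ' : T ⊗_B D T → D A` is the canonical map
`δ'(t ⊗ f)(a) = f(a t)`. -/
def deltaPrime (t : T) (f : Dual R E T) : Dual R E A :=
  (show A →ₗ[R] E from
    { toFun := fun a => f (a • t)
      map_add' := fun a b => by rw [add_smul, map_add]
      map_smul' := fun r a => by rw [smul_assoc, map_smul]; rfl })

@[simp] theorem deltaPrime_apply (t : T) (f : Dual R E T) (a : A) :
    deltaPrime t f a = f (a • t) := rfl

/-- The inverse of `δ`. -/
def deltaInv (hδ : Function.Bijective (delta R E A B T)) :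
    Dual R E B ≃ₗ[B] BalTensor A (Dual R E T) T :=
  (LinearEquiv.ofBijective (delta R E A B T) hδ).symm

theorem deltaInv_delta (hδ : Function.Bijective (delta R E A B T))
    (u : BalTensor A (Dual R E T) T) : deltaInv hδ (delta R E A B T u) = u :=
  (LinearEquiv.ofBijective (delta R E A B T) hδ).symm_apply_apply u

theorem delta_rightMul (b : B) (u : BalTensor A (Dual R E T) T) :
    delta R E A B T (BalTensor.map (Dual R E T) B (rightMul b) u) = op b • delta R E A B T u := by
  refine BalTensor.induction (p := fun u => delta R E A B T
    (BalTensor.map (Dual R E T) B (rightMul b) u) = op b • delta R E A B T u) (by simp)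
    (fun f t => ?_) (fun u v hu hv => ?_) u
  · ext c
    exact congrArg f (mul_smul (op c) (op b) t).symm
  · simp only [map_add, hu, hv, smul_add]

theorem deltaInv_op_smul (hδ : Function.Bijective (delta R E A B T)) (b : B) (f : Dual R E B) :
    deltaInv hδ (op b • f) = BalTensor.map (Dual R E T) B (rightMul b) (deltaInv hδ f) := by
  obtain ⟨u, rfl⟩ := hδ.2 f
  rw [← delta_rightMul, deltaInv_delta, deltaInv_delta]

end Bimodule

/-! ### The functor `L` and Wakamatsu's construction -/

/-- `Hom_A(T, V)`. -/
def HomMod (A T V : Type u) [Ring A] [AddCommGroup T] [Module A T] [AddCommGroup V] [Module A V] :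
    Type u := T →ₗ[A] V

namespace HomMod

variable {A B T V : Type u} [Ring A] [Ring B] [AddCommGroup T] [Module A T]
  [Module Bᵐᵒᵖ T] [SMulCommClass A Bᵐᵒᵖ T] [AddCommGroup V] [Module A V]

instance : AddCommGroup (HomMod A T V) := inferInstanceAs (AddCommGroup (T →ₗ[A] V))

instance : FunLike (HomMod A T V) T V := inferInstanceAs (FunLike (T →ₗ[A] V) T V)

instance : LinearMapClass (HomMod A T V) A T V :=
  inferInstanceAs (LinearMapClass (T →ₗ[A] V) A T V)

@[ext] theorem ext {h k : HomMod A T V} (e : ∀ t, h t = k t) : h = k := LinearMap.ext e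

/-- The left `B`-action `(b h)(t) = h(t b)`. -/
instance : Module B (HomMod A T V) where
  smul b h := (show T →ₗ[A] V from h).comp (rightMul b)
  one_smul h := by ext t; exact congrArg h (one_smul Bᵐᵒᵖ t)
  mul_smul b c h := by ext t; exact congrArg h (mul_smul (op c) (op b) t)
  smul_zero b := rfl
  smul_add b h k := rfl
  add_smul b c h := by
    ext t
    exact (congrArg h (add_smul (op b) (op c) t)).trans (map_add h _ _)
  zero_smul h := by ext t; exact (congrArg h (zero_smul Bᵐᵒᵖ t)).trans (map_zero h)

theorem smul_apply (b : B) (h : HomMod A T V) (t : T) : (b • h) t = h (op b • t) := rfl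

/-- View an element of `Hom_A(T, V)` as a linear map. -/
def toLin (h : HomMod A T V) : T →ₗ[A] V := h

variable (B T) in
/-- `Hom_A(T, g)`. -/
def map {V' : Type u} [AddCommGroup V'] [Module A V'] (g : V →ₗ[A] V') :
    HomMod A T V →ₗ[B] HomMod A T V' where
  toFun h := g.comp h.toLin
  map_add' _ _ := LinearMap.comp_add _ _ _
  map_smul' _ _ := rfl

end HomMod

section Construction

variable {R E A B T : Type u} [CommRing R] [AddCommGroup E] [Module R E]
  [Ring A] [Algebra R A] [Ring B] [Algebra R B]
  [AddCommGroup T] [Module R T] [Module A T] [Module Bᵐᵒᵖ T]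
  [IsScalarTower R A T] [IsScalarTower R Bᵐᵒᵖ T] [SMulCommClass A Bᵐᵒᵖ T]

/-- The underlying group of `L(V) = Hom_A(T, V) ⊕ (D T ⊗_A V)`. -/
def LMod (_ : Function.Bijective (delta R E A B T)) (V : Type u) [AddCommGroup V] [Module A V] :
    Type u :=
  HomMod A T V × BalTensor A (Dual R E T) V

namespace LMod

variable (hδ : Function.Bijective (delta R E A B T))
variable {V V' : Type u} [AddCommGroup V] [Module A V] [AddCommGroup V'] [Module A V']

instance : AddCommGroup (LMod hδ V) :=
  inferInstanceAs (AddCommGroup (HomMod A T V × BalTensor A (Dual R E T) V))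

instance : Module B (LMod hδ V) :=
  inferInstanceAs (Module B (HomMod A T V × BalTensor A (Dual R E T) V))

/-- The composition `(D T ⊗ ε_V) ∘ (δ⁻¹ ⊗ Hom_A(T, V)) : D B ⊗_B Hom_A(T, V) → D T ⊗_A V`,
where `ε_V(t ⊗ h) = h(t)`: if `δ⁻¹ f = ∑ gᵢ ⊗ tᵢ`, it sends `f ⊗ h` to `∑ gᵢ ⊗ h(tᵢ)`. -/
def star (f : Dual R E B) (h : HomMod A T V) : BalTensor A (Dual R E T) V :=
  BalTensor.map (Dual R E T) B h.toLin (deltaInv hδ f)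

theorem star_add_right (f : Dual R E B) (h k : HomMod A T V) :
    star hδ f (h + k) = star hδ f h + star hδ f k := BalTensor.map_add_left _ _ _

theorem star_zero_right (f : Dual R E B) : star hδ f (0 : HomMod A T V) = 0 :=
  BalTensor.map_zero_left _

theorem star_neg_right (f : Dual R E B) (h : HomMod A T V) : star hδ f (-h) = -star hδ f h :=
  eq_neg_of_add_eq_zero_left (by rw [← star_add_right, neg_add_cancel, star_zero_right])

theorem star_add_left (f g : Dual R E B) (h : HomMod A T V) :
    star hδ (f + g) h = star hδ f h + star hδ g h := by simp only [star, map_add]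

theorem star_smul (b : B) (f : Dual R E B) (h : HomMod A T V) :
    star hδ (b • f) h = b • star hδ f h := by simp only [star, map_smul]

theorem star_op_smul (b : B) (f : Dual R E B) (h : HomMod A T V) :
    star hδ (op b • f) h = star hδ f (b • h) := by
  simp only [star, deltaInv_op_smul, BalTensor.map_map]
  rfl

theorem map_star (g : V →ₗ[A] V') (f : Dual R E B) (h : HomMod A T V) :
    BalTensor.map (Dual R E T) B g (star hδ f h) = star hδ f (HomMod.map B T g h) :=
  BalTensor.map_map _ _ _

/-- The structure map of the `T(B)`-module `L(V)`: it sends `f ⊗ (h, z)` to `(0, star f h)`. -/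
def structureMap : Dual R E B →+ LMod hδ V →+ LMod hδ V :=
  AddMonoidHom.mk'
    (fun f => AddMonoidHom.mk' (fun p => ((0, star hδ f p.1) :
        HomMod A T V × BalTensor A (Dual R E T) V))
      fun p q => Prod.ext (add_zero _).symm (star_add_right hδ f p.1 q.1))
    fun f g => by
      ext p
      exact Prod.ext (add_zero _).symm (star_add_left hδ f g p.1)

/-- The `T(B)`-module structure of `L(V)`. -/
instance module : Module (TrivExt R E B) (LMod hδ V) :=
  moduleOfStructureMap (structureMap hδ)
    (fun b f p => Prod.ext (smul_zero b).symm (star_smul hδ b f p.1))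
    (fun b f p => Prod.ext rfl (star_op_smul hδ b f p.1))
    (fun f _ _ => Prod.ext rfl (star_zero_right hδ f))

theorem smul_def (τ : TrivExt R E B) (p : LMod hδ V) :
    τ • p = τ.fst • p + structureMap hδ τ.snd p := rfl

instance : IsScalarTower B (TrivExt R E B) (LMod hδ V) where
  smul_assoc b τ p := by
    rw [smul_def, smul_def, smul_add, TrivSqZeroExt.fst_smul, TrivSqZeroExt.snd_smul, smul_assoc]
    congr 1
    exact Prod.ext (smul_zero b).symm (star_smul hδ b τ.snd p.1)

/-- `L(g) = Hom_A(T, g) ⊕ (D T ⊗ g)`, a map of `T(B)`-modules. -/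
def map (g : V →ₗ[A] V') : LMod hδ V →ₗ[TrivExt R E B] LMod hδ V' where
  toFun p := (HomMod.map B T g p.1, BalTensor.map (Dual R E T) B g p.2)
  map_add' p q := Prod.ext (map_add (HomMod.map B T g) p.1 q.1)
    (map_add (BalTensor.map (Dual R E T) B g) p.2 q.2)
  map_smul' τ p := by
    refine Prod.ext ?_ ?_
    · change HomMod.map B T g (τ.fst • p.1 + 0) = τ.fst • HomMod.map B T g p.1 + 0
      simp only [add_zero, map_smul]
    · change BalTensor.map (Dual R E T) B g (τ.fst • p.2 + star hδ τ.snd p.1) =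
        τ.fst • BalTensor.map (Dual R E T) B g p.2 + star hδ τ.snd (HomMod.map B T g p.1)
      rw [map_add, map_smul, map_star]

end LMod

section OfModule

set_option linter.unusedSectionVars false

variable {X X' : Type u} [AddCommGroup X] [Module A X] [Module (TrivExt R E A) X]
  [IsScalarTower A (TrivExt R E A) X]
  [AddCommGroup X'] [Module A X'] [Module (TrivExt R E A) X']
  [IsScalarTower A (TrivExt R E A) X']

/-- The structure map `φ : D A ⊗_A X → X` of a `T(A)`-module, `φ(f ⊗ x) = (0, f) x`. -/
def phi (f : Dual R E A) (x : X) : X := (TrivSqZeroExt.inr f : TrivExt R E A) • x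

theorem phi_add_left (f g : Dual R E A) (x : X) : phi (f + g) x = phi f x + phi g x := by
  simp only [phi, TrivSqZeroExt.inr_add, add_smul]

theorem phi_add_right (f : Dual R E A) (x y : X) : phi f (x + y) = phi f x + phi f y :=
  smul_add _ _ _

theorem phi_smul (a : A) (f : Dual R E A) (x : X) : phi (a • f) x = a • phi f x := by
  simp only [phi, TrivSqZeroExt.inr_smul, smul_assoc]

theorem phi_op_smul (a : A) (f : Dual R E A) (x : X) : phi (op a • f) x = phi f (a • x) := by
  have h : (a • x) = ((TrivSqZeroExt.inl a : TrivExt R E A)) • x := by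
    have : (TrivSqZeroExt.inl a : TrivExt R E A) = a • 1 := by ext <;> simp
    rw [this, smul_assoc, one_smul]
  rw [h, phi, phi, ← mul_smul]
  congr 1
  ext <;> simp

theorem phi_phi (f g : Dual R E A) (x : X) : phi f (phi g x) = 0 := by
  rw [phi, phi, ← mul_smul, TrivSqZeroExt.inr_mul_inr, zero_smul]

variable (R E A B T X) in
/-- The composition `Hom_A(T, φ ∘ (δ' ⊗ X)) ∘ η_{D T ⊗_A X} : D T ⊗_A X → Hom_A(T, X)`, where
`η(u)(t) = t ⊗ u`: it sends `k ⊗ x` to `t ↦ φ(δ'(t ⊗ k) ⊗ x)`. -/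
def adj : BalTensor A (Dual R E T) X →ₗ[B] HomMod A T X :=
  BalTensor.liftLinear
    (AddMonoidHom.mk' (fun k => AddMonoidHom.mk'
      (fun x => (show HomMod A T X from
        { toFun := fun t => phi (deltaPrime t k : Dual R E A) x
          map_add' := fun s t => by
            rw [← phi_add_left]; congr 1; ext a
            exact (congrArg k (smul_add a s t)).trans (map_add k _ _)
          map_smul' := fun a t => by
            rw [RingHom.id_apply, ← phi_smul]; congr 1; ext b
            exact congrArg k (mul_smul b a t).symm }))
      fun x y => by ext t; exact phi_add_right _ _ _)
      fun k l => by ext x t; exact phi_add_left (deltaPrime t k) (deltaPrime t l) x)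
    (fun k a x => by
      ext t
      refine Eq.trans ?_ (phi_op_smul a (deltaPrime t k) x)
      change phi (deltaPrime t (op a • k) : Dual R E A) x = _
      congr 1; ext b
      exact congrArg k (mul_smul a b t).symm)
    (fun b k x => by
      ext t
      change phi (deltaPrime t (b • k) : Dual R E A) x =
        phi (deltaPrime (op b • t) k : Dual R E A) x
      congr 1; ext a
      exact congrArg k (smul_comm a (op b) t).symm)

theorem adj_tmul (k : Dual R E T) (x : X) (t : T) :
    adj R E A B T X (BalTensor.tmul A k x) t = phi (deltaPrime t k : Dual R E A) x := rfl

/-- The composition of `D T ⊗ adj(u)` with `adj` vanishes, since `φ ∘ (D A ⊗ φ) = 0`. -/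
theorem adj_map_adj (u : BalTensor A (Dual R E T) X) (w : BalTensor A (Dual R E T) T) :
    adj R E A B T X (BalTensor.map (Dual R E T) B (adj R E A B T X u).toLin w) = 0 := by
  refine BalTensor.induction (p := fun w => adj R E A B T X
    (BalTensor.map (Dual R E T) B (adj R E A B T X u).toLin w) = 0) (by simp)
    (fun g s => ?_) (fun v w hv hw => ?_) w
  · refine BalTensor.induction (p := fun u => adj R E A B T X
      (BalTensor.map (Dual R E T) B (adj R E A B T X u).toLin (BalTensor.tmul A g s)) = 0) ?_
      (fun k x => ?_) (fun v w hv hw => ?_) u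
    · rw [map_zero]
      exact (congrArg _ (BalTensor.map_zero_left _)).trans (map_zero _)
    · ext t
      exact phi_phi _ _ _
    · have h : BalTensor.map (Dual R E T) B (adj R E A B T X (v + w)).toLin
          (BalTensor.tmul A g s) =
          BalTensor.map (Dual R E T) B (adj R E A B T X v).toLin (BalTensor.tmul A g s) +
          BalTensor.map (Dual R E T) B (adj R E A B T X w).toLin (BalTensor.tmul A g s) := (congrArg (fun l : HomMod A T X =>
            BalTensor.map (Dual R E T) B l.toLin (BalTensor.tmul A g s))
          (map_add (adj R E A B T X) v w)).trans (BalTensor.map_add_left _ _ _)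
      rw [h, map_add, hv, hw, add_zero]
  · rw [map_add, map_add, hv, hw, add_zero]

variable (hδ : Function.Bijective (delta R E A B T))

/-- The underlying group of the `T(B)`-module `D T ⊗_A X` attached to a `T(A)`-module `X`. -/
def DTMod (_ : Function.Bijective (delta R E A B T)) (X : Type u) [AddCommGroup X] [Module A X] :
    Type u := BalTensor A (Dual R E T) X

namespace DTMod

instance : AddCommGroup (DTMod hδ X) :=
  inferInstanceAs (AddCommGroup (BalTensor A (Dual R E T) X))

instance : Module B (DTMod hδ X) :=
  inferInstanceAs (Module B (BalTensor A (Dual R E T) X))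

/-- The identity map from `D T ⊗_A X` with its `T(B)`-action to `D T ⊗_A X`. -/
def out : DTMod hδ X →ₗ[B] BalTensor A (Dual R E T) X where
  toFun u := u
  map_add' _ _ := rfl
  map_smul' _ _ := rfl

theorem adj_star (f : Dual R E B) (u : BalTensor A (Dual R E T) X) :
    adj R E A B T X (LMod.star hδ f (adj R E A B T X u)) = 0 := adj_map_adj _ _

/-- The structure map
`-(D T ⊗ φ) ∘ (D T ⊗ δ' ⊗ X) ∘ (δ⁻¹ ⊗ D T ⊗_A X) : D B ⊗_B (D T ⊗_A X) → D T ⊗_A X`: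
if `δ⁻¹ f = ∑ gᵢ ⊗ tᵢ`, it sends `f ⊗ (k ⊗ x)` to `-∑ gᵢ ⊗ φ(δ'(tᵢ ⊗ k) ⊗ x)`. -/
def structureMap : Dual R E B →+ DTMod hδ X →+ DTMod hδ X :=
  AddMonoidHom.mk'
    (fun f => AddMonoidHom.mk' (fun u => -LMod.star hδ f (adj R E A B T X (out hδ u)))
      fun u v => by
        rw [map_add, map_add, LMod.star_add_right, neg_add]; rfl)
    fun f g => by
      ext u
      refine (congrArg Neg.neg (LMod.star_add_left hδ f g _)).trans ?_
      rw [neg_add]; rfl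

/-- The `T(B)`-module structure of `D T ⊗_A X`. -/
instance module : Module (TrivExt R E B) (DTMod hδ X) :=
  moduleOfStructureMap (structureMap hδ)
    (fun b f u => by
      refine (congrArg Neg.neg (LMod.star_smul hδ b f _)).trans ?_
      rw [← smul_neg]; rfl)
    (fun b f u => by
      refine (congrArg Neg.neg (LMod.star_op_smul hδ b f _)).trans ?_
      rw [← map_smul, ← map_smul]; rfl)
    (fun f g u => by
      change -LMod.star hδ f (adj R E A B T X (-LMod.star hδ g (adj R E A B T X (out hδ u)))) = 0
      rw [map_neg, adj_star, neg_zero, LMod.star_zero_right, neg_zero])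

theorem out_smul (τ : TrivExt R E B) (u : DTMod hδ X) :
    out hδ (τ • u) = τ.fst • out hδ u + -LMod.star hδ τ.snd (adj R E A B T X (out hδ u)) := rfl

end DTMod

variable {V V' : Type u} [AddCommGroup V] [Module A V] [AddCommGroup V'] [Module A V']

/-- The `T(B)`-linear map `(Δ_X, D T ⊗ α) : D T ⊗_A X → L(V)` attached to a `T(A)`-module `X` and
an `A`-linear map `α : X → V`, where `Δ_X = Hom_A(T, -α ∘ φ ∘ (δ' ⊗ X)) ∘ η_{D T ⊗_A X}`. -/
def embed (α : X →ₗ[A] V) : DTMod hδ X →ₗ[TrivExt R E B] LMod hδ V where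
  toFun u := (HomMod.map B T (-α) (adj R E A B T X (DTMod.out hδ u)),
    BalTensor.map (Dual R E T) B α (DTMod.out hδ u))
  map_add' u v := by
    simp only [map_add]; rfl
  map_smul' τ u := by
    simp only [DTMod.out_smul, map_add, map_neg, map_smul, DTMod.adj_star, LMod.map_star]
    refine Prod.ext ?_ ?_
    · change τ.fst • HomMod.map B T (-α) (adj R E A B T X (DTMod.out hδ u)) +
          -HomMod.map B T (-α) 0 = _
      rw [map_zero, neg_zero]; rfl
    · change _ = _ + LMod.star hδ τ.snd (HomMod.map B T (-α) (adj R E A B T X (DTMod.out hδ u)))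
      have h : HomMod.map B T (-α) (adj R E A B T X (DTMod.out hδ u)) =
          -HomMod.map B T α (adj R E A B T X (DTMod.out hδ u)) := rfl
      rw [h, LMod.star_neg_right]; rfl

/-- Wakamatsu's `T(B)`-module: the cokernel of `(Δ_X, D T ⊗ α) : D T ⊗_A X → L(V)`. -/
abbrev WakMod (α : X →ₗ[A] V) : Type u := LMod hδ V ⧸ LinearMap.range (embed hδ α)

/-- The square formed by `(Δ_X, D T ⊗ α)`, `D T ⊗ f`, `L(g)` and `(Δ_X', D T ⊗ α')`
commutes whenever `α' ∘ f = g ∘ α`. -/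
theorem map_embed (α : X →ₗ[A] V) (α' : X' →ₗ[A] V') (f : X →ₗ[TrivExt R E A] X')
    (g : V →ₗ[A] V') (h : α'.comp (f.restrictScalars A) = g.comp α) (u : DTMod hδ X) :
    LMod.map hδ g (embed hδ α u) =
      embed hδ α' (BalTensor.map (Dual R E T) B (f.restrictScalars A) u) := by
  refine BalTensor.induction (p := fun u : BalTensor A (Dual R E T) X =>
    LMod.map hδ g (embed hδ α (show DTMod hδ X from u)) =
      embed hδ α' (BalTensor.map (Dual R E T) B (f.restrictScalars A) u)) ?_ (fun k x => ?_)
    (fun v w hv hw => ?_) u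
  · exact (map_zero ((LMod.map hδ g).comp (embed hδ α))).trans (map_zero (embed hδ α')).symm
  · have h' (y : X) : α' (f y) = g (α y) := congrArg (fun l => l y) h
    refine Prod.ext ?_ ?_
    · ext t
      change g (-α (phi (deltaPrime t k : Dual R E A) x)) =
        -α' (phi (deltaPrime t k : Dual R E A) (f x))
      rw [map_neg, ← h', phi, map_smul]
      rfl
    · exact congrArg (BalTensor.tmul A k) (h' x).symm
  · rw [map_add]
    refine Eq.trans (map_add ((LMod.map hδ g).comp (embed hδ α)) _ _) ?_
    exact (congrArg₂ (· + ·) hv hw).trans (map_add (embed hδ α') _ _).symm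

/-- The map `S(f) : S(X) → S(X')` of cokernels induced by `D T ⊗ f` and `L(g)`, for a `T(A)`-linear
map `f` and an `A`-linear map `g` with `α' ∘ f = g ∘ α`. -/
def wakMap (α : X →ₗ[A] V) (α' : X' →ₗ[A] V') (f : X →ₗ[TrivExt R E A] X')
    (g : V →ₗ[A] V') (h : α'.comp (f.restrictScalars A) = g.comp α) :
    WakMod hδ α →ₗ[TrivExt R E B] WakMod hδ α' :=
  Submodule.mapQ _ _ (LMod.map hδ g) (by
    rintro _ ⟨u, rfl⟩
    exact ⟨_, (map_embed hδ α α' f g h u).symm⟩)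

end OfModule

end Construction

/-! ### Finiteness -/

section Finiteness

theorem finite_linearMap (R M N : Type u) [CommRing R] [IsNoetherianRing R] [AddCommGroup M]
    [Module R M] [AddCommGroup N] [Module R N] [Module.Finite R M] [Module.Finite R N] :
    Module.Finite R (M →ₗ[R] N) := by
  obtain ⟨n, g, hg⟩ := Module.Finite.exists_fin' R M
  have : Module.Finite R ((Fin n → R) →ₗ[R] N) := inferInstance
  refine Module.Finite.of_injective (LinearMap.lcomp R N g) fun a b hab => ?_
  ext m
  obtain ⟨y, rfl⟩ := hg m
  exact congrArg (fun l => l y) hab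

variable {R E : Type u} [CommRing R] [AddCommGroup E] [Module R E]

theorem mkQ_eq_zero {M : Type u} [AddCommGroup M] [Module R M] (S : Submodule R M) {x : M}
    (hx : x ∈ S) : S.mkQ x = 0 := (Submodule.Quotient.mk_eq_zero S).2 hx

/-- An injective module contains an essential extension of any submodule which is injective. -/
theorem exists_injective_hull (hE : Module.Injective R E) (N₀ : Submodule R E) :
    ∃ N : Submodule R E, N₀ ≤ N ∧ (∀ x ∈ N, x ≠ 0 → ∃ r : R, r • x ∈ N₀ ∧ r • x ≠ 0) ∧
      Module.Injective R N := by
  obtain ⟨N, hN₀, hN⟩ := zorn_le_nonempty₀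
    {N : Submodule R E | N₀ ≤ N ∧ ∀ x ∈ N, x ≠ 0 → ∃ r : R, r • x ∈ N₀ ∧ r • x ≠ 0}
    (fun c hc hch y hy => ⟨sSup c, ⟨(hc hy).1.trans (le_sSup hy), fun x hx hx0 => by
      rw [Submodule.mem_sSup_of_directed ⟨y, hy⟩ hch.directedOn] at hx
      obtain ⟨K, hK, hxK⟩ := hx
      exact (hc hK).2 x hxK hx0⟩, fun z hz => le_sSup hz⟩)
    N₀ ⟨le_rfl, fun x hx h0 => ⟨1, by simpa using hx, by simpa using h0⟩⟩
  refine ⟨N, hN₀, hN.1.2, ?_⟩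
  obtain ⟨C, -, hC⟩ := zorn_le_nonempty₀ {C : Submodule R E | Disjoint C N}
    (fun c hc hch y hy => ⟨sSup c,
      (DirectedOn.disjoint_sSup_left hch.directedOn).2 fun z hz => hc hz,
      fun z hz => le_sSup hz⟩) ⊥ disjoint_bot_left
  have hCN : ∀ x ∈ C, x ∈ N → x = 0 := Submodule.disjoint_def.1 hC.1
  obtain ⟨h, hh⟩ := hE.out (C.mkQ.comp N.subtype) (by
    rw [← LinearMap.ker_eq_bot, LinearMap.ker_eq_bot']
    intro x hx
    exact Subtype.ext (hCN x ((Submodule.Quotient.mk_eq_zero C).1 hx) x.2)) N.subtype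
  have hh' : ∀ x ∈ N, h (C.mkQ x) = x := fun x hx => hh ⟨x, hx⟩
  have key : ∀ e : E, h (C.mkQ e) ∈ N := by
    have hle : N ≤ LinearMap.range (h.comp C.mkQ) := fun x hx => ⟨x, hh' x hx⟩
    have := hN.2 (y := LinearMap.range (h.comp C.mkQ)) ⟨hN₀.trans hle, ?_⟩ hle
    · exact fun e => this ⟨e, rfl⟩
    rintro _ ⟨e, rfl⟩ hx0
    have heC : e ∉ C := fun he => hx0 (by
      change h (C.mkQ e) = 0
      rw [mkQ_eq_zero C he, map_zero])
    have hnd : ¬ Disjoint (C ⊔ Submodule.span R {e}) N := fun hd => heC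
      (hC.2 hd le_sup_left (Submodule.mem_sup_right (Submodule.mem_span_singleton_self e)))
    rw [Submodule.disjoint_def] at hnd
    push Not at hnd
    obtain ⟨n, hn, hnN, hn0⟩ := hnd
    obtain ⟨c, hc, z, hz, rfl⟩ := Submodule.mem_sup.1 hn
    obtain ⟨r, rfl⟩ := Submodule.mem_span_singleton.1 hz
    have e1 : r • h (C.mkQ e) = c + r • e := by
      rw [← hh' _ hnN, map_add, map_smul, mkQ_eq_zero C hc, zero_add,
        map_smul]
    obtain ⟨s, hs, hs0⟩ := hN.1.2 _ hnN hn0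
    refine ⟨s * r, ?_, ?_⟩
    · change (s * r) • h (C.mkQ e) ∈ N₀
      rwa [mul_smul, e1]
    · change (s * r) • h (C.mkQ e) ≠ 0
      rwa [mul_smul, e1]
  refine ⟨fun X Y _ _ _ _ f hf g => ?_⟩
  obtain ⟨k, hk⟩ := hE.out f hf (N.subtype.comp g)
  refine ⟨(LinearMap.codRestrict N (h.comp C.mkQ) key).comp k, fun x => Subtype.ext ?_⟩
  change h (C.mkQ (k (f x))) = g x
  rw [hk]
  exact hh' _ (g x).2

/-- The minimal injective cogenerator of an artinian ring is finitely generated. -/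
instance finite_of_isMinimalInjectiveCogenerator [IsArtinianRing R]
    [hE : IsMinimalInjectiveCogenerator R E] : Module.Finite R E := by
  have hf (m : MaximalSpectrum R) : ∃ f : (R ⧸ m.asIdeal) →ₗ[R] E, f 1 ≠ 0 :=
    have := m.isMaximal
    hE.cogenerator _ _ one_ne_zero
  choose f hf using hf
  set N₀ : Submodule R E := ⨆ m, LinearMap.range (f m) with hN₀
  have hfin : Module.Finite R N₀ := Module.Finite.iff_fg.2
    (Submodule.fg_iSup _ fun m => Module.Finite.iff_fg.1 inferInstance)
  obtain ⟨N, hle, hess, hinj⟩ := exists_injective_hull hE.injective N₀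
  have hcog : IsCogenerator R N := by
    intro M _ _ m hm
    have hI : LinearMap.ker (LinearMap.toSpanSingleton R M m) ≠ ⊤ := fun h => hm (by
      have : (1 : R) ∈ LinearMap.ker (LinearMap.toSpanSingleton R M m) := h ▸ trivial
      simpa using this)
    obtain ⟨P, hP, hIP⟩ := Ideal.exists_le_maximal _ hI
    let p : MaximalSpectrum R := ⟨P, hP⟩
    have hmem : ∀ x, f p x ∈ N := fun x => hle (Submodule.mem_iSup_of_mem p ⟨x, rfl⟩)
    let g : (R ⧸ LinearMap.ker (LinearMap.toSpanSingleton R M m)) →ₗ[R] N :=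
      Submodule.liftQ _ ((LinearMap.codRestrict N (f p) hmem).comp (Submodule.mkQ P)) (by
        intro x hx
        have : Submodule.mkQ P x = 0 := (Submodule.Quotient.mk_eq_zero P).2 (hIP hx)
        rw [LinearMap.mem_ker, LinearMap.comp_apply, this, map_zero])
    obtain ⟨k, hk⟩ := hinj.out
      (Submodule.liftQ _ (LinearMap.toSpanSingleton R M m) le_rfl)
      (by rw [← LinearMap.ker_eq_bot]; exact Submodule.ker_liftQ_eq_bot _ _ _ le_rfl) g
    refine ⟨k, fun h0 => hf p ?_⟩
    have h1 := hk (Submodule.Quotient.mk 1)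
    have h2 : k m = g (Submodule.Quotient.mk 1) := by
      rw [← h1]; exact congrArg k (one_smul R m).symm
    rw [h0] at h2
    exact (congrArg Subtype.val h2).symm
  have htop := hE.minimal N hinj hcog
  have main : ∀ (M : Type u) [AddCommGroup M] [Module R M], IsFiniteLength R M →
      Module.Finite R (M →ₗ[R] E) := by
    intro M _ _ hM
    induction hM with
    | @of_subsingleton M _ _ _ =>
      have : Subsingleton (M →ₗ[R] E) := ⟨fun a b => by
        ext x; rw [Subsingleton.elim x 0, map_zero, map_zero]⟩
      infer_instance
    | @of_simple_quotient M _ _ S hS _ ih =>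
      have h1 : Module.Finite R ((M ⧸ S) →ₗ[R] E) := by
        have : Module.Finite R ((M ⧸ S) →ₗ[R] N₀) := finite_linearMap _ _ _
        refine Module.Finite.of_surjective (LinearMap.compRight R N₀.subtype) fun g => ?_
        have hg : ∀ x, g x ∈ N₀ := by
          intro x
          by_cases hx : g x = 0
          · rw [hx]; exact N₀.zero_mem
          obtain ⟨r, hr, hr0⟩ := hess (g x) (htop ▸ trivial) hx
          rw [← map_smul] at hr hr0
          have hrx : r • x ≠ 0 := fun h => hr0 (by rw [h, map_zero])
          obtain ⟨s, hs⟩ := Submodule.mem_span_singleton.1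
            ((IsSimpleModule.span_singleton_eq_top R hrx) ▸ trivial :
              x ∈ Submodule.span R {r • x})
          rw [← hs, map_smul]
          exact N₀.smul_mem _ hr
        exact ⟨LinearMap.codRestrict N₀ g hg, by ext x; rfl⟩
      have : IsNoetherian R ((M ⧸ S) →ₗ[R] E) := isNoetherian_of_isNoetherianRing_of_finite _ _
      have : IsNoetherian R (S →ₗ[R] E) := isNoetherian_of_isNoetherianRing_of_finite _ _
      have : IsNoetherian R (M →ₗ[R] E) := isNoetherian_of_range_eq_ker
        (LinearMap.lcomp R E S.mkQ) (LinearMap.lcomp R E S.subtype) (by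
          ext g
          constructor
          · rintro ⟨k, rfl⟩
            rw [LinearMap.mem_ker]
            ext x
            change k (S.mkQ x) = 0
            rw [mkQ_eq_zero S x.2, map_zero]
          · intro hg
            exact ⟨S.liftQ g fun x hx => congrArg (fun l : S →ₗ[R] E => l ⟨x, hx⟩) hg, by ext x; rfl⟩)
      infer_instance
  have := main R (isFiniteLength_iff_isNoetherian_isArtinian.2 ⟨inferInstance, inferInstance⟩)
  exact Module.Finite.equiv (LinearMap.ringLmapEquivSelf R R E)

end Finiteness

section Artin

variable (R E A : Type u) [CommRing R] [IsArtinianRing R] [AddCommGroup E] [Module R E]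
  [Module.Finite R E] [Ring A] [Algebra R A] [Module.Finite R A]

theorem finite_dual (M : Type u) [AddCommGroup M] [Module R M] [Module.Finite R M] :
    Module.Finite R (M →ₗ[R] E) := finite_linearMap _ _ _

instance : Module.Finite A (TrivExt R E A) := by
  let _ : Module R (Dual R E A) := inferInstanceAs (Module R (A →ₗ[R] E))
  have : Module.Finite R (Dual R E A) := finite_dual R E A
  have : IsScalarTower R A (Dual R E A) := ⟨fun r a f => by
    ext b
    change f (b * (r • a)) = r • f (b * a)
    rw [mul_smul_comm, map_smul]⟩
  have h2 : Module.Finite A (Dual R E A) := Module.Finite.of_restrictScalars_finite R A _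
  exact inferInstanceAs (Module.Finite A (A × Dual R E A))

instance : IsScalarTower A (TrivExt R E A) (TrivExt R E A) where
  smul_assoc a σ τ := by
    ext
    · simp [mul_assoc]
    · simp [mul_smul, mul_assoc]

/-- The trivial extension of an artin algebra is noetherian. -/
instance : IsNoetherianRing (TrivExt R E A) := by
  have : IsNoetherianRing A := IsNoetherianRing.of_finite R A
  have : IsNoetherian A (TrivExt R E A) := isNoetherian_of_isNoetherianRing_of_finite _ _
  exact isNoetherian_of_tower A this

instance (X : Type u) [AddCommGroup X] [Module (TrivExt R E A) X]
    [Module.Finite (TrivExt R E A) X] : Module.Finite A (Res R E A X) :=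
  have : Module.Finite (TrivExt R E A) (Res R E A X) :=
    inferInstanceAs (Module.Finite (TrivExt R E A) X)
  Module.Finite.trans (TrivExt R E A) (Res R E A X)

variable {R E A}

variable {B T : Type u} [Ring B] [Algebra R B]
  [AddCommGroup T] [Module R T] [Module A T] [Module Bᵐᵒᵖ T]
  [IsScalarTower R A T] [IsScalarTower R Bᵐᵒᵖ T] [SMulCommClass A Bᵐᵒᵖ T]
  [Module.Finite A T] (hδ : Function.Bijective (delta R E A B T))
  (V : Type u) [AddCommGroup V] [Module A V] [Module.Finite A V]

instance : Module.Finite B (LMod hδ V) := by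
  have hT : Module.Finite R T := Module.Finite.trans A T
  let _ : Module R V := Module.compHom V (algebraMap R A)
  have : IsScalarTower R A V := ⟨fun r a v => by
    rw [Algebra.smul_def, mul_smul]; rfl⟩
  have hV : Module.Finite R V := Module.Finite.trans A V
  have h1 : Module.Finite B (HomMod A T V) := by
    have : IsNoetherian R (T →ₗ[R] V) :=
      have := finite_linearMap R T V
      isNoetherian_of_isNoetherianRing_of_finite _ _
    let _ : Module R (HomMod A T V) := Module.compHom _ (algebraMap R B)
    have : IsScalarTower R B (HomMod A T V) := ⟨fun r a v => by
      rw [Algebra.smul_def, mul_smul]; rfl⟩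
    have hsm (r : R) (t : T) : op (algebraMap R B r) • t = r • t :=
      algebraMap_smul Bᵐᵒᵖ r t
    let F : HomMod A T V →ₗ[R] (T →ₗ[R] V) :=
      { toFun := fun h => h.toLin.restrictScalars R
        map_add' := fun _ _ => rfl
        map_smul' := fun r h => by
          ext t
          change h.toLin (op (algebraMap R B r) • t) = r • h.toLin t
          rw [hsm, ← algebraMap_smul A r t, map_smul, algebraMap_smul] }
    have : Module.Finite R (HomMod A T V) := Module.Finite.of_injective F fun a b hab => by
      ext t; exact congrArg (fun l : T →ₗ[R] V => l t) hab
    exact Module.Finite.of_restrictScalars_finite R B _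
  have h2 : Module.Finite B (BalTensor A (Dual R E T) V) := by
    let _ : Module R (BalTensor A (Dual R E T) V) := Module.compHom _ (algebraMap R B)
    have : IsScalarTower R B (BalTensor A (Dual R E T) V) := ⟨fun r a v => by
      rw [Algebra.smul_def, mul_smul]; rfl⟩
    let _ : Module R (Dual R E T) := inferInstanceAs (Module R (T →ₗ[R] E))
    have : Module.Finite R (Dual R E T) := finite_dual R E T
    have hr (r : R) (f : Dual R E T) (v : V) :
        BalTensor.tmul A (r • f) v = r • BalTensor.tmul A f v := by
      change _ = BalTensor.tmul A (algebraMap R B r • f) v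
      congr 1; ext t
      change r • f t = f (op (algebraMap R B r) • t)
      rw [← map_smul]
      exact congrArg f (algebraMap_smul Bᵐᵒᵖ r t).symm
    have hr' (r : R) (f : Dual R E T) (v : V) :
        BalTensor.tmul A f (r • v) = r • BalTensor.tmul A f v := by
      rw [← hr]
      change BalTensor.tmul A f (algebraMap R A r • v) = _
      rw [← BalTensor.smul_tmul]
      congr 1; ext t
      change f (algebraMap R A r • t) = r • f t
      rw [algebraMap_smul, map_smul]
    let F : Dual R E T ⊗[R] V →ₗ[R] BalTensor A (Dual R E T) V :=
      TensorProduct.lift (LinearMap.mk₂ R (BalTensor.tmul A) BalTensor.add_tmul hr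
        BalTensor.tmul_add hr')
    have : Module.Finite R (BalTensor A (Dual R E T) V) := Module.Finite.of_surjective F fun u => by
      refine BalTensor.induction (p := fun u => ∃ a, F a = u) ⟨0, map_zero F⟩
        (fun f v => ⟨f ⊗ₜ v, rfl⟩) (fun u v ⟨a, ha⟩ ⟨b, hb⟩ => ⟨a + b, ?_⟩) u
      rw [map_add, ha, hb]
    exact Module.Finite.of_restrictScalars_finite R B _
  exact inferInstanceAs (Module.Finite B (HomMod A T V × BalTensor A (Dual R E T) V))

instance : Module.Finite (TrivExt R E B) (LMod hδ V) :=
  Module.Finite.of_restrictScalars_finite B (TrivExt R E B) _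

end Artin

/-! ### Frobenius categories and their stable categories -/

section Frobenius

open CategoryTheory CategoryTheory.Limits
open scoped ZeroObject

set_option linter.unusedSectionVars false

universe v w v' w'

variable (𝒜 : Type w) [Category.{v} 𝒜] [Abelian 𝒜]

/-- A Frobenius abelian category: there are enough projectives and enough injectives, and the
projective objects coincide with the injective objects. -/
class IsFrobenius : Prop where
  enoughProjectives : EnoughProjectives 𝒜
  enoughInjectives : EnoughInjectives 𝒜
  projective_iff_injective : ∀ X : 𝒜, Projective X ↔ Injective X

attribute [instance] IsFrobenius.enoughProjectives IsFrobenius.enoughInjectives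

variable {𝒜} in
/-- The morphism `f` factors through a projective object. -/
def FactorsThroughProjective {X Y : 𝒜} (f : X ⟶ Y) : Prop :=
  ∃ (P : 𝒜) (_ : Projective P) (a : X ⟶ P) (b : P ⟶ Y), a ≫ b = f

namespace FactorsThroughProjective

variable {𝒜} {X Y Z : 𝒜}

theorem add {f g : X ⟶ Y} (hf : FactorsThroughProjective f) (hg : FactorsThroughProjective g) :
    FactorsThroughProjective (f + g) := by
  obtain ⟨P, _, a, b, rfl⟩ := hf
  obtain ⟨Q, _, c, d, rfl⟩ := hg
  exact ⟨P ⊞ Q, inferInstance, biprod.lift a c, biprod.desc b d, by simp⟩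

theorem neg {f : X ⟶ Y} (hf : FactorsThroughProjective f) : FactorsThroughProjective (-f) := by
  obtain ⟨P, hP, a, b, rfl⟩ := hf
  exact ⟨P, hP, -a, b, by simp⟩

theorem zero : FactorsThroughProjective (0 : X ⟶ Y) := ⟨0, inferInstance, 0, 0, by simp⟩

theorem comp_left (e : X ⟶ Y) {f : Y ⟶ Z} (hf : FactorsThroughProjective f) :
    FactorsThroughProjective (e ≫ f) := by
  obtain ⟨P, hP, a, b, rfl⟩ := hf
  exact ⟨P, hP, e ≫ a, b, by simp⟩

theorem comp_right {f : X ⟶ Y} (hf : FactorsThroughProjective f) (e : Y ⟶ Z) :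
    FactorsThroughProjective (f ≫ e) := by
  obtain ⟨P, hP, a, b, rfl⟩ := hf
  exact ⟨P, hP, a, b ≫ e, by simp⟩

end FactorsThroughProjective

/-- Two parallel morphisms are identified in the stable category when their difference factors
through a projective object. -/
def stableRel : HomRel 𝒜 := fun _ _ f g => FactorsThroughProjective (f - g)

instance : Congruence (stableRel 𝒜) where
  comp_left e f g h := by
    have := FactorsThroughProjective.comp_left e h
    rwa [Preadditive.comp_sub] at this
  comp_right e h := by
    have := FactorsThroughProjective.comp_right h e
    rwa [Preadditive.sub_comp] at this
  equivalence :=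
    { refl := fun f => by
        change FactorsThroughProjective (f - f)
        rw [sub_self]; exact .zero
      symm := fun {f g} h => by
        have := FactorsThroughProjective.neg h
        rwa [neg_sub] at this
      trans := fun {f g k} h h' => by
        have := FactorsThroughProjective.add h h'
        rwa [sub_add_sub_cancel] at this }

/-- The stable category of `𝒜` modulo projectives. -/
abbrev StableCat : Type w := CategoryTheory.Quotient (stableRel 𝒜)

/-- The canonical functor from `𝒜` to its stable category. -/
abbrev toStable : 𝒜 ⥤ StableCat 𝒜 := CategoryTheory.Quotient.functor (stableRel 𝒜)

instance : Preadditive (StableCat 𝒜) :=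
  CategoryTheory.Quotient.preadditive (stableRel 𝒜) fun _ _ f₁ f₂ g₁ g₂ hf hg => by
    have := FactorsThroughProjective.add hf hg
    rwa [← add_sub_add_comm] at this

variable {𝒜}

section Suspension

variable [EnoughInjectives 𝒜]

/-- The cokernel `Σ X` in the fixed exact sequence `0 → X → I(X) → Σ X → 0` with `I(X)`
injective. -/
def cosyzygy (X : 𝒜) : 𝒜 := cokernel (Injective.ι X)

/-- The epimorphism `d_X : I(X) → Σ X`. -/
def cosyzygyπ (X : 𝒜) : Injective.under X ⟶ cosyzygy X := cokernel.π (Injective.ι X)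

/-- A lift `Σ X → Σ Y` of the morphism `f : X → Y`, obtained from an extension `I(X) → I(Y)`. -/
def cosyzygyMap {X Y : 𝒜} (f : X ⟶ Y) : cosyzygy X ⟶ cosyzygy Y :=
  cokernel.map _ _ f (Injective.factorThru (f ≫ Injective.ι Y) (Injective.ι X))
    (Injective.comp_factorThru _ _)

theorem cosyzygyπ_map {X Y : 𝒜} (f : X ⟶ Y) : cosyzygyπ X ≫ cosyzygyMap f =
    Injective.factorThru (f ≫ Injective.ι Y) (Injective.ι X) ≫ cosyzygyπ Y :=
  cokernel.π_desc _ _ _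

end Suspension

variable [IsFrobenius 𝒜]

/-- A morphism on cosyzygies compatible with a morphism that factors through a projective object
factors through a projective object. -/
theorem FactorsThroughProjective.suspend {X Y : 𝒜} {f : X ⟶ Y} (hf : FactorsThroughProjective f)
    (e : Injective.under X ⟶ Injective.under Y) (k : cosyzygy X ⟶ cosyzygy Y)
    (he : Injective.ι X ≫ e = f ≫ Injective.ι Y) (hk : cosyzygyπ X ≫ k = e ≫ cosyzygyπ Y) :
    FactorsThroughProjective k := by
  obtain ⟨P, hP, a, b, rfl⟩ := hf
  have : Injective P := (IsFrobenius.projective_iff_injective P).1 hP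
  let a' := Injective.factorThru a (Injective.ι X)
  have ha : Injective.ι X ≫ a' = a := Injective.comp_factorThru _ _
  have h0 : Injective.ι X ≫ (e - a' ≫ b ≫ Injective.ι Y) = 0 := by
    rw [Preadditive.comp_sub, he, reassoc_of% ha, Category.assoc, sub_self]
  let s : cosyzygy X ⟶ Injective.under Y := cokernel.desc _ _ h0
  have hs : cosyzygyπ X ≫ s = e - a' ≫ b ≫ Injective.ι Y := cokernel.π_desc _ _ _
  refine ⟨Injective.under Y, (IsFrobenius.projective_iff_injective _).2 inferInstance, s,
    cosyzygyπ Y, ?_⟩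
  have hepi : Epi (cosyzygyπ X) := inferInstanceAs (Epi (cokernel.π (Injective.ι X)))
  have hz : Injective.ι Y ≫ cosyzygyπ Y = 0 := cokernel.condition _
  rw [← cancel_epi (cosyzygyπ X), reassoc_of% hs, hk, Preadditive.sub_comp, Category.assoc,
    Category.assoc, hz, comp_zero, comp_zero, sub_zero]

theorem cosyzygyMap_sound {X Y : 𝒜} {f : X ⟶ Y}
    (e : Injective.under X ⟶ Injective.under Y) (k : cosyzygy X ⟶ cosyzygy Y)
    (he : Injective.ι X ≫ e = f ≫ Injective.ι Y) (hk : cosyzygyπ X ≫ k = e ≫ cosyzygyπ Y) :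
    (toStable 𝒜).map (cosyzygyMap f) = (toStable 𝒜).map k := by
  refine CategoryTheory.Quotient.sound _ (FactorsThroughProjective.suspend (f := (0 : X ⟶ Y)) .zero
    (Injective.factorThru (f ≫ Injective.ι Y) (Injective.ι X) - e) _ ?_ ?_)
  · rw [Preadditive.comp_sub, Injective.comp_factorThru, he, sub_self, zero_comp]
  · rw [Preadditive.comp_sub, Preadditive.sub_comp, cosyzygyπ_map, hk]

variable (𝒜) in
/-- The functor `𝒜 → StableCat 𝒜`, `X ↦ Σ X`. -/
def toStableSuspension : 𝒜 ⥤ StableCat 𝒜 where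
  obj X := (toStable 𝒜).obj (cosyzygy X)
  map f := (toStable 𝒜).map (cosyzygyMap f)
  map_id X := by
    rw [cosyzygyMap_sound (f := 𝟙 X) (𝟙 _) (𝟙 _) (by simp) (by simp)]
    exact (toStable 𝒜).map_id _
  map_comp {X Y Z} f g := by
    rw [← Functor.map_comp]
    refine cosyzygyMap_sound (Injective.factorThru (f ≫ Injective.ι Y) (Injective.ι X) ≫
      Injective.factorThru (g ≫ Injective.ι Z) (Injective.ι Y)) _ ?_ ?_
    · rw [← Category.assoc, Injective.comp_factorThru, Category.assoc, Injective.comp_factorThru,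
        Category.assoc]
    · rw [← Category.assoc, cosyzygyπ_map, Category.assoc, cosyzygyπ_map, Category.assoc]

variable (𝒜) in
/-- The translation functor `Σ` of the stable category of a Frobenius category. -/
def suspension : StableCat 𝒜 ⥤ StableCat 𝒜 :=
  CategoryTheory.Quotient.lift _ (toStableSuspension 𝒜) fun X Y f g h => by
    refine CategoryTheory.Quotient.sound _ (FactorsThroughProjective.suspend h
      (Injective.factorThru (f ≫ Injective.ι Y) (Injective.ι X) -
        Injective.factorThru (g ≫ Injective.ι Y) (Injective.ι X)) _ ?_ ?_)
    · rw [Preadditive.comp_sub, Injective.comp_factorThru, Injective.comp_factorThru,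
        Preadditive.sub_comp]
    · rw [Preadditive.comp_sub, Preadditive.sub_comp, cosyzygyπ_map, cosyzygyπ_map]

/-- For a short exact sequence `0 → X → Y → Z → 0`, the morphism `ω : Z → Σ X` is a connecting
morphism if it is induced by a morphism `Y → I(X)` extending `X → I(X)`. -/
def IsConnecting (S : ShortComplex 𝒜) (ω : S.X₃ ⟶ cosyzygy S.X₁) : Prop :=
  ∃ m : S.X₂ ⟶ Injective.under S.X₁, S.f ≫ m = Injective.ι S.X₁ ∧ m ≫ cosyzygyπ S.X₁ = S.g ≫ ω

/-- The exact triangles of the stable category: those isomorphic to a triangle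
`X → Y → Z → Σ X` given by a short exact sequence of `𝒜` and its connecting morphism. -/
def IsExactTriangle {X Y Z : StableCat 𝒜} (u : X ⟶ Y) (v : Y ⟶ Z)
    (t : Z ⟶ (suspension 𝒜).obj X) : Prop :=
  ∃ (S : ShortComplex 𝒜) (_ : S.ShortExact) (ω : S.X₃ ⟶ cosyzygy S.X₁) (_ : IsConnecting S ω)
    (a : X ≅ (toStable 𝒜).obj S.X₁) (b : Y ≅ (toStable 𝒜).obj S.X₂)
    (c : Z ≅ (toStable 𝒜).obj S.X₃),
    u ≫ b.hom = a.hom ≫ (toStable 𝒜).map S.f ∧ v ≫ c.hom = b.hom ≫ (toStable 𝒜).map S.g ∧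
      t ≫ (suspension 𝒜).map a.hom = c.hom ≫ (toStable 𝒜).map ω

/-- A `∂`-functor from an abelian category to the stable category of a Frobenius category: an
additive functor with chosen connecting morphisms `ω_ξ : F Z → Σ F X` for all short exact sequences
`ξ`, functorial in `ξ`, which complete `F X → F Y → F Z` to exact triangles. -/
def IsDelFunctor {𝒞 : Type w'} [Category.{v'} 𝒞] [Abelian 𝒞] (F : 𝒞 ⥤ StableCat 𝒜) : Prop :=
  F.Additive ∧
    ∃ ω : ∀ ξ : ShortComplex 𝒞, ξ.ShortExact →
        (F.obj ξ.X₃ ⟶ (suspension 𝒜).obj (F.obj ξ.X₁)),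
      (∀ ξ hξ, IsExactTriangle (F.map ξ.f) (F.map ξ.g) (ω ξ hξ)) ∧
      ∀ (ξ ξ' : ShortComplex 𝒞) (hξ : ξ.ShortExact) (hξ' : ξ'.ShortExact) (φ : ξ ⟶ ξ'),
        ω ξ hξ ≫ (suspension 𝒜).map (F.map φ.τ₁) = F.map φ.τ₃ ≫ ω ξ' hξ'

/-- A triangle functor between stable categories: an additive functor `F` with a natural isomorphism
`θ : F Σ ≅ Σ F` such that `F` sends exact triangles to exact triangles. -/
def IsTriangleFunctor {𝒞 : Type w'} [Category.{v'} 𝒞] [Abelian 𝒞] [IsFrobenius 𝒞]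
    (F : StableCat 𝒞 ⥤ StableCat 𝒜) : Prop :=
  F.Additive ∧
    ∃ θ : suspension 𝒞 ⋙ F ≅ F ⋙ suspension 𝒜,
      ∀ (X Y Z : StableCat 𝒞) (u : X ⟶ Y) (v : Y ⟶ Z) (t : Z ⟶ (suspension 𝒞).obj X),
        IsExactTriangle u v t → IsExactTriangle (F.map u) (F.map v) (F.map t ≫ θ.hom.app X)

end Frobenius

/-! ### Cotorsion pairs in the category of finitely generated modules -/

section Cotorsion

open CategoryTheory

variable {A : Type u} [Ring A]

/-- `Ext_A^i(X, Y) = 0` for finitely generated `A`-modules `X` and `Y`. -/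
def ExtVanishes (i : ℕ) (X Y : FGModuleCat.{u} A) : Prop := Subsingleton (Abelian.Ext X.obj Y.obj i)

/-- `(𝒲, 𝒱)` is a cotorsion pair: `𝒲 = {X | Ext¹(X, 𝒱) = 0}` and `𝒱 = {Y | Ext¹(𝒲, Y) = 0}`. -/
structure IsCotorsionPair (𝒲 𝒱 : ObjectProperty (FGModuleCat.{u} A)) : Prop where
  left_iff : ∀ X, 𝒲 X ↔ ∀ Y, 𝒱 Y → ExtVanishes 1 X Y
  right_iff : ∀ Y, 𝒱 Y ↔ ∀ X, 𝒲 X → ExtVanishes 1 X Y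

/-- `Ext^i(𝒲, 𝒱) = 0` for all `i ≥ 1`. -/
def IsHereditary (𝒲 𝒱 : ObjectProperty (FGModuleCat.{u} A)) : Prop :=
  ∀ i, 1 ≤ i → ∀ X Y, 𝒲 X → 𝒱 Y → ExtVanishes i X Y

/-- A special `𝒱`-preenvelope of `X`: a monomorphism `α : X → V` with `V ∈ 𝒱` whose cokernel `C`
satisfies `Ext¹(C, 𝒱) = 0`. -/
structure SpecialPreenvelope (𝒱 : ObjectProperty (FGModuleCat.{u} A)) (X : FGModuleCat.{u} A) where
  V : FGModuleCat.{u} A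
  mem : 𝒱 V
  α : X →ₗ[A] V
  injective : Function.Injective α
  cokernel : ∀ Y, 𝒱 Y → ExtVanishes 1 (FGModuleCat.of A (V ⧸ LinearMap.range α)) Y

/-- The cotorsion pair is complete: every module has a special `𝒱`-preenvelope. -/
def IsComplete (𝒱 : ObjectProperty (FGModuleCat.{u} A)) : Prop :=
  ∀ X, Nonempty (SpecialPreenvelope 𝒱 X)

/-- `X ∈ add T`: `X` is a direct summand of a finite direct sum of copies of `T`. -/
def IsInAdd (T : Type u) [AddCommGroup T] [Module A T] (X : FGModuleCat.{u} A) : Prop :=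
  ∃ (n : ℕ) (i : X →ₗ[A] (Fin n → T)) (p : (Fin n → T) →ₗ[A] X), p.comp i = LinearMap.id

end Cotorsion

/-! ### Wakamatsu's functor -/

section Functor

open CategoryTheory

variable {R E A B T : Type u} [CommRing R] [IsArtinianRing R] [AddCommGroup E] [Module R E]
  [IsMinimalInjectiveCogenerator R E]
  [Ring A] [Algebra R A] [Module.Finite R A] [Ring B] [Algebra R B] [Module.Finite R B]
  [AddCommGroup T] [Module R T] [Module A T] [Module Bᵐᵒᵖ T]
  [IsScalarTower R A T] [IsScalarTower R Bᵐᵒᵖ T] [SMulCommClass A Bᵐᵒᵖ T] [Module.Finite A T]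

/-- The underlying `A`-module of a `T(A)`-module. -/
def res (X : FGModuleCat.{u} (TrivExt R E A)) : FGModuleCat.{u} A :=
  FGModuleCat.of A (Res R E A X)

/-- The underlying `A`-linear map of a morphism of `T(A)`-modules, keeping the `T(A)`-linearity. -/
def resMap {X X' : FGModuleCat.{u} (TrivExt R E A)} (f : X ⟶ X') :
    Res R E A X →ₗ[TrivExt R E A] Res R E A X' := f.hom.hom

variable {𝒱 : ObjectProperty (FGModuleCat.{u} A)}
  (α : ∀ X : FGModuleCat.{u} A, SpecialPreenvelope 𝒱 X)
  (hδ : Function.Bijective (delta R E A B T))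

/-- The special preenvelope `α_X : X → V(X)` of the underlying `A`-module of a `T(A)`-module. -/
def preenv (X : FGModuleCat.{u} (TrivExt R E A)) : Res R E A X →ₗ[A] (α (res X)).V := (α (res X)).α

/-- The `T(B)`-module `S(X)`, the cokernel of `D T ⊗_A X → L(V(X))`. -/
def wakObj (X : FGModuleCat.{u} (TrivExt R E A)) : FGModuleCat.{u} (TrivExt R E B) :=
  FGModuleCat.of (TrivExt R E B) (WakMod hδ (preenv α X))

/-- The morphism `S(X) → S(X')` determined by `f : X → X'` and `f_V : V(X) → V(X')` with
`α_{X'} ∘ f = f_V ∘ α_X`. -/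
def wakHom {X X' : FGModuleCat.{u} (TrivExt R E A)} (f : X ⟶ X')
    (fV : (α (res X)).V →ₗ[A] (α (res X')).V)
    (h : (preenv α X').comp ((resMap f).restrictScalars A) = fV.comp (preenv α X)) :
    wakObj α hδ X ⟶ wakObj α hδ X' :=
  FGModuleCat.ofHom (wakMap hδ (preenv α X) (preenv α X') (resMap f) fV h)

/-- `S` is Wakamatsu's functor from `T(A)`-modules to the stable category of `T(B)`-modules defined
by the fixed special preenvelopes `α`: on objects it is `X ↦ S(X)`, and for every morphism `f` and
every choice of `f_V` with `α_{X'} ∘ f = f_V ∘ α_X`, the morphism `S(f)` is the class of the induced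
morphism of cokernels. -/
def IsWakamatsuFunctor
    (S : FGModuleCat.{u} (TrivExt R E A) ⥤ StableCat (FGModuleCat.{u} (TrivExt R E B))) : Prop :=
  ∃ hS : ∀ X, S.obj X = (toStable _).obj (wakObj α hδ X),
    ∀ (X X' : FGModuleCat.{u} (TrivExt R E A)) (f : X ⟶ X')
      (fV : (α (res X)).V →ₗ[A] (α (res X')).V)
      (h : (preenv α X').comp ((resMap f).restrictScalars A) = fV.comp (preenv α X)),
      S.map f = eqToHom (hS X) ≫ (toStable _).map (wakHom α hδ f fV h) ≫ eqToHom (hS X').symm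

end Functor

end Wakamatsu

end

/-! The key fact is that $L$ turns $\mathrm{add}\,T$ into projectives: faithful balance and the
bijectivity of $\delta$ identify $L(T)$ with $T(B)$ (`LMod.smul_unit_bijective`), and $L$ is
additive. Two lifts $V(X)\to V(X')$ of one morphism differ by a map that kills $X$. Such a map
factors through the cokernel $C\in\mathcal W$ of $\alpha_X$, and then through $V(C)$, which lies in
$\mathcal W\cap\mathcal V=\mathrm{add}\,T$. The induced maps of cokernels thus differ by a map
through the projective $L(V(C))$ (`toStable_coneHom_eq`). This gives functoriality and additivity,
and it makes $\mathcal S(X)$ independent, up to canonical stable isomorphism, of the preenvelope.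

For a short exact sequence $0\to X\to Y\to Z\to0$, a pushout produces special preenvelopes that
themselves form a short exact sequence $0\to V_X\to V_Y\to V_Z\to0$ (`nonempty_horseshoe`). The
hereditary hypothesis puts $V_Z$ in $\mathcal V$. The resulting sequence of $T(B)$-modules is short
exact (`Horseshoe.complex_shortExact`). Injectivity uses the duality $DT\otimes_A V\cong
D\,\mathrm{Hom}_A(V,T)$ (`tensorEval_bijective`) and the extension of maps to $T\in\mathcal V$.
Surjectivity uses $\mathrm{Ext}^1_A(T,V_X)=0$, from $T\in\mathcal W$. The triangle of this sequence
is transported to the fixed preenvelopes. Morphisms of short exact sequences lift to the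
preenvelopes (`Horseshoe.exists_lift`), so naturality reduces to that of connecting morphisms in a
Frobenius category.

The functor kills projectives: $A\oplus DA\to V(A)\oplus DA$ is a special preenvelope of $T(A)$, and
its cone is $L(V(A))$ with $V(A)\in\mathrm{add}\,T$ (`mkQ_comp_map_inl_bijective`). A
$\partial$-functor on a Frobenius category that kills projectives descends to a triangle functor,
with $\theta_X$ the connecting morphism of $0\to X\to I(X)\to\Sigma X\to0$
(`IsDelFunctor.exists_triangleFunctor`).

The Frobenius property comes from the nondegenerate form $(a,f)\mapsto f(1)$ on the trivial
extension. Through it, $R$-linear forms to $E$ become $T(A)$-linear maps to $T(A)$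
(`exists_linearMap_trace_eq`); this needs Matlis reflexivity over $R$ (`exists_eval_eq`). -/

noncomputable section

namespace Wakamatsu

open MulOpposite (op unop)
open scoped TensorProduct

set_option linter.unusedSectionVars false

/-! ### Matlis duality over a commutative artinian ring -/

section Matlis

variable {R E : Type u} [CommRing R] [AddCommGroup E] [Module R E]

/-- An injective submodule meeting every isomorphism class of simple modules is a cogenerator. -/
theorem isCogenerator_of_simple (N : Submodule R E) (hinj : Module.Injective R N)
    (hN : ∀ p : Ideal R, p.IsMaximal → ∃ f : (R ⧸ p) →ₗ[R] N, f 1 ≠ 0) : IsCogenerator R N := by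
  intro M _ _ m hm
  have hI : LinearMap.ker (LinearMap.toSpanSingleton R M m) ≠ ⊤ := fun h => hm (by
    have : (1 : R) ∈ LinearMap.ker (LinearMap.toSpanSingleton R M m) := h ▸ trivial
    simpa using this)
  obtain ⟨P, hP, hIP⟩ := Ideal.exists_le_maximal _ hI
  obtain ⟨f, hf⟩ := hN P hP
  -- $Rm\cong R/\mathrm{ann}(m)$ maps onto $R/P$. The composite with `f` is nonzero at $m$ and
  -- extends to $M$ by injectivity.
  let g : (R ⧸ LinearMap.ker (LinearMap.toSpanSingleton R M m)) →ₗ[R] N :=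
    Submodule.liftQ _ (f.comp (Submodule.mkQ P)) (by
      intro x hx
      rw [LinearMap.mem_ker, LinearMap.comp_apply, mkQ_eq_zero P (hIP hx), map_zero])
  obtain ⟨k, hk⟩ := hinj.out
    (Submodule.liftQ _ (LinearMap.toSpanSingleton R M m) le_rfl)
    (by rw [← LinearMap.ker_eq_bot]; exact Submodule.ker_liftQ_eq_bot _ _ _ le_rfl) g
  refine ⟨k, fun h0 => hf ?_⟩
  have h1 := hk (Submodule.Quotient.mk 1)
  have h2 : k m = g (Submodule.Quotient.mk 1) := by
    rw [← h1]; exact congrArg k (one_smul R m).symm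
  rw [h0] at h2
  exact h2.symm

/-- In a sum of simple modules `R eₘ`, one for each maximal ideal `m`, the elements annihilated by
the maximal ideal `p` are the multiples of `eₚ`. -/
theorem exists_smul_eq_of_mem_iSup_span {e : MaximalSpectrum R → E}
    (he : ∀ m, ∀ r ∈ m.asIdeal, r • e m = 0) (p : MaximalSpectrum R) {x : E}
    (hx : ∀ r ∈ p.asIdeal, r • x = 0) (hmem : x ∈ ⨆ m, Submodule.span R {e m}) :
    ∃ c : R, c • e p = x := by
  -- Localizing at $p$ kills every summand except $Re_p$. The claim is stated with a multiplier
  -- outside $p$ so that it passes to sums.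
  obtain ⟨c, r, hr, h⟩ : ∃ c : R, ∃ r ∉ p.asIdeal, r • (x - c • e p) = 0 := by
    refine Submodule.iSup_induction (fun m => Submodule.span R {e m})
      (motive := fun x => ∃ c : R, ∃ r ∉ p.asIdeal, r • (x - c • e p) = 0) hmem
      (fun m x hx => ?_) ?_ ?_
    · obtain ⟨c, rfl⟩ := Submodule.mem_span_singleton.1 hx
      by_cases hm : m = p
      · subst hm
        exact ⟨c, 1, Ideal.ne_top_iff_one _ |>.1 m.isMaximal.ne_top, by simp⟩
      · have hnle : ¬ m.asIdeal ≤ p.asIdeal := fun h => hm (by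
          ext1; exact m.isMaximal.eq_of_le p.isMaximal.ne_top h)
        obtain ⟨r, hr, hrp⟩ := Set.not_subset.1 hnle
        exact ⟨0, r, hrp, by rw [zero_smul, sub_zero, smul_comm, he m r hr, smul_zero]⟩
    · exact ⟨0, 1, Ideal.ne_top_iff_one _ |>.1 p.isMaximal.ne_top, by simp⟩
    · rintro x x' ⟨c, r, hr, h⟩ ⟨c', r', hr', h'⟩
      refine ⟨c + c', r * r', fun hm => (p.isMaximal.isPrime.mem_or_mem hm).elim hr hr', ?_⟩
      rw [add_smul, add_sub_add_comm, smul_add, mul_smul r r' (x' - _), h', mul_comm, mul_smul, h]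
      simp
  -- Both $x$ and $e_p$ are killed by $p$, so the multiplier $r$ is invertible on their span and can
  -- be cancelled.
  obtain ⟨s, q, hq, h1⟩ := p.isMaximal.exists_inv hr
  refine ⟨c, (sub_eq_zero.1 ?_).symm⟩
  rw [← one_smul R (x - _), ← h1, add_smul, mul_smul, h, smul_zero, zero_add, smul_sub, hx q hq,
    smul_comm, he p q hq, smul_zero, sub_zero]

/-- The elements of the minimal injective cogenerator annihilated by a maximal ideal form a
cyclic module. -/
theorem exists_smul_eq_of_annihilated [hE : IsMinimalInjectiveCogenerator R E] {p : Ideal R}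
    (hp : p.IsMaximal) {y z : E} (hy : ∀ r ∈ p, r • y = 0) (hz : ∀ r ∈ p, r • z = 0)
    (hy0 : y ≠ 0) : ∃ c : R, c • y = z := by
  have hf (m : MaximalSpectrum R) : ∃ e : E, e ≠ 0 ∧ ∀ r ∈ m.asIdeal, r • e = 0 := by
    have := m.isMaximal
    obtain ⟨f, hf⟩ := hE.cogenerator (R ⧸ m.asIdeal) 1 one_ne_zero
    refine ⟨f 1, hf, fun r hr => ?_⟩
    rw [← map_smul, ← Algebra.algebraMap_eq_smul_one, Ideal.Quotient.algebraMap_eq,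
      Ideal.Quotient.eq_zero_iff_mem.2 hr, map_zero]
  choose e he0 he using hf
  -- An injective essential extension of a sum of one copy of each simple module is already a
  -- cogenerator. By minimality it is all of $E$.
  obtain ⟨N, hle, hess, hinj⟩ :=
    exists_injective_hull hE.injective (⨆ m, Submodule.span R {e m})
  have hcog : IsCogenerator R N := isCogenerator_of_simple N hinj fun q hq =>
    ⟨Submodule.liftQ q (LinearMap.toSpanSingleton R N ⟨e ⟨q, hq⟩,
        hle (Submodule.mem_iSup_of_mem _ (Submodule.mem_span_singleton_self _))⟩) fun r hr =>
        Subtype.ext (he ⟨q, hq⟩ r hr), fun h => he0 ⟨q, hq⟩ (by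
        have h' : (1 : R) • e ⟨q, hq⟩ = 0 := congrArg Subtype.val h
        rwa [one_smul] at h')⟩
  have htop := hE.minimal N hinj hcog
  -- Essentiality gives $rx\ne0$ in the sum of simples. Since $r\notin p$ acts invertibly on $x$,
  -- the element $x$ itself lies in that sum.
  have hgen {x : E} (hx : ∀ r ∈ p, r • x = 0) : ∃ c : R, c • e ⟨p, hp⟩ = x := by
    by_cases hx0 : x = 0
    · exact ⟨0, by rw [hx0, zero_smul]⟩
    obtain ⟨r, hr, hr0⟩ := hess x (htop ▸ trivial) hx0
    obtain ⟨s, q, hq, h⟩ := hp.exists_inv fun h => hr0 (hx r h)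
    refine exists_smul_eq_of_mem_iSup_span he ⟨p, hp⟩ hx ?_
    rw [← one_smul R x, ← h, add_smul, hx q hq, add_zero, mul_smul]
    exact Submodule.smul_mem _ _ hr
  obtain ⟨a, ha⟩ := hgen hy
  obtain ⟨b, hb⟩ := hgen hz
  have hap : a ∉ p := fun h => hy0 (by rw [← ha, he _ a h])
  obtain ⟨s, q, hq, h⟩ := hp.exists_inv hap
  refine ⟨b * s, ?_⟩
  rw [← ha, ← mul_smul, mul_assoc, mul_smul, ← hb]
  congr 1
  have := congrArg (· • e ⟨p, hp⟩) h
  simpa [add_smul, he ⟨p, hp⟩ q hq] using this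

/-- A linear form on the dual of a finitely generated module is an evaluation. -/
theorem exists_eval_eq [IsArtinianRing R] [hE : IsMinimalInjectiveCogenerator R E] {M : Type u} [AddCommGroup M]
    [Module R M] [Module.Finite R M] (F : (M →ₗ[R] E) →ₗ[R] E) : ∃ m, ∀ f, F f = f m := by
  -- For simple $M$, every form is a multiple of one nonzero `g`, because values at $x$ lie in the
  -- cyclic part of $E$ killed by $\mathrm{ann}(x)$. Hence $F$ is determined by $F(g)$, which is a
  -- multiple of $g(x)$.
  have simple (M : Type u) [AddCommGroup M] [Module R M] [IsSimpleModule R M]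
      (F : (M →ₗ[R] E) →ₗ[R] E) : ∃ m, ∀ f, F f = f m := by
    have := IsSimpleModule.nontrivial R M
    obtain ⟨x, hx⟩ := exists_ne (0 : M)
    obtain ⟨g, hg⟩ := hE.cogenerator M x hx
    have hspan (m : M) : ∃ r : R, r • x = m := Submodule.mem_span_singleton.1
      (IsSimpleModule.span_singleton_eq_top R hx ▸ trivial)
    have hker := IsSimpleModule.ker_toSpanSingleton_isMaximal R hx
    have hann (k : M →ₗ[R] E) (r : R) (hr : r ∈ LinearMap.ker (LinearMap.toSpanSingleton R M x)) :
        r • k x = 0 := by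
      rw [← map_smul, show r • x = 0 from hr, map_zero]
    obtain ⟨c, hc⟩ := exists_smul_eq_of_annihilated hker (hann g) (z := F g) (fun r hr => by
      have : r • g = 0 := by
        ext m
        obtain ⟨s, rfl⟩ := hspan m
        rw [LinearMap.smul_apply, map_smul, smul_comm, hann g r hr, smul_zero]; rfl
      rw [← map_smul, this, map_zero]) hg
    refine ⟨c • x, fun k => ?_⟩
    obtain ⟨d, hd⟩ := exists_smul_eq_of_annihilated hker (hann g) (hann k) hg
    have hk : k = d • g := by
      ext m
      obtain ⟨s, rfl⟩ := hspan m
      rw [map_smul, ← hd, LinearMap.smul_apply, map_smul, smul_comm]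
    rw [hk, map_smul, ← hc, LinearMap.smul_apply, map_smul]
  have main (M : Type u) [AddCommGroup M] [Module R M] (hM : IsFiniteLength R M) :
      ∀ F : (M →ₗ[R] E) →ₗ[R] E, ∃ m, ∀ f, F f = f m := by
    induction hM with
    | @of_subsingleton M _ _ _ =>
      refine fun F => ⟨0, fun f => ?_⟩
      have : f = 0 := by ext m; rw [Subsingleton.elim m 0, map_zero, map_zero]
      rw [this, map_zero]; rfl
    | @of_simple_quotient M _ _ S _ _ ih =>
      intro F
      obtain ⟨m, hm⟩ := simple (M ⧸ S) (F.comp (LinearMap.lcomp R E S.mkQ))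
      obtain ⟨m, rfl⟩ := S.mkQ_surjective m
      -- Subtracting evaluation at $m$ makes $F$ vanish on forms trivial on $S$. The difference
      -- descends to $\mathrm{Hom}(S,E)$, since restriction is onto by injectivity of $E$; there the
      -- induction hypothesis applies.
      let G : (M →ₗ[R] E) →ₗ[R] E := F - LinearMap.applyₗ m
      have hsurj : Function.Surjective (LinearMap.lcomp R E S.subtype) := fun k => by
        obtain ⟨l, hl⟩ := hE.injective.out S.subtype S.injective_subtype k
        exact ⟨l, LinearMap.ext hl⟩
      have hG : LinearMap.ker (LinearMap.lcomp R E S.subtype) ≤ LinearMap.ker G := by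
        intro k hk
        have hk' : S ≤ LinearMap.ker k := fun s hs =>
          congrArg (fun l : S →ₗ[R] E => l ⟨s, hs⟩) hk
        have := hm (S.liftQ k hk')
        rw [LinearMap.mem_ker, LinearMap.sub_apply, sub_eq_zero]
        exact this
      obtain ⟨s, hs⟩ := ih ((Submodule.liftQ _ G hG).comp
        (LinearMap.quotKerEquivOfSurjective _ hsurj).symm.toLinearMap)
      refine ⟨m + s, fun k => ?_⟩
      have h1 : G k = k s := by
        have := hs (LinearMap.lcomp R E S.subtype k)
        rw [LinearMap.comp_apply, LinearEquiv.coe_coe,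
          (LinearEquiv.symm_apply_eq _).2 (LinearMap.quotKerEquivOfSurjective_apply_mk _ hsurj k).symm]
          at this
        exact this
      rw [map_add, ← h1]
      simp [G]
  exact main M (isFiniteLength_iff_isNoetherian_isArtinian.2 ⟨inferInstance, inferInstance⟩) F

end Matlis

/-! ### Short exact sequences of finitely generated modules -/

section FGModule

open CategoryTheory

variable {Λ : Type u} [Ring Λ] [IsNoetherianRing Λ]

theorem mono_iff_injective {X Y : FGModuleCat.{u} Λ} (f : X ⟶ Y) :
    Mono f ↔ Function.Injective f.hom.hom := by
  refine ⟨fun h => ?_, fun h => ?_⟩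
  · exact (ModuleCat.mono_iff_injective _).1
      (inferInstanceAs (Mono ((forget₂ (FGModuleCat Λ) (ModuleCat Λ)).map f)))
  · exact Functor.mono_of_mono_map (forget₂ (FGModuleCat Λ) (ModuleCat Λ))
      ((ModuleCat.mono_iff_injective f.hom).2 h)

theorem epi_iff_surjective {X Y : FGModuleCat.{u} Λ} (f : X ⟶ Y) :
    Epi f ↔ Function.Surjective f.hom.hom := by
  refine ⟨fun h => ?_, fun h => ?_⟩
  · exact (ModuleCat.epi_iff_surjective _).1
      (inferInstanceAs (Epi ((forget₂ (FGModuleCat Λ) (ModuleCat Λ)).map f)))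
  · exact Functor.epi_of_epi_map (forget₂ (FGModuleCat Λ) (ModuleCat Λ))
      ((ModuleCat.epi_iff_surjective f.hom).2 h)

theorem exact_iff_function_exact (S : ShortComplex (FGModuleCat.{u} Λ)) :
    S.Exact ↔ Function.Exact S.f.hom.hom S.g.hom.hom :=
  (S.exact_map_iff_of_faithful (forget₂ (FGModuleCat Λ) (ModuleCat Λ))).symm.trans
    (ShortComplex.ShortExact.moduleCat_exact_iff_function_exact _)

theorem shortExact_iff (S : ShortComplex (FGModuleCat.{u} Λ)) :
    S.ShortExact ↔ Function.Injective S.f.hom.hom ∧ Function.Exact S.f.hom.hom S.g.hom.hom ∧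
      Function.Surjective S.g.hom.hom :=
  ⟨fun h => ⟨(mono_iff_injective _).1 h.mono_f, (exact_iff_function_exact _).1 h.exact,
    (epi_iff_surjective _).1 h.epi_g⟩, fun ⟨h1, h2, h3⟩ =>
    { exact := (exact_iff_function_exact _).2 h2
      mono_f := (mono_iff_injective _).2 h1
      epi_g := (epi_iff_surjective _).2 h3 }⟩

theorem projective_of_module_projective (X : FGModuleCat.{u} Λ) [Module.Projective Λ X] :
    Projective X where
  factors {E Y} f e he := by
    obtain ⟨g, hg⟩ := Module.projective_lifting_property e.hom.hom f.hom.hom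
      ((epi_iff_surjective e).1 he)
    exact ⟨FGModuleCat.ofHom g, FGModuleCat.hom_ext hg⟩

theorem injective_of_module_injective (X : FGModuleCat.{u} Λ) [hX : Module.Injective Λ X] :
    Injective X where
  factors {Y E} f e he := by
    obtain ⟨g, hg⟩ := hX.out e.hom.hom ((mono_iff_injective e).1 he) f.hom.hom
    exact ⟨FGModuleCat.ofHom g, FGModuleCat.hom_ext (LinearMap.ext hg)⟩

/-- The free module of rank `n`. -/
def freeObj (Λ : Type u) [Ring Λ] (n : ℕ) : FGModuleCat.{u} Λ := FGModuleCat.of Λ (Fin n → Λ)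

instance (n : ℕ) : Module.Projective Λ (freeObj Λ n) :=
  inferInstanceAs (Module.Projective Λ (Fin n → Λ))

instance (n : ℕ) : Projective (freeObj Λ n) := projective_of_module_projective _

theorem exists_epi_freeObj (X : FGModuleCat.{u} Λ) : ∃ (n : ℕ) (f : freeObj Λ n ⟶ X), Epi f := by
  obtain ⟨n, f, hf⟩ := Module.Finite.exists_fin' Λ X
  exact ⟨n, FGModuleCat.ofHom f, (epi_iff_surjective _).2 hf⟩

theorem exists_retract_freeObj (X : FGModuleCat.{u} Λ) [Projective X] :
    ∃ n : ℕ, Nonempty (Retract X (freeObj Λ n)) := by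
  obtain ⟨n, f, hf⟩ := exists_epi_freeObj X
  exact ⟨n, ⟨⟨Projective.factorThru (𝟙 X) f, f, Projective.factorThru_comp _ _⟩⟩⟩

/-- A self-injective noetherian ring over which every finitely generated module embeds in a
finitely generated free module has a Frobenius category of finitely generated modules. -/
theorem isFrobenius_of_selfInjective [Module.Injective Λ Λ]
    (h : ∀ X : FGModuleCat.{u} Λ, ∃ (n : ℕ) (f : X →ₗ[Λ] (Fin n → Λ)), Function.Injective f) :
    IsFrobenius (FGModuleCat.{u} Λ) := by
  have hfree (n : ℕ) : Injective (freeObj Λ n) :=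
    have : Module.Injective Λ (freeObj Λ n) := inferInstanceAs (Module.Injective Λ (Fin n → Λ))
    injective_of_module_injective _
  have hmono (X : FGModuleCat.{u} Λ) : ∃ (n : ℕ) (f : X ⟶ freeObj Λ n), Mono f := by
    obtain ⟨n, f, hf⟩ := h X
    exact ⟨n, FGModuleCat.ofHom f, (mono_iff_injective _).2 hf⟩
  refine ⟨⟨fun X => ?_⟩, ⟨fun X => ?_⟩, fun X => ⟨fun hX => ?_, fun hX => ?_⟩⟩
  · obtain ⟨n, f, hf⟩ := exists_epi_freeObj X
    exact ⟨{ p := freeObj Λ n, f := f, epi := hf }⟩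
  · obtain ⟨n, f, hf⟩ := hmono X
    exact ⟨{ J := freeObj Λ n, injective := hfree n, f := f, mono := hf }⟩
  · obtain ⟨n, ⟨r⟩⟩ := exists_retract_freeObj X
    exact r.injective
  · obtain ⟨n, f, hf⟩ := hmono X
    exact Retract.projective ⟨f, Injective.factorThru (𝟙 X) f, Injective.comp_factorThru _ _⟩

end FGModule

/-! ### Trivial extensions are Frobenius algebras -/

section SelfInjective

variable {R E A : Type u} [CommRing R] [AddCommGroup E] [Module R E] [Ring A] [Algebra R A]

/-- The linear form `(a, f) ↦ f 1` on the trivial extension. -/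
def trace : TrivExt R E A →+ E where
  toFun τ := τ.snd 1
  map_zero' := rfl
  map_add' _ _ := rfl

/-- The formula exhibits the trace form as symmetric: it is the evaluation pairing between $A$ and
$DA$. -/
theorem trace_mul (τ σ : TrivExt R E A) : trace (τ * σ) = σ.snd τ.fst + τ.snd σ.fst := by
  change (τ.fst • σ.snd + op σ.fst • τ.snd) 1 = _
  rw [Dual.add_apply, Dual.smul_apply, Dual.op_smul_apply, op_smul_eq_mul, one_mul, smul_eq_mul,
    mul_one]

/-- Multiplying by elements of $A$ tests the component in $DA$. Multiplying by forms tests the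
component in $A$, where the cogenerator property is needed. -/
theorem eq_zero_of_trace_mul_eq_zero [hE : IsMinimalInjectiveCogenerator R E] {σ : TrivExt R E A}
    (h : ∀ τ, trace (τ * σ) = 0) : σ = 0 := by
  have h2 : σ.snd = 0 := by
    ext a
    have := h (TrivSqZeroExt.inl a)
    rw [trace_mul] at this
    simpa using this
  have h1 : σ.fst = 0 := by
    by_contra h0
    obtain ⟨g, hg⟩ := hE.cogenerator A σ.fst h0
    have := h (TrivSqZeroExt.inr (show Dual R E A from g))
    rw [trace_mul, h2] at this
    rw [TrivSqZeroExt.snd_inr, Dual.zero_apply, zero_add] at this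
    exact hg this
  exact TrivSqZeroExt.ext h1 h2

theorem eq_of_trace_mul_eq [IsMinimalInjectiveCogenerator R E] {σ ρ : TrivExt R E A}
    (h : ∀ τ, trace (τ * σ) = trace (τ * ρ)) : σ = ρ :=
  sub_eq_zero.1 (eq_zero_of_trace_mul_eq_zero fun τ => by rw [mul_sub, map_sub, h, sub_self])

variable (R E A) in
/-- The structure map `R → T(A)`. -/
def scalar : R →+* TrivExt R E A := (TrivSqZeroExt.inlHom A (Dual R E A)).comp (algebraMap R A)

theorem scalar_mul_inr (r : R) (g : Dual R E A) (a : A) :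
    (scalar R E A r * TrivSqZeroExt.inr g).snd a = r • g a := by
  change (TrivSqZeroExt.inl (algebraMap R A r) * TrivSqZeroExt.inr g : TrivExt R E A).snd a = _
  rw [TrivSqZeroExt.inl_mul_inr, TrivSqZeroExt.snd_inr, Dual.smul_apply, op_smul_eq_mul,
    ← Algebra.commutes, ← Algebra.smul_def, map_smul]

theorem trace_scalar_mul (r : R) (τ : TrivExt R E A) : trace (scalar R E A r * τ) = r • trace τ := by
  rw [trace_mul]
  change τ.snd (algebraMap R A r) + (0 : Dual R E A) τ.fst = _
  rw [Dual.zero_apply, add_zero, Algebra.algebraMap_eq_smul_one, map_smul]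
  rfl

variable {X : Type u} [AddCommGroup X] [Module (TrivExt R E A) X]

/-- `Hom_R(X, E)` consists of the compositions of `T(A)`-linear maps `X → T(A)` with the trace. -/
theorem exists_linearMap_trace_eq [IsArtinianRing R] [Module.Finite R A]
    [IsMinimalInjectiveCogenerator R E] (l : X →+ E)
    (hl : ∀ (r : R) x, l (scalar R E A r • x) = r • l x) :
    ∃ h : X →ₗ[TrivExt R E A] TrivExt R E A, ∀ x, trace (h x) = l x := by
  -- The value at $x$ must represent $\tau\mapsto l(\tau x)$. Its component in $DA$ is the
  -- restriction of this form to $A$. Its component in $A$ comes from reflexivity, applied to the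
  -- restriction to $DA$.
  have hex (x : X) : ∃ σ : TrivExt R E A, ∀ τ : TrivExt R E A, trace (τ * σ) = l (τ • x) := by
    let F : (A →ₗ[R] E) →ₗ[R] E :=
      { toFun := fun g => l ((TrivSqZeroExt.inr (show Dual R E A from g) : TrivExt R E A) • x)
        map_add' := fun g g' => by
          rw [← map_add, ← add_smul, ← TrivSqZeroExt.inr_add]; rfl
        map_smul' := fun r g => by
          rw [RingHom.id_apply, ← hl, ← mul_smul]
          congr 2
          refine TrivSqZeroExt.ext ?_ (Dual.ext fun a => (scalar_mul_inr r _ a).symm)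
          rw [TrivSqZeroExt.fst_mul, TrivSqZeroExt.fst_inr, TrivSqZeroExt.fst_inr, mul_zero] }
    obtain ⟨a, ha⟩ := exists_eval_eq F
    let f : Dual R E A := (show A →ₗ[R] E from
      { toFun := fun b => l ((TrivSqZeroExt.inl b : TrivExt R E A) • x)
        map_add' := fun b c => by rw [TrivSqZeroExt.inl_add, add_smul, map_add]
        map_smul' := fun r b => by
          rw [RingHom.id_apply, ← hl, ← mul_smul, Algebra.smul_def, TrivSqZeroExt.inl_mul]; rfl })
    refine ⟨TrivSqZeroExt.inl a + TrivSqZeroExt.inr f, fun τ => ?_⟩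
    rw [trace_mul]
    conv_rhs => rw [← TrivSqZeroExt.inl_fst_add_inr_snd_eq τ, add_smul, map_add]
    rw [TrivSqZeroExt.fst_add, TrivSqZeroExt.snd_add, TrivSqZeroExt.fst_inl, TrivSqZeroExt.fst_inr,
      TrivSqZeroExt.snd_inl, TrivSqZeroExt.snd_inr, add_zero, zero_add]
    exact congrArg (l ((TrivSqZeroExt.inl τ.fst : TrivExt R E A) • x) + ·) (ha τ.snd).symm
  choose h hh using hex
  -- Nondegeneracy makes the representing element unique, and uniqueness yields linearity.
  refine ⟨{ toFun := h, map_add' := fun x y => ?_, map_smul' := fun σ x => ?_ }, fun x => ?_⟩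
  · exact eq_of_trace_mul_eq fun τ => by rw [hh, mul_add, map_add, hh, hh, smul_add, map_add]
  · exact eq_of_trace_mul_eq fun τ => by
      rw [hh, RingHom.id_apply, smul_eq_mul, ← mul_assoc, hh, mul_smul]
  · have := hh x 1
    rwa [one_mul, one_smul] at this

variable [IsArtinianRing R] [Module.Finite R A] [hE : IsMinimalInjectiveCogenerator R E]

/-- The trivial extension is self-injective. -/
instance : Module.Injective (TrivExt R E A) (TrivExt R E A) where
  out X Y _ _ _ _ f hf g := by
    let _ : Module R X := Module.compHom X (scalar R E A)
    let _ : Module R Y := Module.compHom Y (scalar R E A)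
    let f' : X →ₗ[R] Y :=
      { toFun := f, map_add' := map_add f, map_smul' := fun r x => map_smul f (scalar R E A r) x }
    let g' : X →ₗ[R] E :=
      { toFun := fun x => trace (g x)
        map_add' := fun x y => by rw [map_add, map_add]
        map_smul' := fun r x => by
          rw [RingHom.id_apply, ← trace_scalar_mul, ← smul_eq_mul, ← map_smul]; rfl }
    -- The extension problem is solved over $R$ for the composite of $g$ with the trace, and the
    -- solution is converted back into a $T(A)$-linear map.
    obtain ⟨l, hl⟩ := hE.injective.out f' hf g'
    obtain ⟨h, hh⟩ := exists_linearMap_trace_eq (A := A) l.toAddMonoidHom (map_smul l)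
    refine ⟨h, fun x => eq_of_trace_mul_eq fun τ => ?_⟩
    rw [← smul_eq_mul, ← smul_eq_mul, ← map_smul, ← map_smul, ← map_smul, hh]
    exact hl (τ • x)

/-- Finitely generated modules over the trivial extension embed in free modules. -/
theorem exists_injective_linearMap_free [Module.Finite (TrivExt R E A) X] :
    ∃ (n : ℕ) (f : X →ₗ[TrivExt R E A] (Fin n → TrivExt R E A)), Function.Injective f := by
  let _ : Module R X := Module.compHom X (scalar R E A)
  have : Module.Finite R X := by
    have : Module.Finite A (Res R E A X) := inferInstance
    let _ : Module R (Res R E A X) := Module.compHom X (scalar R E A)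
    have : IsScalarTower R A (Res R E A X) := ⟨fun r a x => by
      rw [Algebra.smul_def, mul_smul]; rfl⟩
    exact Module.Finite.trans A (Res R E A X)
  have : Module.Finite R (X →ₗ[R] E) := finite_linearMap _ _ _
  -- Finitely many forms generate $\mathrm{Hom}_R(X,E)$, and each gives a coordinate in $T(A)$. An
  -- element with all coordinates zero is killed by every form, hence vanishes.
  obtain ⟨n, s, hs⟩ := Module.Finite.exists_fin (R := R) (M := X →ₗ[R] E)
  have h (i : Fin n) := exists_linearMap_trace_eq (A := A) (s i).toAddMonoidHom (map_smul (s i))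
  choose h hh using h
  refine ⟨n, LinearMap.pi h, ?_⟩
  rw [← LinearMap.ker_eq_bot, LinearMap.ker_eq_bot']
  intro x hx
  by_contra hx0
  obtain ⟨k, hk⟩ := hE.cogenerator X x hx0
  refine hk ?_
  have hle : Submodule.span R (Set.range s) ≤ LinearMap.ker (LinearMap.applyₗ (R := R) x) := by
    rw [Submodule.span_le]
    rintro _ ⟨i, rfl⟩
    change s i x = 0
    have hi : h i x = 0 := congrFun hx i
    exact (hh i x).symm.trans (by rw [hi, map_zero])
  exact hle (hs ▸ trivial)

instance : IsFrobenius (FGModuleCat.{u} (TrivExt R E A)) :=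
  isFrobenius_of_selfInjective fun _ => exists_injective_linearMap_free

/-- The dual `D A` is an injective left `A`-module. -/
instance : Module.Injective A (Dual R E A) where
  out X Y _ _ _ _ f hf g := by
    let _ : Module R X := Module.compHom X (algebraMap R A)
    let _ : Module R Y := Module.compHom Y (algebraMap R A)
    let f' : X →ₗ[R] Y :=
      { toFun := f, map_add' := map_add f, map_smul' := fun r x => map_smul f (algebraMap R A r) x }
    let g' : X →ₗ[R] E :=
      { toFun := fun x => g x 1
        map_add' := fun x y => by rw [map_add]; rfl
        map_smul' := fun r x => by
          change g (algebraMap R A r • x) 1 = _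
          rw [map_smul, Dual.smul_apply, op_smul_eq_mul, one_mul, Algebra.algebraMap_eq_smul_one,
            map_smul]; rfl }
    -- Under the adjunction $\mathrm{Hom}_A(-,DA)\cong\mathrm{Hom}_R(-,E)$, given by evaluation at
    -- $1$, extensions over $R$ become extensions over $A$.
    obtain ⟨l, hl⟩ := hE.injective.out f' hf g'
    refine ⟨{ toFun := fun y => (show A →ₗ[R] E from
                { toFun := fun a => l (a • y)
                  map_add' := fun a b => by rw [add_smul, map_add]
                  map_smul' := fun r a => by
                    rw [RingHom.id_apply, ← map_smul, Algebra.smul_def, mul_smul]; rfl })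
              map_add' := fun x y => Dual.ext fun a => ?_
              map_smul' := fun a x => Dual.ext fun b => ?_ }, fun x => Dual.ext fun a => ?_⟩
    · exact (congrArg l (smul_add a x y)).trans (map_add l _ _)
    · exact congrArg l (mul_smul b a x).symm
    · have : l (a • f x) = g (a • x) 1 := by rw [← map_smul f]; exact hl (a • x)
      rw [map_smul g, Dual.smul_apply, op_smul_eq_mul, one_mul] at this
      exact this

end SelfInjective

/-! ### Exactness of tensor products -/

namespace BalTensor

section

variable {A M X Y Z : Type u} [Ring A] [AddCommGroup M] [Module Aᵐᵒᵖ M] [AddCommGroup X]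
  [Module A X] [AddCommGroup Y] [Module A Y] [AddCommGroup Z] [Module A Z]
  {B : Type u} [Ring B] [Module B M] [SMulCommClass B Aᵐᵒᵖ M]

theorem map_id (u : BalTensor A M X) : map M B (LinearMap.id : X →ₗ[A] X) u = u := by
  refine induction (p := fun u => map M B (LinearMap.id : X →ₗ[A] X) u = u) (map_zero _)
    (fun m x => rfl) (fun u v hu hv => ?_) u
  rw [map_add, hu, hv]

theorem map_surjective {g : X →ₗ[A] Y} (hg : Function.Surjective g) :
    Function.Surjective (map M B g) := fun u => by
  refine induction (p := fun u => ∃ v, map M B g v = u) ⟨0, map_zero _⟩ (fun m y => ?_)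
    (fun u v ⟨a, ha⟩ ⟨b, hb⟩ => ⟨a + b, by rw [map_add, ha, hb]⟩) u
  obtain ⟨x, rfl⟩ := hg y
  exact ⟨tmul A m x, rfl⟩

/-- The tensor product is right exact. -/
theorem exists_map_eq {f : X →ₗ[A] Y} {g : Y →ₗ[A] Z} (hfg : Function.Exact f g)
    (hg : Function.Surjective g) {u : BalTensor A M Y} (hu : map M B g u = 0) :
    ∃ v, map M B f v = u := by
  let N := LinearMap.range (map M B f)
  have hmk {m : M} {y y' : Y} (h : g y = g y') :
      (Submodule.Quotient.mk (tmul A m y) : BalTensor A M Y ⧸ N) =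
        Submodule.Quotient.mk (tmul A m y') := by
    obtain ⟨x, hx⟩ := (hfg (y - y')).1 (by rw [map_sub, h, sub_self])
    refine (Submodule.Quotient.eq _).2 ⟨tmul A m x, ?_⟩
    rw [map_tmul, hx]
    exact map_sub (mk m) y y'
  -- A set-theoretic section suffices: modulo the image of $M\otimes X$, the class of $m\otimes y$
  -- depends only on $g(y)$. This defines an inverse map from $M\otimes Z$ to the cokernel.
  let s : Z → Y := Function.surjInv hg
  have hs (z : Z) : g (s z) = z := Function.surjInv_eq hg z
  let F : BalTensor A M Z →+ BalTensor A M Y ⧸ N := lift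
    (AddMonoidHom.mk' (fun m => AddMonoidHom.mk' (fun z => Submodule.Quotient.mk (tmul A m (s z)))
      fun z z' => by
        rw [← Submodule.Quotient.mk_add, ← tmul_add]
        exact hmk (by rw [map_add, hs, hs, hs]))
      fun m n => by
        ext z
        exact congrArg Submodule.Quotient.mk (add_tmul m n (s z)))
    fun m a z => by
      change Submodule.Quotient.mk (tmul A (op a • m) (s z)) = Submodule.Quotient.mk (tmul A m _)
      rw [smul_tmul]
      exact hmk (by rw [map_smul, hs, hs])
  have hF (u : BalTensor A M Y) : F (map M B g u) = Submodule.Quotient.mk u := by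
    refine induction (p := fun u => F (map M B g u) = Submodule.Quotient.mk u)
      (by rw [map_zero, map_zero]; rfl) (fun m y => hmk (hs _)) (fun u v hu hv => ?_) u
    rw [map_add, map_add, hu, hv]; rfl
  have := hF u
  rw [hu, map_zero] at this
  exact (Submodule.Quotient.mk_eq_zero N).1 this.symm

end

end BalTensor

/-! ### The duality between `D T ⊗_A V` and `Hom_A(V, T)` -/

section Evaluation

variable {R E A T V W : Type u} [CommRing R] [AddCommGroup E] [Module R E]
  [Ring A] [Algebra R A] [AddCommGroup T] [Module R T] [Module A T] [IsScalarTower R A T]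
  [AddCommGroup V] [Module A V] [AddCommGroup W] [Module A W]

/-- A linear map to an injective module factors through any linear map with smaller kernel. -/
theorem exists_comp_eq_of_ker_le (hE : Module.Injective R E) {M N : Type u} [AddCommGroup M]
    [Module R M] [AddCommGroup N] [Module R N] (L : M →ₗ[R] N) (F : M →ₗ[R] E)
    (h : LinearMap.ker L ≤ LinearMap.ker F) : ∃ G : N →ₗ[R] E, ∀ m, G (L m) = F m := by
  obtain ⟨G, hG⟩ := hE.out (Submodule.liftQ _ L le_rfl)
    (LinearMap.ker_eq_bot.1 (Submodule.ker_liftQ_eq_bot _ _ _ le_rfl)) (Submodule.liftQ _ F h)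
  exact ⟨G, fun m => hG (Submodule.Quotient.mk m)⟩

theorem exists_comp_eq_of_surjective {U : Type u} [AddCommGroup U] [Module A U] {p : V →ₗ[A] W}
    (hp : Function.Surjective p) (k : V →ₗ[A] U) (h : ∀ x, p x = 0 → k x = 0) :
    ∃ l : W →ₗ[A] U, l.comp p = k := by
  refine ⟨(Submodule.liftQ _ k h).comp (p.quotKerEquivOfSurjective hp).symm.toLinearMap,
    LinearMap.ext fun x => ?_⟩
  rw [LinearMap.comp_apply, LinearMap.comp_apply, LinearEquiv.coe_coe,
    LinearMap.quotKerEquivOfSurjective_symm_apply]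
  rfl

variable (R T) in
/-- The map `Hom_A(W, T) → Hom_A(V, T)` induced by a map `V → W`. -/
def precomp (g : V →ₗ[A] W) : (W →ₗ[A] T) →ₗ[R] (V →ₗ[A] T) where
  toFun h := h.comp g
  map_add' _ _ := rfl
  map_smul' _ _ := rfl

/-- The canonical map `D T ⊗_A V → D Hom_A(V, T)`, `f ⊗ v ↦ (h ↦ f (h v))`. -/
def tensorEval : BalTensor A (Dual R E T) V →+ ((V →ₗ[A] T) →ₗ[R] E) :=
  BalTensor.lift
    (AddMonoidHom.mk' (fun f => AddMonoidHom.mk'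
      (fun v =>
        { toFun := fun h => f (h v)
          map_add' := fun h k => map_add f _ _
          map_smul' := fun r h => map_smul f r (h v) })
      fun v w => by ext h; exact (congrArg f (map_add h v w)).trans (map_add f _ _))
      fun f g => by ext v h; rfl)
    fun f a v => by ext h; exact congrArg f (map_smul h a v).symm

theorem tensorEval_tmul (f : Dual R E T) (v : V) (h : V →ₗ[A] T) :
    tensorEval (BalTensor.tmul A f v) h = f (h v) := rfl

section

variable {B : Type u} [Ring B] [Algebra R B] [Module Bᵐᵒᵖ T] [IsScalarTower R Bᵐᵒᵖ T]
  [SMulCommClass A Bᵐᵒᵖ T]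

theorem tensorEval_map (g : V →ₗ[A] W) (u : BalTensor A (Dual R E T) V) (h : W →ₗ[A] T) :
    tensorEval (BalTensor.map (Dual R E T) B g u) h = tensorEval u (h.comp g) := by
  refine BalTensor.induction (p := fun u => tensorEval (BalTensor.map (Dual R E T) B g u) h =
    tensorEval u (h.comp g)) ?_ (fun f v => rfl) (fun u v hu hv => ?_) u
  · simp only [map_zero, LinearMap.zero_apply]
  · simp only [map_add, LinearMap.add_apply, hu, hv]

/-- Since $\mathrm{Hom}_A(A^n,T)\cong T^n$, a form is given by its $n$ components in $DT$, which
become the coefficients of the basis vectors. -/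
theorem tensorEval_free_surjective (n : ℕ) (F : ((Fin n → A) →ₗ[A] T) →ₗ[R] E) :
    ∃ u, tensorEval u = F := by
  let k (i : Fin n) : Dual R E T := (show T →ₗ[R] E from
    { toFun := fun t => F ((LinearMap.toSpanSingleton A T t).comp (LinearMap.proj i))
      map_add' := fun s t => by rw [LinearMap.toSpanSingleton_add, LinearMap.add_comp, map_add]
      map_smul' := fun r t => by
        rw [RingHom.id_apply, ← map_smul]
        congr 1
        refine LinearMap.ext fun v => ?_
        exact smul_comm (v i) r t })
  refine ⟨∑ i, BalTensor.tmul A (k i) (Pi.single i 1), ?_⟩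
  ext h
  rw [map_sum, LinearMap.sum_apply]
  change ∑ i, F _ = _
  rw [← map_sum]
  congr 1
  refine LinearMap.pi_ext fun i a => ?_
  rw [LinearMap.sum_apply, Finset.sum_eq_single i]
  · simp only [LinearMap.comp_apply, LinearMap.proj_apply, Pi.single_eq_same,
      LinearMap.toSpanSingleton_apply]
    rw [← map_smul, ← Pi.single_smul, smul_eq_mul, mul_one]
  · intro j _ hj
    simp [Pi.single_eq_of_ne hj]
  · simp

/-- Every tensor is $\sum_i k_i\otimes e_i$, and testing on maps supported on the $i$-th coordinate
recovers $k_i$. -/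
theorem tensorEval_free_injective (n : ℕ) {u : BalTensor A (Dual R E T) (Fin n → A)}
    (hu : (tensorEval u : ((Fin n → A) →ₗ[A] T) →ₗ[R] E) = 0) : u = 0 := by
  obtain ⟨k, rfl⟩ : ∃ k : Fin n → Dual R E T,
      ∑ i, BalTensor.tmul A (k i) (Pi.single i (1 : A)) = u := by
    refine BalTensor.induction (p := fun u => ∃ k : Fin n → Dual R E T,
      ∑ i, BalTensor.tmul A (k i) (Pi.single i (1 : A)) = u) ⟨0, ?_⟩ (fun f v => ?_)
      (fun u v ⟨k, hk⟩ ⟨l, hl⟩ => ⟨k + l, ?_⟩) u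
    · exact Finset.sum_eq_zero fun i _ => BalTensor.zero_tmul _
    · refine ⟨fun i => op (v i) • f, ?_⟩
      simp only [BalTensor.smul_tmul]
      have h (w : Fin n → A) : BalTensor.tmul A f w = BalTensor.mk (A := A) f w := rfl
      simp only [h]
      rw [← map_sum]
      congr 1
      refine Eq.trans ?_ (LinearMap.sum_single_apply (φ := fun _ : Fin n => A) v)
      refine Finset.sum_congr rfl fun i _ => ?_
      rw [← Pi.single_smul, smul_eq_mul, mul_one]
    · rw [← hk, ← hl, ← Finset.sum_add_distrib]
      exact Finset.sum_congr rfl fun i _ => BalTensor.add_tmul _ _ _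
  refine Finset.sum_eq_zero fun i _ => ?_
  have : k i = 0 := by
    ext t
    have h := congrArg (fun F => F ((LinearMap.toSpanSingleton A T t).comp (LinearMap.proj i))) hu
    rw [map_sum] at h
    simp only [LinearMap.sum_apply, tensorEval_tmul] at h
    rw [Finset.sum_eq_single i] at h
    · simpa using h
    · intro j _ hj
      simp [Pi.single_eq_of_ne hj.symm]
    · simp
  rw [this, BalTensor.zero_tmul]

end

/-- For finitely generated `V`, the canonical map `D T ⊗_A V → D Hom_A(V, T)` is bijective. -/
theorem tensorEval_bijective (B : Type u) [Ring B] [Algebra R B] [Module Bᵐᵒᵖ T]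
    [IsScalarTower R Bᵐᵒᵖ T] [SMulCommClass A Bᵐᵒᵖ T] (hE : Module.Injective R E)
    [IsNoetherianRing A] [Module.Finite A V] :
    Function.Bijective
      (tensorEval : BalTensor A (Dual R E T) V →+ ((V →ₗ[A] T) →ₗ[R] E)) := by
  -- A finite presentation $A^m\to A^n\to V\to0$ reduces the claim to free modules. Both functors
  -- are right exact: the tensor product always, and $D\,\mathrm{Hom}_A(-,T)$ because $E$ is
  -- injective.
  obtain ⟨n, p, hp⟩ := Module.Finite.exists_fin' A V
  obtain ⟨m, q, hq⟩ := Module.Finite.exists_fin' A (LinearMap.ker p)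
  let q' : (Fin m → A) →ₗ[A] (Fin n → A) := (LinearMap.ker p).subtype.comp q
  have hpq : p.comp q' = 0 := LinearMap.ext fun x => (q x).2
  constructor
  · rw [injective_iff_map_eq_zero]
    intro u hu
    obtain ⟨u, rfl⟩ := BalTensor.map_surjective (B := B) (M := Dual R E T) hp u
    -- Maps killed by $q'$ factor through $V$, where the form vanishes by assumption. So the form
    -- comes from $D\,\mathrm{Hom}_A(A^m,T)$, and the free case puts $u$ in the image of $DT\otimes
    -- q'$.
    obtain ⟨G, hG⟩ := exists_comp_eq_of_ker_le hE (precomp R T q') (tensorEval u) fun k hk => by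
      obtain ⟨h, rfl⟩ := exists_comp_eq_of_surjective hp k fun x hx => by
        obtain ⟨y, hy⟩ := hq ⟨x, hx⟩
        have := congrArg (fun l => l y) hk
        change k (q y) = 0 at this
        rwa [hy] at this
      have := congrArg (fun F => F h) hu
      simp only [tensorEval_map] at this
      exact this
    obtain ⟨w, rfl⟩ := tensorEval_free_surjective m G
    have : BalTensor.map (Dual R E T) B q' w = u := by
      rw [← sub_eq_zero]
      refine tensorEval_free_injective n (LinearMap.ext fun h => ?_)
      rw [map_sub, LinearMap.sub_apply, tensorEval_map]
      exact sub_eq_zero.2 (hG h)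
    rw [← this, BalTensor.map_map, hpq, BalTensor.map_zero_left]
  · intro F
    -- Restriction along the surjection $p$ is injective, so every form on $\mathrm{Hom}_A(V,T)$
    -- extends to $\mathrm{Hom}_A(A^n,T)$.
    obtain ⟨G, hG⟩ := exists_comp_eq_of_ker_le hE (precomp R T p) F fun k hk => by
      have : k = 0 := LinearMap.ext fun v => by
        obtain ⟨x, rfl⟩ := hp v
        exact congrArg (fun l => l x) hk
      rw [this]; exact zero_mem _
    obtain ⟨u, rfl⟩ := tensorEval_free_surjective n G
    exact ⟨BalTensor.map (Dual R E T) B p u, LinearMap.ext fun h => (tensorEval_map p u h).trans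
      (hG h)⟩

section

variable {B : Type u} [Ring B] [Algebra R B] [Module Bᵐᵒᵖ T] [IsScalarTower R Bᵐᵒᵖ T]
  [SMulCommClass A Bᵐᵒᵖ T]

/-- `D T ⊗_A a` is injective if all linear maps to `T` extend along `a`. -/
theorem map_injective_of_extension (hE : Module.Injective R E) [IsNoetherianRing A]
    [Module.Finite A V] (a : V →ₗ[A] W) (ha : ∀ h : V →ₗ[A] T, ∃ k : W →ₗ[A] T, k.comp a = h) :
    Function.Injective (BalTensor.map (Dual R E T) B a) := by
  rw [injective_iff_map_eq_zero]
  intro u hu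
  refine (injective_iff_map_eq_zero _).1 (tensorEval_bijective B hE).1 u (LinearMap.ext fun h => ?_)
  obtain ⟨k, rfl⟩ := ha h
  rw [← tensorEval_map (B := B), hu, map_zero]; rfl

/-- The canonical map `δ : D T ⊗_A T → D B` is bijective. -/
theorem delta_bijective (hE : Module.Injective R E) [IsNoetherianRing A] [Module.Finite A T]
    (hT : IsFaithfullyBalanced A B T) : Function.Bijective (delta R E A B T) := by
  have hr : Function.Bijective (rightMul : B → T →ₗ[A] T) := by
    have : SMulCommClass Bᵐᵒᵖ A T := SMulCommClass.symm A Bᵐᵒᵖ T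
    refine Function.Bijective.comp (g := Module.toModuleEnd A (S := Bᵐᵒᵖ) T) (f := op) hT.2
      MulOpposite.opEquiv.bijective
  -- Identifying $B$ with $\mathrm{End}_A(T)$ turns $\delta$ into the evaluation map for $V=T$.
  let ρ : B ≃ₗ[R] (T →ₗ[A] T) := LinearEquiv.ofBijective
    { toFun := rightMul
      map_add' := fun b c => LinearMap.ext fun t => add_smul (op b) (op c) t
      map_smul' := fun r b => LinearMap.ext fun t => smul_assoc r (op b) t } hr
  have h (u : BalTensor A (Dual R E T) T) (b : B) :
      delta R E A B T u b = tensorEval u (ρ b) := by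
    refine BalTensor.induction (p := fun u => delta R E A B T u b = tensorEval u (ρ b)) ?_
      (fun f t => rfl) (fun u v hu hv => ?_) u
    · rw [map_zero, map_zero]; rfl
    · rw [map_add, map_add, Dual.add_apply, hu, hv]; rfl
  have hbij := tensorEval_bijective (R := R) (E := E) (A := A) (T := T) (V := T) B hE
  constructor
  · rw [injective_iff_map_eq_zero]
    intro u hu
    refine (injective_iff_map_eq_zero _).1 hbij.1 u (LinearMap.ext fun k => ?_)
    obtain ⟨b, rfl⟩ := ρ.surjective k
    rw [← h, hu]; rfl
  · intro f
    obtain ⟨u, hu⟩ := hbij.2 ((show B →ₗ[R] E from f).comp ρ.symm.toLinearMap)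
    refine ⟨u, Dual.ext fun b => ?_⟩
    rw [h, hu]
    exact congrArg f (ρ.symm_apply_apply b)

end

end Evaluation

/-! ### The functor `L` -/

section LFunctor

variable {R E A B T : Type u} [CommRing R] [AddCommGroup E] [Module R E]
  [Ring A] [Algebra R A] [Ring B] [Algebra R B]
  [AddCommGroup T] [Module R T] [Module A T] [Module Bᵐᵒᵖ T]
  [IsScalarTower R A T] [IsScalarTower R Bᵐᵒᵖ T] [SMulCommClass A Bᵐᵒᵖ T]
  (hδ : Function.Bijective (delta R E A B T))
  {V V' V'' : Type u} [AddCommGroup V] [Module A V] [AddCommGroup V'] [Module A V']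
  [AddCommGroup V''] [Module A V'']

namespace LMod

theorem map_id : map hδ (LinearMap.id : V →ₗ[A] V) = LinearMap.id :=
  LinearMap.ext fun p => Prod.ext rfl (BalTensor.map_id p.2)

theorem map_comp (g : V →ₗ[A] V') (h : V' →ₗ[A] V'') :
    map hδ (h.comp g) = (map hδ h).comp (map hδ g) :=
  LinearMap.ext fun p => Prod.ext rfl (BalTensor.map_map g h p.2).symm

theorem map_add (g h : V →ₗ[A] V') : map hδ (g + h) = map hδ g + map hδ h :=
  LinearMap.ext fun p => Prod.ext rfl (BalTensor.map_add_left g h p.2)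

/-- `L` as an additive map on morphisms. -/
def mapHom : (V →ₗ[A] V') →+ (LMod hδ V →ₗ[TrivExt R E B] LMod hδ V') :=
  AddMonoidHom.mk' (map hδ) (map_add hδ)

/-- The identity of `T` as an element of `L(T)`. -/
def unit : LMod hδ T :=
  ((show HomMod A T T from LinearMap.id), (0 : BalTensor A (Dual R E T) T))

theorem smul_unit (τ : TrivExt R E B) :
    τ • unit hδ = ((show HomMod A T T from rightMul τ.fst), deltaInv hδ τ.snd) := by
  rw [smul_def]
  refine Prod.ext ?_ ?_
  · change τ.fst • (show HomMod A T T from LinearMap.id) + 0 = _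
    rw [add_zero]; rfl
  · change τ.fst • (0 : BalTensor A (Dual R E T) T) + star hδ τ.snd _ = _
    rw [smul_zero, zero_add]
    exact BalTensor.map_id _

/-- `L(T)` is free of rank one. -/
theorem smul_unit_bijective (hT : IsFaithfullyBalanced A B T) :
    Function.Bijective (LinearMap.toSpanSingleton (TrivExt R E B) (LMod hδ T) (unit hδ)) := by
  constructor
  · intro τ σ h
    rw [LinearMap.toSpanSingleton_apply, LinearMap.toSpanSingleton_apply, smul_unit, smul_unit] at h
    refine TrivSqZeroExt.ext ?_ ((deltaInv hδ).injective (congrArg Prod.snd h))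
    have h1 := congrArg Prod.fst h
    exact congrArg unop (hT.2.1 h1)
  · intro p
    obtain ⟨b, hb⟩ := hT.2.2 p.1.toLin
    obtain ⟨f, hf⟩ := (deltaInv hδ).surjective p.2
    refine ⟨TrivSqZeroExt.inl (unop b) + TrivSqZeroExt.inr f, ?_⟩
    rw [LinearMap.toSpanSingleton_apply, smul_unit]
    simp only [TrivSqZeroExt.fst_add, TrivSqZeroExt.snd_add, TrivSqZeroExt.fst_inl,
      TrivSqZeroExt.fst_inr, TrivSqZeroExt.snd_inl, TrivSqZeroExt.snd_inr, add_zero, zero_add]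
    exact Prod.ext hb hf

theorem projective_self (hT : IsFaithfullyBalanced A B T) :
    Module.Projective (TrivExt R E B) (LMod hδ T) :=
  Module.Projective.of_equiv' (LinearEquiv.ofBijective _ (smul_unit_bijective hδ hT))

/-- `L(V)` is projective for `V` in `add T`. -/
theorem projective_of_add (hT : IsFaithfullyBalanced A B T) (n : ℕ) (i : V →ₗ[A] (Fin n → T))
    (p : (Fin n → T) →ₗ[A] V) (h : p.comp i = LinearMap.id) :
    Module.Projective (TrivExt R E B) (LMod hδ V) := by
  have := projective_self hδ hT
  have : Module.Projective (TrivExt R E B) (Fin n → LMod hδ T) :=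
    Module.Projective.of_equiv' (DirectSum.linearEquivFunOnFintype _ _ fun _ => LMod hδ T)
  let I : LMod hδ V →ₗ[TrivExt R E B] (Fin n → LMod hδ T) :=
    LinearMap.pi fun j => map hδ ((LinearMap.proj j).comp i)
  let P : (Fin n → LMod hδ T) →ₗ[TrivExt R E B] LMod hδ V :=
    ∑ j, (map hδ (p.comp (LinearMap.single A (fun _ => T) j))).comp (LinearMap.proj j)
  refine Module.Projective.of_split I P ?_
  rw [← map_id, ← h]
  -- The identity of $V$ is a finite sum of maps through $T$. Additivity of $L$ then makes $L(V)$ a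
  -- summand of $L(T)^n$ without computing $L(T^n)$.
  have hp : p.comp i = ∑ j, (p.comp (LinearMap.single A (fun _ => T) j)).comp
      ((LinearMap.proj j).comp i) := by
    ext v
    simp only [LinearMap.sum_apply, LinearMap.comp_apply, LinearMap.proj_apply, ← map_sum]
    congr 1
    exact (LinearMap.sum_single_apply (φ := fun _ : Fin n => T) (i v)).symm
  rw [hp]
  change _ = mapHom hδ _
  rw [map_sum]
  ext x : 1
  simp only [P, LinearMap.comp_apply, LinearMap.sum_apply]
  refine Finset.sum_congr rfl fun j _ => ?_
  exact congrArg (fun l => l x) (map_comp hδ ((LinearMap.proj j).comp i)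
    (p.comp (LinearMap.single A (fun _ => T) j))).symm

end LMod

end LFunctor

/-! ### Exactness of Wakamatsu's construction -/

section Exactness

variable {R E A B T : Type u} [CommRing R] [AddCommGroup E] [Module R E]
  [Ring A] [Algebra R A] [Ring B] [Algebra R B]
  [AddCommGroup T] [Module R T] [Module A T] [Module Bᵐᵒᵖ T]
  [IsScalarTower R A T] [IsScalarTower R Bᵐᵒᵖ T] [SMulCommClass A Bᵐᵒᵖ T]
  (hδ : Function.Bijective (delta R E A B T))
  {X Y Z : Type u} [AddCommGroup X] [Module A X] [Module (TrivExt R E A) X]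
  [IsScalarTower A (TrivExt R E A) X]
  [AddCommGroup Y] [Module A Y] [Module (TrivExt R E A) Y]
  [IsScalarTower A (TrivExt R E A) Y]
  [AddCommGroup Z] [Module A Z] [Module (TrivExt R E A) Z]
  [IsScalarTower A (TrivExt R E A) Z]
  {VX VY VZ : Type u} [AddCommGroup VX] [Module A VX] [AddCommGroup VY] [Module A VY]
  [AddCommGroup VZ] [Module A VZ]

theorem map_adj (f : X →ₗ[TrivExt R E A] Y) (u : BalTensor A (Dual R E T) X) :
    HomMod.map B T (f.restrictScalars A) (adj R E A B T X u) =
      adj R E A B T Y (BalTensor.map (Dual R E T) B (f.restrictScalars A) u) := by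
  refine BalTensor.induction (p := fun u =>
    HomMod.map B T (f.restrictScalars A) (adj R E A B T X u) =
      adj R E A B T Y (BalTensor.map (Dual R E T) B (f.restrictScalars A) u)) ?_
    (fun k x => ?_) (fun u v hu hv => ?_) u
  · simp only [map_zero]
  · ext t
    exact map_smul f (TrivSqZeroExt.inr (deltaPrime t k) : TrivExt R E A) x
  · simp only [map_add, hu, hv]

/-- View an element of `D T ⊗_A X` as an element of the `T(B)`-module `D T ⊗_A X`. -/
def DTMod.of (u : BalTensor A (Dual R E T) X) : DTMod hδ X := u

/-- Both components of the embedding end with `a`. Hence $L(c)$ descends to the cokernel whenever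
$c\circ a=0$. -/
theorem LMod.map_embed_eq_zero {U : Type u} [AddCommGroup U] [Module A U] (a : X →ₗ[A] VX)
    (c : VX →ₗ[A] U) (hc : c.comp a = 0) (u : DTMod hδ X) :
    LMod.map hδ c (embed hδ a u) = 0 := by
  refine Prod.ext (HomMod.ext fun t => ?_) ?_
  · have h (x : X) : c (a x) = 0 := congrArg (fun l => l x) hc
    change c (-a _) = 0
    rw [map_neg, h, neg_zero]
  · change BalTensor.map (Dual R E T) B c (BalTensor.map (Dual R E T) B a _) = 0
    rw [BalTensor.map_map, hc, BalTensor.map_zero_left]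

/-- This is injectivity of $DT\otimes\mathrm{coker}(a_X)\to DT\otimes\mathrm{coker}(a_Y)$, written
with representatives. By duality, a class on the left is tested against maps $\mathrm{coker}(a_X)\to
T$, and these are assumed to extend. -/
theorem mem_range_map_of_extension (hE : Module.Injective R E) [IsNoetherianRing A]
    [Module.Finite A VX] (aX : X →ₗ[A] VX) (aY : Y →ₗ[A] VY) (i : VX →ₗ[A] VY)
    (hext : ∀ h : VX →ₗ[A] T, h.comp aX = 0 → ∃ e : VY →ₗ[A] T, e.comp i = h ∧ e.comp aY = 0)
    (w : BalTensor A (Dual R E T) VX)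
    (hw : BalTensor.map (Dual R E T) B i w ∈ LinearMap.range (BalTensor.map (Dual R E T) B aY)) :
    w ∈ LinearMap.range (BalTensor.map (Dual R E T) B aX) := by
  obtain ⟨u, hu⟩ := hw
  have hex : Function.Exact aX (LinearMap.range aX).mkQ := LinearMap.exact_map_mkQ_range aX
  refine BalTensor.exists_map_eq hex (Submodule.mkQ_surjective _) ?_
  refine (injective_iff_map_eq_zero _).1 (tensorEval_bijective B hE).1 _ (LinearMap.ext fun h => ?_)
  obtain ⟨e, he, he'⟩ := hext (h.comp (LinearMap.range aX).mkQ) (by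
    rw [LinearMap.comp_assoc, hex.linearMap_comp_eq_zero, LinearMap.comp_zero])
  rw [tensorEval_map, ← he, ← tensorEval_map (B := B), ← hu, tensorEval_map, he', map_zero]
  rfl

variable {f : X →ₗ[TrivExt R E A] Y} {g : Y →ₗ[TrivExt R E A] Z}
  {aX : X →ₗ[A] VX} {aY : Y →ₗ[A] VY} {aZ : Z →ₗ[A] VZ} {i : VX →ₗ[A] VY} {p : VY →ₗ[A] VZ}
  (hf : aY.comp (f.restrictScalars A) = i.comp aX) (hg : aZ.comp (g.restrictScalars A) = p.comp aY)

theorem wakMap_injective (hi : Function.Injective i)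
    (hY : Function.Injective (BalTensor.map (Dual R E T) B aY))
    (hC : ∀ w : BalTensor A (Dual R E T) VX, BalTensor.map (Dual R E T) B i w ∈
      LinearMap.range (BalTensor.map (Dual R E T) B aY) →
      w ∈ LinearMap.range (BalTensor.map (Dual R E T) B aX)) :
    Function.Injective (wakMap hδ aX aY f i hf) := by
  rw [injective_iff_map_eq_zero]
  intro q hq
  obtain ⟨⟨h, z⟩, rfl⟩ := Submodule.Quotient.mk_surjective _ q
  obtain ⟨u, hu⟩ := (Submodule.Quotient.mk_eq_zero _).1 hq
  change BalTensor A (Dual R E T) Y at u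
  have hu1 : -HomMod.map B T aY (adj R E A B T Y u) = HomMod.map B T i h := congrArg Prod.fst hu
  have hu2 : BalTensor.map (Dual R E T) B aY u = BalTensor.map (Dual R E T) B i z :=
    congrArg Prod.snd hu
  -- The tensor component determines everything: $z$ comes from some $w$ over $X$, the injectivity
  -- of $DT\otimes a_Y$ identifies $u$ with the image of $w$, and the Hom component then follows
  -- from injectivity of $i$.
  obtain ⟨w, rfl⟩ := hC z ⟨_, hu2⟩
  obtain rfl : u = BalTensor.map (Dual R E T) B (f.restrictScalars A) w := hY (by
    rw [hu2, BalTensor.map_map, BalTensor.map_map, hf])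
  refine (Submodule.Quotient.mk_eq_zero _).2 ⟨DTMod.of hδ w, Prod.ext ?_ rfl⟩
  ext t
  refine hi ?_
  rw [← map_adj] at hu1
  have h1 := congrArg (fun l : HomMod A T VY => l t) hu1
  refine Eq.trans ?_ h1
  change i (-aX (adj R E A B T X w t)) = -aY (f (adj R E A B T X w t))
  rw [map_neg]
  exact congrArg Neg.neg (congrArg (fun l => l (adj R E A B T X w t)) hf).symm

theorem wakMap_exact (hgs : Function.Surjective g) (hi : Function.Injective i)
    (hip : Function.Exact i p) (hps : Function.Surjective p) :
    Function.Exact (wakMap hδ aX aY f i hf) (wakMap hδ aY aZ g p hg) := by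
  have hpi : p.comp i = 0 := LinearMap.ext hip.apply_apply_eq_zero
  intro q
  constructor
  · intro hq
    obtain ⟨y, rfl⟩ := Submodule.Quotient.mk_surjective _ q
    obtain ⟨u, hu⟩ := (Submodule.Quotient.mk_eq_zero _).1 hq
    -- The relation over $Z$ lifts to one over $Y$. Subtracting it replaces the representative by
    -- one killed by $L(p)$ itself; left exactness of Hom and right exactness of the tensor product
    -- then lift the two components separately.
    obtain ⟨v, rfl⟩ := BalTensor.map_surjective (B := B) (M := Dual R E T)
      (g := g.restrictScalars A) hgs u
    have h0 : LMod.map hδ p (y - embed hδ aY (DTMod.of hδ v)) = 0 := by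
      rw [map_sub, map_embed hδ aY aZ g p hg]
      exact sub_eq_zero.2 hu.symm
    have hy : (Submodule.Quotient.mk (y - embed hδ aY (DTMod.of hδ v)) : WakMod hδ aY) =
        Submodule.Quotient.mk y := by
      rw [Submodule.Quotient.mk_sub, sub_eq_self]
      exact (Submodule.Quotient.mk_eq_zero _).2 ⟨_, rfl⟩
    rw [← hy]
    clear hy
    generalize y - embed hδ aY (DTMod.of hδ v) = y' at h0 ⊢
    obtain ⟨h, z⟩ := y'
    have h1 (t : T) : p (h t) = 0 := congrArg (fun l : HomMod A T VZ => l t) (congrArg Prod.fst h0)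
    obtain ⟨z, rfl⟩ := BalTensor.exists_map_eq (B := B) hip hps (congrArg Prod.snd h0)
    choose k hk using fun t => (hip (h t)).1 (h1 t)
    refine ⟨Submodule.Quotient.mk ((show HomMod A T VX from
      { toFun := k
        map_add' := fun s t => hi (by rw [hk, map_add, map_add, hk, hk])
        map_smul' := fun a t => hi (by rw [hk, map_smul, RingHom.id_apply, map_smul, hk]) }), z), ?_⟩
    exact congrArg Submodule.Quotient.mk (Prod.ext (HomMod.ext hk) rfl)
  · rintro ⟨q, rfl⟩
    obtain ⟨y, rfl⟩ := Submodule.Quotient.mk_surjective _ q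
    change Submodule.Quotient.mk (LMod.map hδ p (LMod.map hδ i y)) = _
    rw [← LinearMap.comp_apply, ← LMod.map_comp, hpi]
    refine congrArg Submodule.Quotient.mk (Prod.ext rfl (BalTensor.map_zero_left _))

/-- The tensor component is always onto; only the Hom component needs lifting against $p$, later
supplied by $\mathrm{Ext}^1_A(T,V_X)=0$. -/
theorem wakMap_surjective (hps : Function.Surjective p)
    (hT : ∀ h : T →ₗ[A] VZ, ∃ k : T →ₗ[A] VY, p.comp k = h) :
    Function.Surjective (wakMap hδ aY aZ g p hg) := by
  intro q
  obtain ⟨⟨h, z⟩, rfl⟩ := Submodule.Quotient.mk_surjective _ q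
  obtain ⟨k, rfl⟩ := hT h
  obtain ⟨w, rfl⟩ := BalTensor.map_surjective (B := B) (M := Dual R E T) hps z
  exact ⟨Submodule.Quotient.mk ((show HomMod A T VY from k), w), rfl⟩

end Exactness

/-! ### Special preenvelopes -/

section Preenvelopes

open CategoryTheory Abelian

variable {A : Type u} [Ring A]

/-! ### Vanishing of Ext and its long exact sequences -/

section Ext

variable {X Y Z V W : FGModuleCat.{u} A}

/-- A short exact sequence of finitely generated modules as a short complex of modules. -/
def moduleComplex {i : X →ₗ[A] Y} {p : Y →ₗ[A] Z} (h : Function.Exact i p) :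
    ShortComplex (ModuleCat.{u} A) :=
  ShortComplex.mk (X₁ := X.obj) (X₂ := Y.obj) (X₃ := Z.obj) (ModuleCat.ofHom i) (ModuleCat.ofHom p)
    (ModuleCat.hom_ext h.linearMap_comp_eq_zero)

theorem moduleComplex_shortExact {i : X →ₗ[A] Y} {p : Y →ₗ[A] Z} (hi : Function.Injective i)
    (h : Function.Exact i p) (hp : Function.Surjective p) : (moduleComplex h).ShortExact where
  exact := (ShortComplex.ShortExact.moduleCat_exact_iff_function_exact _).2 h
  mono_f := (ModuleCat.mono_iff_injective _).2 hi
  epi_g := (ModuleCat.epi_iff_surjective _).2 hp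

theorem ExtVanishes.eq_zero {n : ℕ} (h : ExtVanishes n X Y) (x : Ext X.obj Y.obj n) : x = 0 :=
  Subsingleton.elim (h := h) x 0

theorem extVanishes_of_forall {n : ℕ} (h : ∀ x : Ext X.obj Y.obj n, x = 0) : ExtVanishes n X Y :=
  ⟨fun x y => by rw [h x, h y]⟩

theorem ExtVanishes.of_equiv (e : X ≃ₗ[A] Y) {n : ℕ} (h : ExtVanishes n X V) :
    ExtVanishes n Y V := extVanishes_of_forall fun x => by
  have h1 : (ModuleCat.ofHom e.symm.toLinearMap : Y.obj ⟶ X.obj) ≫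
      (ModuleCat.ofHom e.toLinearMap : X.obj ⟶ Y.obj) = 𝟙 _ := by
    ext y; exact e.apply_symm_apply y
  rw [← Ext.mk₀_id_comp x, ← h1, ← Ext.mk₀_comp_mk₀_assoc, h.eq_zero (Ext.comp _ x _), Ext.comp_zero]

theorem extVanishes_of_projective [Module.Projective A X] : ExtVanishes 1 X V :=
  have : Module.Projective A X.obj := inferInstanceAs (Module.Projective A X)
  have : Projective X.obj := ModuleCat.projective_of_categoryTheory_projective X.obj
  extVanishes_of_forall fun x => x.eq_zero_of_projective

theorem extVanishes_of_injective [Module.Injective A V] : ExtVanishes 1 X V :=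
  have : Module.Injective A V.obj := inferInstanceAs (Module.Injective A V)
  have : Injective V.obj := Module.injective_object_of_injective_module A V.obj
  extVanishes_of_forall fun x => x.eq_zero_of_injective

variable {i : X →ₗ[A] Y} {p : Y →ₗ[A] Z} (hi : Function.Injective i) (h : Function.Exact i p)
  (hp : Function.Surjective p)

include hi h hp

/-- The obstruction to extending a map along $i$ is its image in $\mathrm{Ext}^1(Z,V)$. -/
theorem exists_extension_of_extVanishes (hV : ExtVanishes 1 Z V) (k : X →ₗ[A] V) :
    ∃ l : Y →ₗ[A] V, l.comp i = k := by
  have hS := moduleComplex_shortExact hi h hp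
  obtain ⟨x, hx⟩ := Ext.contravariant_sequence_exact₁ hS V.obj
    (Ext.mk₀ (ModuleCat.ofHom k : X.obj ⟶ V.obj)) (n₁ := 1) rfl (hV.eq_zero _)
  obtain ⟨l, rfl⟩ := Ext.homEquiv₀.symm.surjective x
  refine ⟨l.hom, ?_⟩
  have := Ext.homEquiv₀.symm.injective ((Ext.mk₀_comp_mk₀ _ _).symm.trans hx)
  exact congrArg ModuleCat.Hom.hom this

/-- The obstruction to lifting a map through $p$ is its image in $\mathrm{Ext}^1(W,X)$. -/
theorem exists_lift_of_extVanishes (hW : ExtVanishes 1 W X) (k : W →ₗ[A] Z) :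
    ∃ l : W →ₗ[A] Y, p.comp l = k := by
  have hS := moduleComplex_shortExact hi h hp
  obtain ⟨x, hx⟩ := Ext.covariant_sequence_exact₃ W.obj hS
    (Ext.mk₀ (ModuleCat.ofHom k : W.obj ⟶ Z.obj)) (n₁ := 1) rfl (hW.eq_zero _)
  obtain ⟨l, rfl⟩ := Ext.homEquiv₀.symm.surjective x
  refine ⟨l.hom, ?_⟩
  have := Ext.homEquiv₀.symm.injective ((Ext.mk₀_comp_mk₀ _ _).symm.trans hx)
  exact congrArg ModuleCat.Hom.hom this

theorem extVanishes_middle_left (hX : ExtVanishes 1 X V) (hZ : ExtVanishes 1 Z V) :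
    ExtVanishes 1 Y V := extVanishes_of_forall fun x => by
  obtain ⟨z, rfl⟩ := Ext.contravariant_sequence_exact₂ (moduleComplex_shortExact hi h hp) V.obj x
    (hX.eq_zero _)
  rw [hZ.eq_zero z]; exact Ext.comp_zero ..

theorem extVanishes_middle_right (hX : ExtVanishes 1 W X) (hZ : ExtVanishes 1 W Z) :
    ExtVanishes 1 W Y := extVanishes_of_forall fun x => by
  obtain ⟨z, rfl⟩ := Ext.covariant_sequence_exact₂ W.obj (moduleComplex_shortExact hi h hp) x
    (hZ.eq_zero _)
  rw [hX.eq_zero z]; exact Ext.zero_comp ..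

/-- With the hereditary condition in degree two, this closes $\mathcal V$ under cokernels of
monomorphisms. -/
theorem extVanishes_cokernel (hY : ExtVanishes 1 W Y) (hX : ExtVanishes 2 W X) :
    ExtVanishes 1 W Z := extVanishes_of_forall fun x => by
  obtain ⟨z, rfl⟩ := Ext.covariant_sequence_exact₃ W.obj (moduleComplex_shortExact hi h hp) x
    (n₁ := 2) rfl (hX.eq_zero _)
  rw [hY.eq_zero z]; exact Ext.zero_comp ..

end Ext

variable {𝒲 𝒱 : ObjectProperty (FGModuleCat.{u} A)}

namespace SpecialPreenvelope

variable {X : FGModuleCat.{u} A} (s : SpecialPreenvelope 𝒱 X)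

theorem exact_mkQ : Function.Exact s.α (LinearMap.range s.α).mkQ :=
  LinearMap.exact_map_mkQ_range s.α

theorem exists_extension {Y : FGModuleCat.{u} A} (hY : 𝒱 Y) (h : X →ₗ[A] Y) :
    ∃ k : s.V →ₗ[A] Y, k.comp s.α = h :=
  exists_extension_of_extVanishes (Z := FGModuleCat.of A (s.V ⧸ LinearMap.range s.α))
    s.injective s.exact_mkQ (Submodule.mkQ_surjective _) (s.cokernel Y hY) h

/-- The preenvelope is an extension of its cokernel, which lies in $\mathcal W$, by $X$. So modules
of $\mathcal W$ have their preenvelopes in $\mathcal W\cap\mathcal V$. -/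
theorem mem_left (hpair : IsCotorsionPair 𝒲 𝒱) (hX : 𝒲 X) : 𝒲 s.V :=
  (hpair.left_iff _).2 fun Y hY =>
    extVanishes_middle_left (Z := FGModuleCat.of A (s.V ⧸ LinearMap.range s.α))
      s.injective s.exact_mkQ (Submodule.mkQ_surjective _) ((hpair.left_iff _).1 hX Y hY)
      (s.cokernel Y hY)

/-- A linear map from `V` to a module in `𝒱` which vanishes on `X` factors through a module in the
kernel of the cotorsion pair by maps vanishing on `X`. -/
theorem exists_factorization (hpair : IsCotorsionPair 𝒲 𝒱)
    (α : ∀ X : FGModuleCat.{u} A, SpecialPreenvelope 𝒱 X) {Y : FGModuleCat.{u} A} (hY : 𝒱 Y)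
    (k : s.V →ₗ[A] Y) (hk : k.comp s.α = 0) :
    ∃ (U : FGModuleCat.{u} A) (_ : 𝒲 U ∧ 𝒱 U) (c : s.V →ₗ[A] U) (d : U →ₗ[A] Y),
      c.comp s.α = 0 ∧ d.comp c = k := by
  let C : FGModuleCat.{u} A := FGModuleCat.of A (s.V ⧸ LinearMap.range s.α)
  have hC : 𝒲 C := (hpair.left_iff _).2 s.cokernel
  let q : s.V →ₗ[A] C := (LinearMap.range s.α).mkQ
  -- The map factors through the cokernel $C\in\mathcal W$, and then through the preenvelope of $C$
  -- because its target lies in $\mathcal V$.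
  obtain ⟨l, hl⟩ := exists_comp_eq_of_surjective (p := q)
    (Submodule.mkQ_surjective _) k fun x hx => by
      obtain ⟨y, rfl⟩ := (s.exact_mkQ x).1 hx
      exact congrArg (fun l => l y) hk
  obtain ⟨d, hd⟩ := (α C).exists_extension hY l
  refine ⟨(α C).V, ⟨(α C).mem_left hpair hC, (α C).mem⟩, (α C).α.comp q, d, ?_, ?_⟩
  · have : q.comp s.α = 0 := s.exact_mkQ.linearMap_comp_eq_zero
    rw [LinearMap.comp_assoc, this, LinearMap.comp_zero]
  · rw [← LinearMap.comp_assoc, hd, hl]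

end SpecialPreenvelope

/-! ### A horseshoe lemma for special preenvelopes -/

/-- Special preenvelopes of the terms of a short exact sequence which form a short exact sequence,
such that maps extend along the induced map of cokernels. -/
structure Horseshoe {X Y Z : FGModuleCat.{u} A} (f : X →ₗ[A] Y) (g : Y →ₗ[A] Z)
    (sX : SpecialPreenvelope 𝒱 X) where
  sY : SpecialPreenvelope 𝒱 Y
  sZ : SpecialPreenvelope 𝒱 Z
  i : sX.V →ₗ[A] sY.V
  p : sY.V →ₗ[A] sZ.V
  injective : Function.Injective i
  exact : Function.Exact i p
  surjective : Function.Surjective p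
  comm_left : sY.α.comp f = i.comp sX.α
  comm_right : sZ.α.comp g = p.comp sY.α
  extend : ∀ W : FGModuleCat.{u} A, 𝒱 W → ∀ k : sX.V →ₗ[A] W, k.comp sX.α = 0 →
    ∃ e : sY.V →ₗ[A] W, e.comp i = k ∧ e.comp sY.α = 0

/-- A preenvelope $\beta:P\to V(P)$ of the pushout $P$ of $V_X\leftarrow X\to Y$ serves all terms at
once: $V_Y=V(P)$ and $V_Z=V(P)/V_X$. -/
theorem nonempty_horseshoe [IsNoetherianRing A] (hpair : IsCotorsionPair 𝒲 𝒱)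
    (hhered : IsHereditary 𝒲 𝒱) (α : ∀ X : FGModuleCat.{u} A, SpecialPreenvelope 𝒱 X)
    {X Y Z : FGModuleCat.{u} A} {f : X →ₗ[A] Y} {g : Y →ₗ[A] Z} (hf : Function.Injective f)
    (hfg : Function.Exact f g) (hg : Function.Surjective g) (s : SpecialPreenvelope 𝒱 X) :
    Nonempty (Horseshoe f g s) := by
  -- The pushout is the quotient of $V_X\times Y$ by the antidiagonal image of $X$. Both legs out of
  -- it are monomorphisms, since $f$ and $\alpha_X$ are.
  let N : Submodule A (s.V × Y) := LinearMap.range (s.α.prod (-f))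
  let P : FGModuleCat.{u} A := FGModuleCat.of A ((s.V × Y) ⧸ N)
  let jV : s.V →ₗ[A] P := N.mkQ.comp (LinearMap.inl A s.V Y)
  let jY : Y →ₗ[A] P := N.mkQ.comp (LinearMap.inr A s.V Y)
  have hj (v : s.V) (y : Y) (h : jV v = jY y) : ∃ x, s.α x = v ∧ f x = y := by
    obtain ⟨x, hx⟩ := (Submodule.Quotient.eq N).1 h
    refine ⟨x, ?_, ?_⟩
    · simpa using congrArg Prod.fst hx
    · simpa using congrArg Prod.snd hx
  have hcomm : jY.comp f = jV.comp s.α := LinearMap.ext fun x =>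
    ((Submodule.Quotient.eq N).2 ⟨x, by simp⟩).symm
  have hPs (w : P) : ∃ v y, w = jV v + jY y := by
    obtain ⟨⟨v, y⟩, rfl⟩ := N.mkQ_surjective w
    refine ⟨v, y, ?_⟩
    change N.mkQ _ = N.mkQ _ + N.mkQ _
    rw [← map_add]
    simp
  have hjV : Function.Injective jV := (injective_iff_map_eq_zero _).2 fun v hv => by
    obtain ⟨x, rfl, hx⟩ := hj v 0 (by rw [hv, map_zero])
    rw [(injective_iff_map_eq_zero f).1 hf x hx, map_zero]
  have hjY : Function.Injective jY := (injective_iff_map_eq_zero _).2 fun y hy => by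
    obtain ⟨x, hx, rfl⟩ := hj 0 y (by rw [hy, map_zero])
    rw [(injective_iff_map_eq_zero s.α).1 s.injective x hx, map_zero]
  have hdesc {W : FGModuleCat.{u} A} (a : s.V →ₗ[A] W) (b : Y →ₗ[A] W)
      (h : b.comp f = a.comp s.α) : ∃ l : P →ₗ[A] W, l.comp jV = a ∧ l.comp jY = b := by
    refine ⟨N.liftQ (a.coprod b) ?_, ?_, ?_⟩
    · rintro _ ⟨x, rfl⟩
      have := congrArg (fun l => l x) h
      simp only [LinearMap.comp_apply] at this
      simp [this]
    · ext v
      change (a.coprod b) (v, 0) = a v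
      simp
    · ext y
      change (a.coprod b) (0, y) = b y
      simp
  let β := (α P).α
  let V := (α P).V
  have hβ : Function.Injective β := (α P).injective
  let sY : SpecialPreenvelope 𝒱 Y :=
    { V := V
      mem := (α P).mem
      α := β.comp jY
      injective := hβ.comp hjY
      cokernel := fun W hW => by
        let i : s.V ⧸ LinearMap.range s.α →ₗ[A] V ⧸ LinearMap.range (β.comp jY) :=
          Submodule.mapQ _ _ (β.comp jV) (by
            rintro _ ⟨x, rfl⟩
            exact ⟨f x, congrArg (fun l => β (l x)) hcomm⟩)
        let p : V ⧸ LinearMap.range (β.comp jY) →ₗ[A] V ⧸ LinearMap.range β :=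
          Submodule.factor (LinearMap.range_comp_le_range jY β)
        -- Since $P/Y\cong V_X/X$, the cokernel of $Y\to V(P)$ is an extension of $V(P)/P$ by
        -- $V_X/X$, and both are left orthogonal to $\mathcal V$.
        refine extVanishes_middle_left (X := FGModuleCat.of A (s.V ⧸ LinearMap.range s.α))
          (Z := FGModuleCat.of A (V ⧸ LinearMap.range β)) (i := i) (p := p) ?_ ?_ ?_
          (s.cokernel W hW) ((α P).cokernel W hW)
        · refine (injective_iff_map_eq_zero i).2 fun q hq => ?_
          obtain ⟨v, rfl⟩ := Submodule.Quotient.mk_surjective _ q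
          obtain ⟨y, hy⟩ := (Submodule.Quotient.mk_eq_zero _).1 hq
          obtain ⟨x, rfl, -⟩ := hj v y (hβ hy.symm)
          exact (Submodule.Quotient.mk_eq_zero _).2 ⟨x, rfl⟩
        · intro q
          constructor
          · intro hq
            obtain ⟨v, rfl⟩ := Submodule.Quotient.mk_surjective _ q
            obtain ⟨w, rfl⟩ := (Submodule.Quotient.mk_eq_zero _).1 hq
            obtain ⟨v, y, rfl⟩ := hPs w
            refine ⟨Submodule.Quotient.mk v, (Submodule.Quotient.eq _).2 ⟨-y, ?_⟩⟩
            simp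
          · rintro ⟨q, rfl⟩
            obtain ⟨v, rfl⟩ := Submodule.Quotient.mk_surjective _ q
            exact (Submodule.Quotient.mk_eq_zero _).2 ⟨jV v, rfl⟩
        · exact Submodule.factor_surjective _ }
  -- The pushout satisfies $P/V_X\cong Z$. Hence $\beta$ induces a monomorphism $\gamma:Z\to
  -- V(P)/V_X$.
  obtain ⟨π, hπV, hπY⟩ := hdesc (W := Z) 0 g (by
    rw [LinearMap.zero_comp]; exact hfg.linearMap_comp_eq_zero)
  have hπs : Function.Surjective π := fun z => by
    obtain ⟨y, rfl⟩ := hg z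
    exact ⟨jY y, congrArg (fun l => l y) hπY⟩
  have hπk (w : P) (hw : π w = 0) : ∃ v, jV v = w := by
    obtain ⟨v, y, rfl⟩ := hPs w
    rw [map_add, show π (jV v) = 0 from congrArg (fun l => l v) hπV,
      show π (jY y) = g y from congrArg (fun l => l y) hπY, zero_add] at hw
    obtain ⟨x, rfl⟩ := (hfg y).1 hw
    refine ⟨v + s.α x, ?_⟩
    rw [map_add]
    exact congrArg (fun l => jV v + l x) hcomm.symm
  let M : Submodule A V := LinearMap.range (β.comp jV)
  obtain ⟨γ, hγ⟩ := exists_comp_eq_of_surjective hπs (M.mkQ.comp β) fun w hw => by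
    obtain ⟨v, rfl⟩ := hπk w hw
    exact (Submodule.Quotient.mk_eq_zero M).2 ⟨v, rfl⟩
  have hMexact : Function.Exact (β.comp jV) M.mkQ := LinearMap.exact_map_mkQ_range _
  let sZ : SpecialPreenvelope 𝒱 Z :=
    { V := FGModuleCat.of A (V ⧸ M)
      mem := (hpair.right_iff _).2 fun W hW =>
        extVanishes_cokernel (i := β.comp jV) (hβ.comp hjV) hMexact M.mkQ_surjective
          ((hpair.right_iff _).1 (α P).mem W hW) (hhered 2 (by norm_num) W _ hW s.mem)
      α := γ
      injective := (injective_iff_map_eq_zero γ).2 fun z hz => by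
        obtain ⟨w, rfl⟩ := hπs z
        rw [← LinearMap.comp_apply, hγ] at hz
        obtain ⟨v, hv⟩ := (Submodule.Quotient.mk_eq_zero M).1 hz
        rw [← hβ hv]
        exact congrArg (fun l => l v) hπV
      cokernel := fun W hW => by
        have hle : M ≤ LinearMap.range β := LinearMap.range_comp_le_range jV β
        -- By the third isomorphism theorem the cokernel of $\gamma$ is again $V(P)/P$.
        have hr : (LinearMap.range β).map M.mkQ = LinearMap.range γ := by
          rw [← LinearMap.range_comp, ← hγ, LinearMap.range_comp, LinearMap.range_eq_top.2 hπs,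
            Submodule.map_top]
        exact ExtVanishes.of_equiv (X := FGModuleCat.of A (V ⧸ LinearMap.range β))
          ((Submodule.quotientQuotientEquivQuotient M _ hle).symm.trans
            (Submodule.quotEquivOfEq _ _ hr)) ((α P).cokernel W hW) }
  exact ⟨{
    sY := sY
    sZ := sZ
    i := β.comp jV
    p := M.mkQ
    injective := hβ.comp hjV
    exact := hMexact
    surjective := M.mkQ_surjective
    comm_left := congrArg β.comp hcomm
    comm_right := by
      change γ.comp g = M.mkQ.comp (β.comp jY)
      rw [← hπY, ← LinearMap.comp_assoc, hγ, LinearMap.comp_assoc]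
    extend := fun W hW k hk => by
      -- A map on $V_X$ that kills $X$ glues with zero on $Y$ to a map on the pushout, which extends
      -- to $V(P)$.
      obtain ⟨l, hl, hl'⟩ := hdesc k 0 (by rw [hk, LinearMap.zero_comp])
      obtain ⟨e, he⟩ := (α P).exists_extension hW l
      refine ⟨e, ?_, ?_⟩
      · rw [← hl, ← he, LinearMap.comp_assoc]
      · change e.comp (β.comp jY) = 0
        rw [← LinearMap.comp_assoc, he, hl'] }⟩

/-- Morphisms of short exact sequences lift to the short exact sequences of preenvelopes. -/
theorem Horseshoe.exists_lift {X Y Z X' Y' Z' : FGModuleCat.{u} A} {f : X →ₗ[A] Y} {g : Y →ₗ[A] Z}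
    {f' : X' →ₗ[A] Y'} {g' : Y' →ₗ[A] Z'} {s : SpecialPreenvelope 𝒱 X}
    {s' : SpecialPreenvelope 𝒱 X'} (H : Horseshoe f g s) (H' : Horseshoe f' g' s')
    (hg : Function.Surjective g) {a : X →ₗ[A] X'} {b : Y →ₗ[A] Y'} {c : Z →ₗ[A] Z'}
    (hab : f'.comp a = b.comp f) (hbc : g'.comp b = c.comp g) :
    ∃ (l₁ : s.V →ₗ[A] s'.V) (l₂ : H.sY.V →ₗ[A] H'.sY.V) (l₃ : H.sZ.V →ₗ[A] H'.sZ.V),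
      s'.α.comp a = l₁.comp s.α ∧ H'.sY.α.comp b = l₂.comp H.sY.α ∧
      H'.sZ.α.comp c = l₃.comp H.sZ.α ∧ H'.i.comp l₁ = l₂.comp H.i ∧
      H'.p.comp l₂ = l₃.comp H.p := by
  obtain ⟨l₁, h₁⟩ := s.exists_extension s'.mem (s'.α.comp a)
  obtain ⟨m, hm⟩ := H.sY.exists_extension H'.sY.mem (H'.sY.α.comp b)
  -- The lifts over $X$ and $Y$ are chosen independently, and their mismatch on $V_X$ kills $X$. The
  -- correction $e$ removes it without changing the map on $Y$.
  obtain ⟨e, he, he'⟩ := H.extend _ H'.sY.mem (m.comp H.i - H'.i.comp l₁) (by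
    rw [LinearMap.sub_comp, LinearMap.comp_assoc, ← H.comm_left, ← LinearMap.comp_assoc, hm,
      LinearMap.comp_assoc, ← hab, LinearMap.comp_assoc, h₁, ← LinearMap.comp_assoc, H'.comm_left,
      LinearMap.comp_assoc, sub_self])
  have hi : H'.i.comp l₁ = (m - e).comp H.i := by
    rw [LinearMap.sub_comp, he, sub_sub_cancel]
  have hb : H'.sY.α.comp b = (m - e).comp H.sY.α := by
    rw [LinearMap.sub_comp, he', sub_zero, hm]
  obtain ⟨l₃, h₃⟩ := exists_comp_eq_of_surjective H.surjective (H'.p.comp (m - e)) fun v hv => by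
    obtain ⟨w, rfl⟩ := (H.exact v).1 hv
    have := congrArg (fun l => H'.p (l w)) hi
    exact this.symm.trans (H'.exact.apply_apply_eq_zero _)
  refine ⟨l₁, m - e, l₃, h₁.symm, hb, ?_, hi, h₃.symm⟩
  refine LinearMap.ext fun z => ?_
  obtain ⟨y, rfl⟩ := hg z
  have h : (H'.sZ.α.comp c).comp g = (l₃.comp H.sZ.α).comp g := by
    rw [LinearMap.comp_assoc, ← hbc, ← LinearMap.comp_assoc, H'.comm_right, LinearMap.comp_assoc,
      hb, LinearMap.comp_assoc, H.comm_right]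
    exact congrArg (fun l => l.comp H.sY.α) h₃.symm
  exact congrArg (fun l => l y) h

end Preenvelopes

/-! ### Stable categories of Frobenius categories -/

section Stable

open CategoryTheory CategoryTheory.Limits

universe v w v' w'

variable {𝒜 : Type w} [Category.{v} 𝒜] [Abelian 𝒜]

instance : (toStable 𝒜).Additive := CategoryTheory.Quotient.functor_additive _ _

theorem toStable_map_eq_iff {X Y : 𝒜} (f g : X ⟶ Y) :
    (toStable 𝒜).map f = (toStable 𝒜).map g ↔ FactorsThroughProjective (f - g) :=
  CategoryTheory.Quotient.functor_map_eq_iff (stableRel 𝒜) f g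

theorem toStable_map_eq_zero {X Y : 𝒜} {f : X ⟶ Y} (hf : FactorsThroughProjective f) :
    (toStable 𝒜).map f = 0 := by
  rw [← (toStable 𝒜).map_zero, toStable_map_eq_iff, sub_zero]
  exact hf

theorem projective_of_id_toStable_eq_zero {X : 𝒜} (h : 𝟙 ((toStable 𝒜).obj X) = 0) :
    Projective X := by
  rw [← (toStable 𝒜).map_id, ← (toStable 𝒜).map_zero, toStable_map_eq_iff, sub_zero] at h
  obtain ⟨P, _, a, b, hab⟩ := h
  exact Retract.projective ⟨a, b, hab⟩

theorem map_eq_of_stableRel {𝒞 : Type w'} [Category.{v'} 𝒞] [Abelian 𝒞] {F : 𝒞 ⥤ StableCat 𝒜} (hF : F.Additive)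
    (hP : ∀ P : 𝒞, Projective P → 𝟙 (F.obj P) = 0) {X Y : 𝒞} {f g : X ⟶ Y}
    (h : stableRel 𝒞 f g) : F.map f = F.map g := by
  obtain ⟨P, hPP, a, b, hab⟩ := h
  rw [← sub_eq_zero, ← F.map_sub, ← hab, F.map_comp, ← Category.id_comp (F.map b), hP P hPP,
    zero_comp, comp_zero]

variable [IsFrobenius 𝒜]

theorem factorsThroughProjective_cosyzygyπ {X Y : 𝒜} (f : Y ⟶ Injective.under X) :
    FactorsThroughProjective (f ≫ cosyzygyπ X) :=
  ⟨_, (IsFrobenius.projective_iff_injective _).2 inferInstance, f, _, rfl⟩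

theorem exists_isConnecting (S : ShortComplex 𝒜) (hS : S.ShortExact) : ∃ ω, IsConnecting S ω := by
  have := hS.mono_f
  have := hS.epi_g
  let m := Injective.factorThru (Injective.ι S.X₁) S.f
  have hm : S.f ≫ m = Injective.ι S.X₁ := Injective.comp_factorThru _ _
  have h0 : S.f ≫ m ≫ cosyzygyπ S.X₁ = 0 := by
    rw [← Category.assoc, hm]; exact cokernel.condition _
  exact ⟨hS.exact.desc _ h0, m, hm, (hS.exact.g_desc _ h0).symm⟩

/-- Connecting morphisms are natural in the stable category. -/
theorem IsConnecting.naturality {S S' : ShortComplex 𝒜} (hS : S.ShortExact)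
    {ω : S.X₃ ⟶ cosyzygy S.X₁} {ω' : S'.X₃ ⟶ cosyzygy S'.X₁} (h : IsConnecting S ω)
    (h' : IsConnecting S' ω') (φ : S ⟶ S') :
    (toStable 𝒜).map ω ≫ (toStable 𝒜).map (cosyzygyMap φ.τ₁) =
      (toStable 𝒜).map φ.τ₃ ≫ (toStable 𝒜).map ω' := by
  have := hS.epi_g
  obtain ⟨m, hm, hmω⟩ := h
  obtain ⟨m', hm', hmω'⟩ := h'
  let e := Injective.factorThru (φ.τ₁ ≫ Injective.ι S'.X₁) (Injective.ι S.X₁)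
  have he : Injective.ι S.X₁ ≫ e = φ.τ₁ ≫ Injective.ι S'.X₁ := Injective.comp_factorThru _ _
  -- The two maps from the middle term to $I(X')$ agree on $X$, so their difference descends to $Z$.
  -- The failure of strict naturality factors through $I(X')$, which is projective.
  have h0 : S.f ≫ (m ≫ e - φ.τ₂ ≫ m') = 0 := by
    rw [Preadditive.comp_sub, reassoc_of% hm, he, ← Category.assoc S.f, ← φ.comm₁₂, Category.assoc,
      hm', sub_self]
  have key : ω ≫ cosyzygyMap φ.τ₁ - φ.τ₃ ≫ ω' = hS.exact.desc _ h0 ≫ cosyzygyπ S'.X₁ := by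
    rw [← cancel_epi S.g, hS.exact.g_desc_assoc, Preadditive.comp_sub, Preadditive.sub_comp,
      ← Category.assoc, ← hmω, Category.assoc, Category.assoc, Category.assoc, cosyzygyπ_map, hmω',
      ← Category.assoc S.g, ← φ.comm₂₃, Category.assoc]
  rw [← Functor.map_comp, ← Functor.map_comp, toStable_map_eq_iff, key]
  exact factorsThroughProjective_cosyzygyπ _

/-- The connecting morphism of a short exact sequence with projective middle term is a stable
isomorphism. -/
theorem IsConnecting.isIso {S : ShortComplex 𝒜} (hS : S.ShortExact)
    {ω : S.X₃ ⟶ cosyzygy S.X₁} (h : IsConnecting S ω) (hP : Projective S.X₂) :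
    IsIso ((toStable 𝒜).map ω) := by
  have := hS.epi_g
  have : Injective S.X₂ := (IsFrobenius.projective_iff_injective _).1 hP
  have hπ : Epi (cosyzygyπ S.X₁) := inferInstanceAs (Epi (cokernel.π (Injective.ι S.X₁)))
  obtain ⟨m, hm, hmω⟩ := h
  let n := Injective.factorThru S.f (Injective.ι S.X₁)
  have hn : Injective.ι S.X₁ ≫ n = S.f := Injective.comp_factorThru _ _
  have hnz : Injective.ι S.X₁ ≫ n ≫ S.g = 0 := by rw [reassoc_of% hn, S.zero]
  -- The middle term is injective too, so the two embeddings of $X$ into injectives can be compared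
  -- in both directions. `ν` is the stable inverse: the composites differ from identities by maps
  -- through the two middle terms.
  let ν : cosyzygy S.X₁ ⟶ S.X₃ := cokernel.desc _ _ hnz
  have hν : cosyzygyπ S.X₁ ≫ ν = n ≫ S.g := cokernel.π_desc _ _ _
  have h1 : S.f ≫ (m ≫ n - 𝟙 _) = 0 := by
    rw [Preadditive.comp_sub, reassoc_of% hm, hn, Category.comp_id, sub_self]
  have h2 : Injective.ι S.X₁ ≫ (n ≫ m - 𝟙 _) = 0 := by
    rw [Preadditive.comp_sub, reassoc_of% hn, hm, Category.comp_id, sub_self]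
  let s : cosyzygy S.X₁ ⟶ Injective.under S.X₁ := cokernel.desc _ _ h2
  have hs : cosyzygyπ S.X₁ ≫ s = n ≫ m - 𝟙 _ := cokernel.π_desc _ _ _
  have e1 : ω ≫ ν - 𝟙 _ = hS.exact.desc _ h1 ≫ S.g := by
    rw [← cancel_epi S.g, hS.exact.g_desc_assoc, Preadditive.comp_sub, Preadditive.sub_comp,
      ← Category.assoc, ← hmω, Category.assoc, hν, Category.assoc, Category.comp_id,
      Category.id_comp]
  have e2 : ν ≫ ω - 𝟙 _ = s ≫ cosyzygyπ S.X₁ := by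
    rw [← cancel_epi (cosyzygyπ S.X₁), reassoc_of% hs, Preadditive.comp_sub, Preadditive.sub_comp,
      reassoc_of% hν, ← hmω, Category.assoc, Category.comp_id, Category.id_comp]
  refine ⟨(toStable 𝒜).map ν, ?_, ?_⟩
  · rw [← Functor.map_comp, ← (toStable 𝒜).map_id, toStable_map_eq_iff, e1]
    exact ⟨_, hP, _, _, rfl⟩
  · rw [← Functor.map_comp, ← (toStable 𝒜).map_id, toStable_map_eq_iff, e2]
    exact factorsThroughProjective_cosyzygyπ _

theorem IsExactTriangle.of_iso {X Y Z X' Y' Z' : StableCat 𝒜} {u : X ⟶ Y} {v : Y ⟶ Z}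
    {t : Z ⟶ (suspension 𝒜).obj X} {u' : X' ⟶ Y'} {v' : Y' ⟶ Z'}
    {t' : Z' ⟶ (suspension 𝒜).obj X'} (h : IsExactTriangle u' v' t') (a : X ≅ X') (b : Y ≅ Y')
    (c : Z ≅ Z') (hu : u ≫ b.hom = a.hom ≫ u') (hv : v ≫ c.hom = b.hom ≫ v')
    (ht : t ≫ (suspension 𝒜).map a.hom = c.hom ≫ t') : IsExactTriangle u v t := by
  obtain ⟨S, hS, ω, hω, a', b', c', hu', hv', ht'⟩ := h
  refine ⟨S, hS, ω, hω, a ≪≫ a', b ≪≫ b', c ≪≫ c', ?_, ?_, ?_⟩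
  · rw [Iso.trans_hom, Iso.trans_hom, reassoc_of% hu, hu', Category.assoc]
  · rw [Iso.trans_hom, Iso.trans_hom, reassoc_of% hv, hv', Category.assoc]
  · rw [Iso.trans_hom, Iso.trans_hom, Functor.map_comp, reassoc_of% ht, ht', Category.assoc]
    rfl

/-- An object whose stable identity vanishes is projective, so the sequence representing the
triangle has projective middle term. -/
theorem IsExactTriangle.isIso {X Y Z : StableCat 𝒜} {u : X ⟶ Y} {v : Y ⟶ Z}
    {t : Z ⟶ (suspension 𝒜).obj X} (h : IsExactTriangle u v t) (hY : 𝟙 Y = 0) : IsIso t := by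
  obtain ⟨S, hS, ω, hω, a, b, c, -, -, ht⟩ := h
  have hP : Projective S.X₂ := projective_of_id_toStable_eq_zero (by
    rw [← b.inv_hom_id, ← Category.id_comp b.hom, hY, zero_comp, comp_zero])
  have := hω.isIso hS hP
  have hc : IsIso (c.hom ≫ (toStable 𝒜).map ω) := inferInstance
  have : IsIso (t ≫ (suspension 𝒜).map a.hom) := by rw [ht]; exact hc
  exact IsIso.of_isIso_comp_right t ((suspension 𝒜).map a.hom)

/-! ### From ∂-functors to triangle functors -/

section DelFunctor

variable {𝒞 : Type w'} [Category.{v'} 𝒞] [Abelian 𝒞] [IsFrobenius 𝒞]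

/-- The short exact sequence `0 → X → I(X) → Σ X → 0`. -/
def cosyzygyComplex (X : 𝒞) : ShortComplex 𝒞 :=
  ShortComplex.mk (Injective.ι X) (cosyzygyπ X) (cokernel.condition _)

theorem cosyzygyComplex_shortExact (X : 𝒞) : (cosyzygyComplex X).ShortExact where
  exact := ShortComplex.exact_cokernel (Injective.ι X)
  mono_f := inferInstanceAs (Mono (Injective.ι X))
  epi_g := inferInstanceAs (Epi (cokernel.π (Injective.ι X)))

/-- The morphism of short exact sequences given by a connecting morphism. -/
def IsConnecting.toCosyzygyComplex {S : ShortComplex 𝒞} {ω : S.X₃ ⟶ cosyzygy S.X₁}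
    (h : IsConnecting S ω) : S ⟶ cosyzygyComplex S.X₁ where
  τ₁ := 𝟙 _
  τ₂ := h.choose
  τ₃ := ω
  comm₁₂ := (Category.id_comp _).trans h.choose_spec.1.symm
  comm₂₃ := h.choose_spec.2

/-- The morphism of short exact sequences inducing `Σ f`. -/
def cosyzygyComplexMap {X Y : 𝒞} (f : X ⟶ Y) : cosyzygyComplex X ⟶ cosyzygyComplex Y where
  τ₁ := f
  τ₂ := show Injective.under X ⟶ Injective.under Y from
    Injective.factorThru (f ≫ Injective.ι Y) (Injective.ι X)
  τ₃ := cosyzygyMap f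
  comm₁₂ := (Injective.comp_factorThru (f ≫ Injective.ι Y) (Injective.ι X)).symm
  comm₂₃ := (cosyzygyπ_map f).symm

/-- A `∂`-functor on a Frobenius category which vanishes on projective objects induces a triangle
functor on the stable category. -/
theorem IsDelFunctor.exists_triangleFunctor {F : 𝒞 ⥤ StableCat 𝒜} (hF : IsDelFunctor F)
    (hP : ∀ P : 𝒞, Projective P → 𝟙 (F.obj P) = 0) :
    ∃ F' : StableCat 𝒞 ⥤ StableCat 𝒜, toStable 𝒞 ⋙ F' = F ∧ IsTriangleFunctor F' := by
  obtain ⟨hadd, ω, hω, hnat⟩ := hF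
  let F' : StableCat 𝒞 ⥤ StableCat 𝒜 := CategoryTheory.Quotient.lift (stableRel 𝒞) F
    fun _ _ _ _ h => map_eq_of_stableRel hadd hP h
  -- These are the components of $\theta$. They are invertible because $F$ kills $I(X)$, and natural
  -- because every morphism extends to the standard sequences.
  let ω' (X : 𝒞) : F.obj (cosyzygy X) ⟶ (suspension 𝒜).obj (F.obj X) :=
    ω (cosyzygyComplex X) (cosyzygyComplex_shortExact X)
  have hiso (X : 𝒞) : IsIso (ω' X) := (hω _ (cosyzygyComplex_shortExact X)).isIso
    (hP _ ((IsFrobenius.projective_iff_injective _).2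
      (inferInstanceAs (Injective (Injective.under X)))))
  let θ : suspension 𝒞 ⋙ F' ≅ F' ⋙ suspension 𝒜 :=
    NatIso.ofComponents (fun X => @asIso _ _ _ _ (ω' X.as) (hiso X.as)) (by
      intro X Y f
      obtain ⟨f, rfl⟩ := (toStable 𝒞).map_surjective (X := X.as) (Y := Y.as) f
      exact (hnat _ _ (cosyzygyComplex_shortExact X.as) (cosyzygyComplex_shortExact Y.as)
        (cosyzygyComplexMap f)).symm)
  refine ⟨F', CategoryTheory.Quotient.lift_spec _ _ _, ⟨?_⟩, θ, ?_⟩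
  · intro X Y f g
    obtain ⟨f, rfl⟩ := (toStable 𝒞).map_surjective (X := X.as) (Y := Y.as) f
    obtain ⟨g, rfl⟩ := (toStable 𝒞).map_surjective (X := X.as) (Y := Y.as) g
    rw [← (toStable 𝒞).map_add]
    exact F.map_add
  · rintro X Y Z u v t ⟨S, hS, ω₀, hω₀, a, b, c, hu, hv, ht⟩
    refine (hω S hS).of_iso (F'.mapIso a) (F'.mapIso b) (F'.mapIso c) ?_ ?_ ?_
    · exact (F'.map_comp _ _).symm.trans ((congrArg F'.map hu).trans (F'.map_comp _ _))
    · exact (F'.map_comp _ _).symm.trans ((congrArg F'.map hv).trans (F'.map_comp _ _))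
    -- A connecting morphism gives a map of $\xi$ to the standard sequence of $X$ that is the
    -- identity on $X$. Naturality of $\omega$ along it expresses $\omega_\xi$ through $\theta_X$.
    · have h1 : F.map ω₀ ≫ ω' S.X₁ = ω S hS := by
        have := hnat S _ hS (cosyzygyComplex_shortExact S.X₁) hω₀.toCosyzygyComplex
        change ω S hS ≫ (suspension 𝒜).map (F.map (𝟙 S.X₁)) = F.map ω₀ ≫ ω' S.X₁ at this
        rw [← this, F.map_id, (suspension 𝒜).map_id, Category.comp_id]
      have h2 := θ.hom.naturality a.hom
      change (F'.map t ≫ θ.hom.app X) ≫ (F' ⋙ suspension 𝒜).map a.hom = F'.map c.hom ≫ ω S hS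
      rw [Category.assoc, ← h2, ← h1]
      change F'.map t ≫ F'.map ((suspension 𝒞).map a.hom) ≫ _ = _
      rw [← Category.assoc]
      exact (congrArg (· ≫ θ.hom.app _) ((F'.map_comp t _).symm.trans ((congrArg F'.map ht).trans
        (F'.map_comp c.hom ((toStable 𝒞).map ω₀))))).trans (Category.assoc _ _ _)

end DelFunctor

end Stable

/-! ### Wakamatsu's functor for arbitrary special preenvelopes -/

section WakamatsuFunctor

open CategoryTheory

variable {R E A B T : Type u} [CommRing R] [IsArtinianRing R] [AddCommGroup E] [Module R E]
  [IsMinimalInjectiveCogenerator R E]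
  [Ring A] [Algebra R A] [Module.Finite R A] [Ring B] [Algebra R B] [Module.Finite R B]
  [AddCommGroup T] [Module R T] [Module A T] [Module Bᵐᵒᵖ T]
  [IsScalarTower R A T] [IsScalarTower R Bᵐᵒᵖ T] [SMulCommClass A Bᵐᵒᵖ T] [Module.Finite A T]
  {𝒲 𝒱 : ObjectProperty (FGModuleCat.{u} A)}
  (hδ : Function.Bijective (delta R E A B T))

/-- The `A`-linear map underlying a morphism of `T(A)`-modules. -/
def resLin {X X' : FGModuleCat.{u} (TrivExt R E A)} (f : X ⟶ X') : res X →ₗ[A] res X' :=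
  (resMap f).restrictScalars A

/-- A special preenvelope of the underlying `A`-module of a `T(A)`-module. -/
def SpecialPreenvelope.toRes {X : FGModuleCat.{u} (TrivExt R E A)}
    (s : SpecialPreenvelope 𝒱 (res X)) : Res R E A X →ₗ[A] s.V := s.α

variable {X X' X'' : FGModuleCat.{u} (TrivExt R E A)}

/-- The `T(B)`-module attached to a special preenvelope of a `T(A)`-module. -/
def coneObj (s : SpecialPreenvelope 𝒱 (res X)) : FGModuleCat.{u} (TrivExt R E B) :=
  FGModuleCat.of (TrivExt R E B) (WakMod hδ s.toRes)

/-- The morphism of `T(B)`-modules induced by a morphism of special preenvelopes. -/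
def coneHom (s : SpecialPreenvelope 𝒱 (res X)) (s' : SpecialPreenvelope 𝒱 (res X')) (f : X ⟶ X')
    (fV : s.V →ₗ[A] s'.V) (h : s'.α.comp (resLin f) = fV.comp s.α) :
    coneObj hδ s ⟶ coneObj hδ s' :=
  FGModuleCat.ofHom (wakMap hδ s.toRes s'.toRes (resMap f) fV h)

theorem coneObj_hom_ext {s : SpecialPreenvelope 𝒱 (res X)} {Y : FGModuleCat.{u} (TrivExt R E B)}
    {f g : coneObj hδ s ⟶ Y} (h : ∀ p : LMod hδ s.V,
      f.hom.hom (Submodule.Quotient.mk p : WakMod hδ s.toRes) =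
        g.hom.hom (Submodule.Quotient.mk p : WakMod hδ s.toRes)) : f = g :=
  FGModuleCat.hom_ext (LinearMap.ext fun q => by
    obtain ⟨p, rfl⟩ := Submodule.Quotient.mk_surjective _ q
    exact h p)

theorem coneHom_id (s : SpecialPreenvelope 𝒱 (res X)) (h) :
    coneHom hδ s s (𝟙 X) LinearMap.id h = 𝟙 _ :=
  coneObj_hom_ext hδ fun p => congrArg Submodule.Quotient.mk
    (congrArg (fun l => l p) (LMod.map_id hδ))

theorem coneHom_comp {s : SpecialPreenvelope 𝒱 (res X)} {s' : SpecialPreenvelope 𝒱 (res X')}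
    {s'' : SpecialPreenvelope 𝒱 (res X'')} (f : X ⟶ X') (g : X' ⟶ X'')
    {fV : s.V →ₗ[A] s'.V} (hf : s'.α.comp (resLin f) = fV.comp s.α)
    {gV : s'.V →ₗ[A] s''.V} (hg : s''.α.comp (resLin g) = gV.comp s'.α) (h) :
    coneHom hδ s s' f fV hf ≫ coneHom hδ s' s'' g gV hg =
      coneHom hδ s s'' (f ≫ g) (gV.comp fV) h :=
  coneObj_hom_ext hδ fun p => congrArg Submodule.Quotient.mk
    (congrArg (fun l => l p) (LMod.map_comp hδ fV gV)).symm

theorem comp_lift {s : SpecialPreenvelope 𝒱 (res X)} {s' : SpecialPreenvelope 𝒱 (res X')}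
    {s'' : SpecialPreenvelope 𝒱 (res X'')} {f : X ⟶ X'} {g : X' ⟶ X''}
    {fV : s.V →ₗ[A] s'.V} (hf : s'.α.comp (resLin f) = fV.comp s.α)
    {gV : s'.V →ₗ[A] s''.V} (hg : s''.α.comp (resLin g) = gV.comp s'.α) :
    s''.α.comp (resLin (f ≫ g)) = (gV.comp fV).comp s.α := by
  rw [LinearMap.comp_assoc, ← hf, ← LinearMap.comp_assoc, ← hg]
  rfl

theorem coneHom_add {s : SpecialPreenvelope 𝒱 (res X)} {s' : SpecialPreenvelope 𝒱 (res X')}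
    (f g : X ⟶ X') {fV gV : s.V →ₗ[A] s'.V} (hf : s'.α.comp (resLin f) = fV.comp s.α)
    (hg : s'.α.comp (resLin g) = gV.comp s.α) (h) :
    coneHom hδ s s' (f + g) (fV + gV) h = coneHom hδ s s' f fV hf + coneHom hδ s s' g gV hg :=
  coneObj_hom_ext hδ fun p => congrArg Submodule.Quotient.mk
    (congrArg (fun l => l p) (LMod.map_add hδ fV gV))

/-- The stable class of the morphism induced by a morphism of special preenvelopes depends only on
the given morphism of `T(A)`-modules. -/
theorem toStable_coneHom_eq (hT : IsFaithfullyBalanced A B T) (hpair : IsCotorsionPair 𝒲 𝒱)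
    (hadd : ∀ X : FGModuleCat.{u} A, (𝒲 X ∧ 𝒱 X) ↔ IsInAdd T X)
    (α : ∀ X : FGModuleCat.{u} A, SpecialPreenvelope 𝒱 X)
    {s : SpecialPreenvelope 𝒱 (res X)} {s' : SpecialPreenvelope 𝒱 (res X')}
    {f : X ⟶ X'} {fV gV : s.V →ₗ[A] s'.V} (hf : s'.α.comp (resLin f) = fV.comp s.α)
    (hg : s'.α.comp (resLin f) = gV.comp s.α) :
    (toStable _).map (coneHom hδ s s' f fV hf) = (toStable _).map (coneHom hδ s s' f gV hg) := by
  -- The difference of two lifts kills $X$ and factors through some $U\in\mathrm{add}\,T$. Its first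
  -- factor also kills $X$, so $L(c)$ descends to the cone and the difference factors through the
  -- projective $L(U)$.
  obtain ⟨U, hU, c, d, hc, hd⟩ := s.exists_factorization hpair α s'.mem (fV - gV) (by
    rw [LinearMap.sub_comp, ← hf, ← hg, sub_self])
  obtain ⟨n, i, p, hip⟩ := (hadd U).1 hU
  have : Module.Projective (TrivExt R E B) (LMod hδ U) := LMod.projective_of_add hδ hT n i p hip
  let P : FGModuleCat.{u} (TrivExt R E B) := FGModuleCat.of _ (LMod hδ U)
  have : Module.Projective (TrivExt R E B) P := this
  rw [toStable_map_eq_iff]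
  let a : coneObj hδ s ⟶ P := FGModuleCat.ofHom (Submodule.liftQ _ (LMod.map hδ c) (by
    rintro _ ⟨u, rfl⟩
    exact LMod.map_embed_eq_zero hδ s.toRes c hc u))
  let b : P ⟶ coneObj hδ s' := FGModuleCat.ofHom
    ((LinearMap.range (embed hδ s'.toRes)).mkQ.comp (LMod.map hδ d))
  refine ⟨P, projective_of_module_projective P, a, b, coneObj_hom_ext hδ fun q => ?_⟩
  let N := LinearMap.range (embed hδ s'.toRes)
  change N.mkQ (LMod.map hδ d (LMod.map hδ c q)) =
    N.mkQ (LMod.map hδ fV q) - N.mkQ (LMod.map hδ gV q)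
  have h1 : LMod.map hδ d (LMod.map hδ c q) = LMod.map hδ (fV - gV) q := by
    rw [← hd, LMod.map_comp]; rfl
  rw [h1, ← map_sub]
  have h2 : LMod.map hδ (fV - gV) = LMod.map hδ fV - LMod.map hδ gV :=
    (LMod.mapHom hδ).map_sub fV gV
  rw [h2]
  rfl

/-- Lifts to special preenvelopes exist. -/
theorem exists_lift (s : SpecialPreenvelope 𝒱 (res X)) (s' : SpecialPreenvelope 𝒱 (res X'))
    (f : X ⟶ X') : ∃ fV : s.V →ₗ[A] s'.V, s'.α.comp (resLin f) = fV.comp s.α := by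
  obtain ⟨k, hk⟩ := s.exists_extension s'.mem (s'.α.comp (resLin f))
  exact ⟨k, hk.symm⟩

/-- The stable morphism induced by a morphism of `T(A)`-modules. -/
def stableHom (s : SpecialPreenvelope 𝒱 (res X)) (s' : SpecialPreenvelope 𝒱 (res X'))
    (f : X ⟶ X') : (toStable _).obj (coneObj hδ s) ⟶ (toStable _).obj (coneObj hδ s') :=
  (toStable _).map (coneHom hδ s s' f (exists_lift s s' f).choose (exists_lift s s' f).choose_spec)

section

variable (hT : IsFaithfullyBalanced A B T) (hpair : IsCotorsionPair 𝒲 𝒱)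
  (hadd : ∀ X : FGModuleCat.{u} A, (𝒲 X ∧ 𝒱 X) ↔ IsInAdd T X)
  (α : ∀ X : FGModuleCat.{u} A, SpecialPreenvelope 𝒱 X)

include hT hpair hadd α

/-- This frees the stable morphism from its chosen lift, so that identities, composites and sums may
be computed with convenient lifts. -/
theorem stableHom_eq {s : SpecialPreenvelope 𝒱 (res X)} {s' : SpecialPreenvelope 𝒱 (res X')}
    {f : X ⟶ X'} {fV : s.V →ₗ[A] s'.V} (hf : s'.α.comp (resLin f) = fV.comp s.α) :
    stableHom hδ s s' f = (toStable _).map (coneHom hδ s s' f fV hf) :=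
  toStable_coneHom_eq hδ hT hpair hadd α _ hf

theorem stableHom_id (s : SpecialPreenvelope 𝒱 (res X)) : stableHom hδ s s (𝟙 X) = 𝟙 _ := by
  have h : s.α.comp (resLin (𝟙 X)) = LinearMap.id.comp s.α := rfl
  rw [stableHom_eq hδ hT hpair hadd α h, coneHom_id hδ s h, (toStable _).map_id]

theorem stableHom_comp (s : SpecialPreenvelope 𝒱 (res X)) (s' : SpecialPreenvelope 𝒱 (res X'))
    (s'' : SpecialPreenvelope 𝒱 (res X'')) (f : X ⟶ X') (g : X' ⟶ X'') :
    stableHom hδ s s' f ≫ stableHom hδ s' s'' g = stableHom hδ s s'' (f ≫ g) := by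
  obtain ⟨fV, hf⟩ := exists_lift s s' f
  obtain ⟨gV, hg⟩ := exists_lift s' s'' g
  rw [stableHom_eq hδ hT hpair hadd α hf, stableHom_eq hδ hT hpair hadd α hg,
    stableHom_eq hδ hT hpair hadd α (comp_lift hf hg), ← Functor.map_comp,
    coneHom_comp hδ f g hf hg (comp_lift hf hg)]

theorem stableHom_add (s : SpecialPreenvelope 𝒱 (res X)) (s' : SpecialPreenvelope 𝒱 (res X'))
    (f g : X ⟶ X') :
    stableHom hδ s s' (f + g) = stableHom hδ s s' f + stableHom hδ s s' g := by
  obtain ⟨fV, hf⟩ := exists_lift s s' f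
  obtain ⟨gV, hg⟩ := exists_lift s s' g
  have h : s'.α.comp (resLin (f + g)) = (fV + gV).comp s.α := by
    rw [LinearMap.add_comp, ← hf, ← hg, ← LinearMap.comp_add]; rfl
  rw [stableHom_eq hδ hT hpair hadd α hf, stableHom_eq hδ hT hpair hadd α hg,
    stableHom_eq hδ hT hpair hadd α h, ← Functor.map_add, coneHom_add hδ f g hf hg h]

/-- The stable isomorphism between the modules attached to two special preenvelopes. -/
def stableIso (s s' : SpecialPreenvelope 𝒱 (res X)) :
    (toStable _).obj (coneObj hδ s) ≅ (toStable _).obj (coneObj hδ s') where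
  hom := stableHom hδ s s' (𝟙 X)
  inv := stableHom hδ s' s (𝟙 X)
  hom_inv_id := by
    rw [stableHom_comp hδ hT hpair hadd α, Category.comp_id, stableHom_id hδ hT hpair hadd α]
  inv_hom_id := by
    rw [stableHom_comp hδ hT hpair hadd α, Category.comp_id, stableHom_id hδ hT hpair hadd α]

end

/-- Wakamatsu's functor. -/
def wakFunctor (hT : IsFaithfullyBalanced A B T) (hpair : IsCotorsionPair 𝒲 𝒱)
    (hadd : ∀ X : FGModuleCat.{u} A, (𝒲 X ∧ 𝒱 X) ↔ IsInAdd T X)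
    (α : ∀ X : FGModuleCat.{u} A, SpecialPreenvelope 𝒱 X) :
    FGModuleCat.{u} (TrivExt R E A) ⥤ StableCat (FGModuleCat.{u} (TrivExt R E B)) where
  obj X := (toStable _).obj (wakObj α hδ X)
  map f := stableHom hδ (α _) (α _) f
  map_id X := stableHom_id hδ hT hpair hadd α (α (res X))
  map_comp f g := (stableHom_comp hδ hT hpair hadd α _ _ _ f g).symm

/-! ### Connecting morphisms -/

section Connecting

/-- The complex of `T(B)`-modules attached to a short exact sequence of special preenvelopes. -/
def Horseshoe.complex {ξ : ShortComplex (FGModuleCat.{u} (TrivExt R E A))}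
    {s : SpecialPreenvelope 𝒱 (res ξ.X₁)} (H : Horseshoe (resLin ξ.f) (resLin ξ.g) s) :
    ShortComplex (FGModuleCat.{u} (TrivExt R E B)) :=
  ShortComplex.mk (coneHom hδ s H.sY ξ.f H.i H.comm_left)
    (coneHom hδ H.sY H.sZ ξ.g H.p H.comm_right) (coneObj_hom_ext hδ fun q => by
      have h : (LMod.map hδ H.p).comp (LMod.map hδ H.i) = 0 := by
        rw [← LMod.map_comp, H.exact.linearMap_comp_eq_zero]
        exact (LMod.mapHom hδ).map_zero
      exact congrArg (fun l : LMod hδ s.V →ₗ[TrivExt R E B] LMod hδ H.sZ.V =>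
        Submodule.Quotient.mk (p := LinearMap.range (embed hδ H.sZ.toRes)) (l q)) h)

/-- Both memberships of $T$ are used: $T\in\mathcal V$ lets maps into $T$ extend, giving
injectivity, and $T\in\mathcal W$ lets maps out of $T$ lift, giving surjectivity. -/
theorem Horseshoe.complex_shortExact (hpair : IsCotorsionPair 𝒲 𝒱)
    (hadd : ∀ X : FGModuleCat.{u} A, (𝒲 X ∧ 𝒱 X) ↔ IsInAdd T X)
    {ξ : ShortComplex (FGModuleCat.{u} (TrivExt R E A))} (hξ : ξ.ShortExact)
    {s : SpecialPreenvelope 𝒱 (res ξ.X₁)} (H : Horseshoe (resLin ξ.f) (resLin ξ.g) s) :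
    (H.complex hδ).ShortExact := by
  have : IsNoetherianRing A := IsNoetherianRing.of_finite R A
  have hE : Module.Injective R E := IsMinimalInjectiveCogenerator.injective
  let T' : FGModuleCat.{u} A := FGModuleCat.of A T
  have hT' : 𝒲 T' ∧ 𝒱 T' := (hadd T').2
    ⟨1, LinearMap.pi fun _ => LinearMap.id, LinearMap.proj 0, rfl⟩
  obtain ⟨-, -, hgs⟩ := (shortExact_iff ξ).1 hξ
  refine (shortExact_iff _).2 ⟨?_, ?_, ?_⟩
  · refine wakMap_injective hδ (f := resMap ξ.f) (aX := s.toRes) (aY := H.sY.toRes) H.comm_left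
      H.injective ?_ fun w hw => ?_
    · exact map_injective_of_extension hE _ fun h => H.sY.exists_extension hT'.2 h
    · exact mem_range_map_of_extension hE s.toRes H.sY.toRes H.i (H.extend T' hT'.2) w hw
  · exact wakMap_exact hδ (f := resMap ξ.f) (g := resMap ξ.g) (aX := s.toRes) (aY := H.sY.toRes)
      (aZ := H.sZ.toRes) H.comm_left H.comm_right hgs H.injective H.exact H.surjective
  · exact wakMap_surjective hδ (g := resMap ξ.g) (aY := H.sY.toRes) (aZ := H.sZ.toRes)
      H.comm_right H.surjective fun h => exists_lift_of_extVanishes (W := T') H.injective H.exact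
        H.surjective ((hpair.left_iff T').1 hT'.1 _ s.mem) h

/-- Morphisms of short exact sequences induce morphisms of the attached complexes. -/
theorem Horseshoe.exists_complexMap {ξ ξ' : ShortComplex (FGModuleCat.{u} (TrivExt R E A))}
    (hξ : ξ.ShortExact) {s : SpecialPreenvelope 𝒱 (res ξ.X₁)}
    (H : Horseshoe (resLin ξ.f) (resLin ξ.g) s) {s' : SpecialPreenvelope 𝒱 (res ξ'.X₁)}
    (H' : Horseshoe (resLin ξ'.f) (resLin ξ'.g) s') (φ : ξ ⟶ ξ') :
    ∃ (l₁ : s.V →ₗ[A] s'.V) (l₃ : H.sZ.V →ₗ[A] H'.sZ.V)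
      (h₁ : s'.α.comp (resLin φ.τ₁) = l₁.comp s.α)
      (h₃ : H'.sZ.α.comp (resLin φ.τ₃) = l₃.comp H.sZ.α)
      (ψ : H.complex hδ ⟶ H'.complex hδ), ψ.τ₁ = coneHom hδ s s' φ.τ₁ l₁ h₁ ∧
        ψ.τ₃ = coneHom hδ H.sZ H'.sZ φ.τ₃ l₃ h₃ := by
  have h12 : (resLin ξ'.f).comp (resLin φ.τ₁) = (resLin φ.τ₂).comp (resLin ξ.f) :=
    congrArg resLin φ.comm₁₂
  have h23 : (resLin ξ'.g).comp (resLin φ.τ₂) = (resLin φ.τ₃).comp (resLin ξ.g) :=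
    congrArg resLin φ.comm₂₃
  obtain ⟨l₁, l₂, l₃, h₁, h₂, h₃, hi, hp⟩ :=
    H.exists_lift H' ((shortExact_iff ξ).1 hξ).2.2 h12 h23
  refine ⟨l₁, l₃, h₁, h₃, ⟨coneHom hδ s s' φ.τ₁ l₁ h₁, coneHom hδ H.sY H'.sY φ.τ₂ l₂ h₂,
    coneHom hδ H.sZ H'.sZ φ.τ₃ l₃ h₃, ?_, ?_⟩, rfl, rfl⟩
  · refine coneObj_hom_ext hδ fun q => congrArg Submodule.Quotient.mk ?_
    change ((LMod.map hδ H'.i).comp (LMod.map hδ l₁)) q = ((LMod.map hδ l₂).comp (LMod.map hδ H.i)) q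
    rw [← LMod.map_comp, hi, LMod.map_comp]
  · refine coneObj_hom_ext hδ fun q => congrArg Submodule.Quotient.mk ?_
    change ((LMod.map hδ H'.p).comp (LMod.map hδ l₂)) q = ((LMod.map hδ l₃).comp (LMod.map hδ H.p)) q
    rw [← LMod.map_comp, hp, LMod.map_comp]

/-- The fixed preenvelopes of $X,Y,Z$ need not form an exact sequence. The horseshoe keeps the one
of $X$ and replaces the other two, and the canonical stable isomorphisms compare the choices. -/
theorem wakFunctor_isDelFunctor (hT : IsFaithfullyBalanced A B T) (hpair : IsCotorsionPair 𝒲 𝒱)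
    (hhered : IsHereditary 𝒲 𝒱)
    (hadd : ∀ X : FGModuleCat.{u} A, (𝒲 X ∧ 𝒱 X) ↔ IsInAdd T X)
    (α : ∀ X : FGModuleCat.{u} A, SpecialPreenvelope 𝒱 X) :
    IsDelFunctor (wakFunctor (R := R) (E := E) hδ hT hpair hadd α) := by
  have : IsNoetherianRing A := IsNoetherianRing.of_finite R A
  have hH (ξ : ShortComplex (FGModuleCat.{u} (TrivExt R E A))) (hξ : ξ.ShortExact) :
      Nonempty (Horseshoe (resLin ξ.f) (resLin ξ.g) (α (res ξ.X₁))) := by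
    obtain ⟨h1, h2, h3⟩ := (shortExact_iff ξ).1 hξ
    exact nonempty_horseshoe hpair hhered α h1 h2 h3 _
  let H (ξ : ShortComplex (FGModuleCat.{u} (TrivExt R E A))) (hξ : ξ.ShortExact) :=
    (hH ξ hξ).some
  have hω (ξ : ShortComplex (FGModuleCat.{u} (TrivExt R E A))) (hξ : ξ.ShortExact) :=
    exists_isConnecting _ ((H ξ hξ).complex_shortExact hδ hpair hadd hξ)
  choose ω hω using hω
  -- Only the source of the connecting morphism needs transport, since the horseshoe uses the fixed
  -- preenvelope at $X$.
  refine ⟨⟨fun {X Y f g} => stableHom_add hδ hT hpair hadd α _ _ f g⟩, fun ξ hξ =>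
    stableHom hδ (α (res ξ.X₃)) (H ξ hξ).sZ (𝟙 ξ.X₃) ≫ (toStable _).map (ω ξ hξ),
    fun ξ hξ => ?_, fun ξ ξ' hξ hξ' φ => ?_⟩
  · refine ⟨(H ξ hξ).complex hδ, (H ξ hξ).complex_shortExact hδ hpair hadd hξ, ω ξ hξ, hω ξ hξ,
      Iso.refl _, stableIso hδ hT hpair hadd α _ (H ξ hξ).sY,
      stableIso hδ hT hpair hadd α _ (H ξ hξ).sZ, ?_, ?_, ?_⟩
    · refine Eq.trans ?_ (Category.id_comp _).symm
      refine Eq.trans ?_ (stableHom_eq hδ hT hpair hadd α (H ξ hξ).comm_left)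
      refine (stableHom_comp hδ hT hpair hadd α _ _ _ ξ.f (𝟙 ξ.X₂)).trans ?_
      rw [Category.comp_id]
    · refine (stableHom_comp hδ hT hpair hadd α _ _ _ ξ.g (𝟙 ξ.X₃)).trans ?_
      refine Eq.trans ?_ (congrArg (stableHom hδ _ (H ξ hξ).sY (𝟙 ξ.X₂) ≫ ·)
        (stableHom_eq hδ hT hpair hadd α (H ξ hξ).comm_right))
      refine Eq.trans ?_ (stableHom_comp hδ hT hpair hadd α _ _ _ (𝟙 ξ.X₂) ξ.g).symm
      rw [Category.comp_id, Category.id_comp]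
    · refine Eq.trans (congrArg (_ ≫ ·) ((suspension _).map_id _)) (Category.comp_id _)
  · obtain ⟨l₁, l₃, h₁, h₃, ψ, hψ₁, hψ₃⟩ := (H ξ hξ).exists_complexMap hδ hξ (H ξ' hξ') φ
    have hn := (hω ξ hξ).naturality ((H ξ hξ).complex_shortExact hδ hpair hadd hξ) (hω ξ' hξ') ψ
    have e₁ : stableHom hδ (α (res ξ.X₁)) (α (res ξ'.X₁)) φ.τ₁ = (toStable _).map ψ.τ₁ := by
      rw [hψ₁]; exact stableHom_eq hδ hT hpair hadd α h₁
    have e₃ : stableHom hδ (H ξ hξ).sZ (H ξ' hξ').sZ φ.τ₃ = (toStable _).map ψ.τ₃ := by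
      rw [hψ₃]; exact stableHom_eq hδ hT hpair hadd α h₃
    have hl : stableHom hδ (α (res ξ.X₃)) (H ξ hξ).sZ (𝟙 ξ.X₃) ≫
        stableHom hδ (H ξ hξ).sZ (H ξ' hξ').sZ φ.τ₃ =
        stableHom hδ (α (res ξ.X₃)) (α (res ξ'.X₃)) φ.τ₃ ≫
          stableHom hδ (α (res ξ'.X₃)) (H ξ' hξ').sZ (𝟙 ξ'.X₃) := by
      rw [stableHom_comp hδ hT hpair hadd α, stableHom_comp hδ hT hpair hadd α, Category.comp_id,
        Category.id_comp]
    have hs : (suspension _).map (stableHom hδ (α (res ξ.X₁)) (α (res ξ'.X₁)) φ.τ₁) =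
        (toStable _).map (cosyzygyMap ψ.τ₁) := congrArg (suspension _).map e₁
    refine (Category.assoc _ _ _).trans ?_
    refine (congrArg (fun k => _ ≫ _ ≫ k) hs).trans ?_
    refine (congrArg (_ ≫ ·) hn).trans ?_
    rw [← e₃]
    refine (Category.assoc _ _ _).symm.trans ?_
    refine (congrArg (· ≫ _) hl).trans (Category.assoc _ _ _)

end Connecting

end WakamatsuFunctor

/-! ### Projective modules -/

section Regular

variable {R E A B T : Type u} [CommRing R] [AddCommGroup E] [Module R E]
  [Ring A] [Algebra R A] [Ring B] [Algebra R B]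
  [AddCommGroup T] [Module R T] [Module A T] [Module Bᵐᵒᵖ T]
  [IsScalarTower R A T] [IsScalarTower R Bᵐᵒᵖ T] [SMulCommClass A Bᵐᵒᵖ T]
  {V : Type u} [AddCommGroup V] [Module A V]

/-- The map `T(A) → V ⊕ D A` induced by a map `A → V`. -/
def regularMap (a : A →ₗ[A] V) : Res R E A (TrivExt R E A) →ₗ[A] V × Dual R E A where
  toFun τ := (a (TrivSqZeroExt.fst τ), TrivSqZeroExt.snd τ)
  map_add' τ σ := Prod.ext (map_add a _ _) rfl
  map_smul' b τ := by
    have h1 (σ : TrivExt R E A) : (TrivSqZeroExt.inl b * σ).fst = b • σ.fst := by simp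
    have h2 (σ : TrivExt R E A) : (TrivSqZeroExt.inl b * σ).snd = b • σ.snd := by simp
    exact Prod.ext ((congrArg a (h1 τ)).trans (map_smul a b _)) (h2 τ)

/-- The inclusion of `D A` into the `A`-module `T(A)`. -/
def regularInr : Dual R E A →ₗ[A] Res R E A (TrivExt R E A) where
  toFun f := (TrivSqZeroExt.inr f : TrivExt R E A)
  map_add' := TrivSqZeroExt.inr_add A
  map_smul' b f := (TrivSqZeroExt.inl_mul_inr b f).symm

/-- The unit of `T(A)`. -/
def regularOne : Res R E A (TrivExt R E A) := (1 : TrivExt R E A)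

theorem regularMap_inr (a : A →ₗ[A] V) (f : Dual R E A) :
    regularMap a (regularInr f) = (0, f) := Prod.ext (map_zero a) rfl

theorem regularMap_one (a : A →ₗ[A] V) :
    regularMap a (regularOne : Res R E A (TrivExt R E A)) = (a 1, 0) := rfl

/-- This reflects the decomposition $T(A)=A\cdot1\oplus DA$ of left $A$-modules, with $DT\otimes_A
A\cong DT$. -/
theorem exists_tensor_regular_eq (u : BalTensor A (Dual R E T) (Res R E A (TrivExt R E A))) :
    ∃ (k : Dual R E T) (v : BalTensor A (Dual R E T) (Dual R E A)),
      u = BalTensor.tmul A k regularOne + BalTensor.map (Dual R E T) B regularInr v := by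
  refine BalTensor.induction
    (p := fun u : BalTensor A (Dual R E T) (Res R E A (TrivExt R E A)) => ∃ (k : Dual R E T)
      (v : BalTensor A (Dual R E T) (Dual R E A)),
      u = BalTensor.tmul A k regularOne + BalTensor.map (Dual R E T) B regularInr v)
    ⟨0, 0, ?_⟩ (fun f τ => ⟨op (TrivSqZeroExt.fst τ) • f,
      BalTensor.tmul A f (TrivSqZeroExt.snd τ), ?_⟩) ?_ u
  · rw [BalTensor.zero_tmul, map_zero, add_zero]
  · rw [BalTensor.map_tmul, BalTensor.smul_tmul, ← BalTensor.tmul_add]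
    refine congrArg (BalTensor.tmul A f) ?_
    have h : (τ : TrivExt R E A) = TrivSqZeroExt.inl (TrivSqZeroExt.fst τ) * 1 +
        TrivSqZeroExt.inr (TrivSqZeroExt.snd τ) := by
      rw [mul_one]; exact (TrivSqZeroExt.inl_fst_add_inr_snd_eq τ).symm
    exact h
  · rintro _ _ ⟨k, v, rfl⟩ ⟨l, w, rfl⟩
    refine ⟨k + l, v + w, ?_⟩
    rw [BalTensor.add_tmul, map_add]
    abel

/-- The reason is that $DA\cdot DA=0$ in $T(A)$. -/
theorem adj_regularInr (v : BalTensor A (Dual R E T) (Dual R E A)) :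
    adj R E A B T (Res R E A (TrivExt R E A)) (BalTensor.map (Dual R E T) B regularInr v) = 0 := by
  refine BalTensor.induction (p := fun v => adj R E A B T (Res R E A (TrivExt R E A))
    (BalTensor.map (Dual R E T) B regularInr v) = 0) ?_ (fun k f => ?_) (fun v w hv hw => ?_) v
  · rw [map_zero, map_zero]
  · refine HomMod.ext fun t => ?_
    exact TrivSqZeroExt.inr_mul_inr A (deltaPrime t k : Dual R E A) f
  · rw [map_add, map_add, hv, hw, add_zero]

theorem adj_regularOne (k : Dual R E T) (t : T) :
    adj R E A B T (Res R E A (TrivExt R E A)) (BalTensor.tmul A k regularOne) t =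
      regularInr (deltaPrime t k) :=
  mul_one (TrivSqZeroExt.inr (deltaPrime t k) : TrivExt R E A)

/-- The form `t ↦ h(t)(1)` on `T` attached to an `A`-linear map `h : T → D A`. -/
def evalOne (h : T →ₗ[A] Dual R E A) : Dual R E T :=
  (show T →ₗ[R] E from
    { toFun := fun t => h t 1
      map_add' := fun s t => by rw [map_add]; rfl
      map_smul' := fun r t => by
        rw [← algebraMap_smul A r t, map_smul]
        change h t (1 * algebraMap R A r) = r • h t 1
        rw [one_mul, Algebra.algebraMap_eq_smul_one, map_smul] })

/-- This is one half of the adjunction $DT\cong\mathrm{Hom}_A(T,DA)$. -/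
theorem deltaPrime_evalOne (h : T →ₗ[A] Dual R E A) (t : T) :
    deltaPrime t (evalOne h) = h t := by
  ext a
  change h (a • t) 1 = h t a
  rw [map_smul]
  change h t (1 * a) = h t a
  rw [one_mul]

variable (hδ : Function.Bijective (delta R E A B T))

/-- In $L(V\oplus DA)=L(V)\oplus\mathrm{Hom}_A(T,DA)\oplus(DT\otimes_A DA)$, the image of
$DT\otimes_A T(A)\cong DT\oplus(DT\otimes_A DA)$ is a complement of $L(V)$, because
$DT\cong\mathrm{Hom}_A(T,DA)$. So the cokernel is $L(V)$. -/
theorem mkQ_comp_map_inl_bijective (a : A →ₗ[A] V) :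
    Function.Bijective ((LinearMap.range (embed hδ (regularMap (R := R) (E := E) a))).mkQ.comp
      (LMod.map hδ (LinearMap.inl A V (Dual R E A)))) := by
  constructor
  · rw [injective_iff_map_eq_zero]
    rintro ⟨h, z⟩ hp
    obtain ⟨u, hu⟩ := (Submodule.Quotient.mk_eq_zero _).1 hp
    change BalTensor A (Dual R E T) (Res R E A (TrivExt R E A)) at u
    obtain ⟨k, v, rfl⟩ := exists_tensor_regular_eq (B := B) u
    have h1 := congrArg Prod.fst hu
    have h2 := congrArg Prod.snd hu
    change BalTensor.map (Dual R E T) B (regularMap a) (BalTensor.tmul A k regularOne +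
      BalTensor.map (Dual R E T) B regularInr v) = BalTensor.map (Dual R E T) B (LinearMap.inl A V (Dual R E A)) z at h2
    -- Projecting the tensor component to $DT\otimes_A DA$ isolates $v$; below, projecting the Hom
    -- component to $DA$ isolates $k$.
    have hv : v = 0 := by
      have h3 := congrArg (BalTensor.map (Dual R E T) B (LinearMap.snd A V (Dual R E A))) h2
      have e1 : ((LinearMap.snd A V (Dual R E A)).comp
          (regularMap a)).comp (regularInr (R := R) (E := E)) = LinearMap.id := rfl
      rw [map_add, map_add, BalTensor.map_tmul, BalTensor.map_tmul, BalTensor.map_map,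
        BalTensor.map_map, e1, BalTensor.map_map, LinearMap.snd_comp_inl, BalTensor.map_zero_left,
        BalTensor.map_id, regularMap_one] at h3
      have e2 : LinearMap.snd A V (Dual R E A) (a 1, 0) = 0 := rfl
      rwa [e2, BalTensor.tmul_zero, zero_add] at h3
    have hk : k = 0 := by
      ext t
      have h3 : -(regularMap a (adj R E A B T (Res R E A (TrivExt R E A))
          (BalTensor.tmul A k regularOne +
            BalTensor.map (Dual R E T) B regularInr v) t)) = (h t, 0) :=
        congrArg (fun l : HomMod A T (V × Dual R E A) => l t) h1
      rw [map_add, adj_regularInr, add_zero, adj_regularOne, regularMap_inr] at h3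
      have h4 : -(deltaPrime t k : Dual R E A) = 0 := congrArg Prod.snd h3
      have h5 := congrArg (fun f : Dual R E A => f 1) (neg_eq_zero.1 h4)
      change k ((1 : A) • t) = 0 at h5
      rwa [one_smul] at h5
    have h0 : LMod.map hδ (LinearMap.inl A V (Dual R E A)) (h, z) = 0 := by
      rw [← hu, hk, hv, BalTensor.zero_tmul, map_zero, add_zero]
      exact map_zero (embed hδ (regularMap a))
    have h6 (p : LMod hδ V) : LMod.map hδ (LinearMap.fst A V (Dual R E A))
        (LMod.map hδ (LinearMap.inl A V (Dual R E A)) p) = p := by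
      rw [← LinearMap.comp_apply, ← LMod.map_comp, LinearMap.fst_comp_inl, LMod.map_id]
      rfl
    exact (h6 _).symm.trans ((congrArg _ h0).trans (map_zero _))
  · intro q
    obtain ⟨⟨h, z⟩, rfl⟩ := Submodule.Quotient.mk_surjective _ q
    let k : Dual R E T := evalOne ((LinearMap.snd A V (Dual R E A)).comp h.toLin)
    let v := BalTensor.map (Dual R E T) B (LinearMap.snd A V (Dual R E A)) z
    -- The relation given by $k\otimes1$ removes the $DA$-part of $h$ but contributes $-k\otimes
    -- a(1)$ to the tensor component. The last summand compensates for this; the minus sign in `u`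
    -- matches the sign in `embed`.
    let p : LMod hδ V := (HomMod.map B T (LinearMap.fst A V (Dual R E A)) h,
      BalTensor.map (Dual R E T) B (LinearMap.fst A V (Dual R E A)) z + BalTensor.tmul A k (a 1))
    let u : BalTensor A (Dual R E T) (Res R E A (TrivExt R E A)) :=
      BalTensor.map (Dual R E T) B regularInr v - BalTensor.tmul A k regularOne
    have h1 : -HomMod.map B T (regularMap a) (adj R E A B T _ u) +
        HomMod.map B T (LinearMap.inl A V (Dual R E A)) p.1 = h := by
      refine HomMod.ext fun t => ?_
      change -regularMap a (adj R E A B T _ u t) + ((h t).1, 0) = h t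
      have e : adj R E A B T _ u t = -regularInr (deltaPrime t k) := by
        rw [map_sub, adj_regularInr, zero_sub, ← adj_regularOne (B := B)]
        rfl
      rw [e, map_neg, neg_neg, regularMap_inr, deltaPrime_evalOne]
      exact Prod.ext (zero_add _) (add_zero _)
    have h2 : BalTensor.map (Dual R E T) B (regularMap a) u +
        BalTensor.map (Dual R E T) B (LinearMap.inl A V (Dual R E A)) p.2 = z := by
      have e1 : (regularMap a).comp (regularInr (R := R) (E := E)) =
          LinearMap.inr A V (Dual R E A) := LinearMap.ext (regularMap_inr a)
      have e2 : (LinearMap.inl A V (Dual R E A)).comp (LinearMap.fst A V (Dual R E A)) +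
          (LinearMap.inr A V (Dual R E A)).comp (LinearMap.snd A V (Dual R E A)) =
          LinearMap.id := LinearMap.ext fun w => Prod.ext (add_zero _) (zero_add _)
      rw [map_sub, BalTensor.map_tmul, BalTensor.map_map, BalTensor.map_map, e1, regularMap_one,
        map_add, BalTensor.map_map, BalTensor.map_tmul, LinearMap.inl_apply]
      conv_rhs => rw [← BalTensor.map_id (B := B) z, ← e2, BalTensor.map_add_left]
      abel
    have h3 : embed hδ (regularMap a) (DTMod.of hδ u) +
        LMod.map hδ (LinearMap.inl A V (Dual R E A)) p = (h, z) := Prod.ext h1 h2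
    refine ⟨p, (Submodule.Quotient.eq _).2 ⟨-DTMod.of hδ u, ?_⟩⟩
    rw [map_neg, ← h3]
    abel

end Regular

/-! ### Vanishing of Wakamatsu's functor on projectives -/

section Projective

open CategoryTheory

variable {R E A B T : Type u} [CommRing R] [IsArtinianRing R] [AddCommGroup E] [Module R E]
  [IsMinimalInjectiveCogenerator R E]
  [Ring A] [Algebra R A] [Module.Finite R A] [Ring B] [Algebra R B] [Module.Finite R B]
  [AddCommGroup T] [Module R T] [Module A T] [Module Bᵐᵒᵖ T]
  [IsScalarTower R A T] [IsScalarTower R Bᵐᵒᵖ T] [SMulCommClass A Bᵐᵒᵖ T] [Module.Finite A T]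
  {𝒲 𝒱 : ObjectProperty (FGModuleCat.{u} A)}

instance : Module.Finite A (Dual R E A) :=
  Module.Finite.of_surjective (M := TrivExt R E A) (TrivSqZeroExt.sndHom A (Dual R E A))
    TrivSqZeroExt.snd_surjective

variable (R E) in
/-- The special preenvelope of `T(A)` obtained from a special preenvelope of `A`. -/
def SpecialPreenvelope.regular (hpair : IsCotorsionPair 𝒲 𝒱)
    (s : SpecialPreenvelope 𝒱 (FGModuleCat.of A A)) :
    SpecialPreenvelope 𝒱 (res (FGModuleCat.of (TrivExt R E A) (TrivExt R E A))) where
  V := FGModuleCat.of A (s.V × Dual R E A)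
  mem := (hpair.right_iff _).2 fun W hW =>
    extVanishes_middle_right (X := s.V) (Y := FGModuleCat.of A (s.V × Dual R E A))
      (Z := FGModuleCat.of A (Dual R E A))
      (i := LinearMap.inl A s.V (Dual R E A)) (p := LinearMap.snd A s.V (Dual R E A))
      LinearMap.inl_injective Function.Exact.inl_snd LinearMap.snd_surjective
      ((hpair.right_iff _).1 s.mem W hW)
      (have : Module.Injective A (FGModuleCat.of A (Dual R E A)) :=
        inferInstanceAs (Module.Injective A (Dual R E A))
       extVanishes_of_injective)
  α := regularMap s.α
  injective τ σ h := by
    have h1 : s.α (TrivSqZeroExt.fst τ) = s.α (TrivSqZeroExt.fst σ) := congrArg Prod.fst h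
    have h2 : TrivSqZeroExt.snd τ = TrivSqZeroExt.snd σ :=
      congrArg (Prod.snd : s.V × Dual R E A → Dual R E A) h
    exact TrivSqZeroExt.ext (s.injective h1) h2
  cokernel Y hY := by
    let N := LinearMap.range (regularMap (R := R) (E := E) s.α)
    -- Adding $DA$ to both source and target leaves the cokernel unchanged.
    let e : (s.V ⧸ LinearMap.range s.α) →ₗ[A] ((s.V × Dual R E A) ⧸ N) :=
      Submodule.mapQ _ N (LinearMap.inl A s.V (Dual R E A)) (by
        rintro _ ⟨a, rfl⟩
        exact ⟨(TrivSqZeroExt.inl a : TrivExt R E A), rfl⟩)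
    have he : Function.Bijective e := by
      constructor
      · rw [injective_iff_map_eq_zero]
        intro q hq
        obtain ⟨v, rfl⟩ := Submodule.Quotient.mk_surjective _ q
        obtain ⟨τ, hτ⟩ := (Submodule.Quotient.mk_eq_zero _).1 hq
        exact (Submodule.Quotient.mk_eq_zero _).2 ⟨TrivSqZeroExt.fst τ, congrArg Prod.fst hτ⟩
      · intro q
        obtain ⟨⟨v, f⟩, rfl⟩ := Submodule.Quotient.mk_surjective _ q
        refine ⟨Submodule.Quotient.mk v, (Submodule.Quotient.eq _).2
          ⟨(TrivSqZeroExt.inr (-f) : TrivExt R E A), ?_⟩⟩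
        exact Prod.ext ((map_zero s.α).trans (sub_self v).symm) (zero_sub f).symm
    exact ExtVanishes.of_equiv (X := FGModuleCat.of A (s.V ⧸ LinearMap.range s.α))
      (LinearEquiv.ofBijective e he) (s.cokernel Y hY)

variable (hδ : Function.Bijective (delta R E A B T))
  (hT : IsFaithfullyBalanced A B T) (hpair : IsCotorsionPair 𝒲 𝒱)
  (hadd : ∀ X : FGModuleCat.{u} A, (𝒲 X ∧ 𝒱 X) ↔ IsInAdd T X)
  (α : ∀ X : FGModuleCat.{u} A, SpecialPreenvelope 𝒱 X)

-- $A$ is projective, hence in $\mathcal W$, so its preenvelope lies in $\mathrm{add}\,T$. The cone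
-- is $L$ of that preenvelope.
include hT hadd in
theorem projective_coneObj_regular (s : SpecialPreenvelope 𝒱 (FGModuleCat.of A A)) :
    Projective (coneObj hδ (s.regular R E hpair)) := by
  have : Module.Projective A (FGModuleCat.of A A) := inferInstanceAs (Module.Projective A A)
  have hA : 𝒲 (FGModuleCat.of A A) :=
    (hpair.left_iff _).2 fun Y _ => extVanishes_of_projective
  obtain ⟨n, i, p, h⟩ := (hadd s.V).1 ⟨s.mem_left hpair hA, s.mem⟩
  have : Module.Projective (TrivExt R E B) (LMod hδ s.V) :=
    LMod.projective_of_add hδ hT n i p h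
  have : Module.Projective (TrivExt R E B) (coneObj hδ (s.regular R E hpair)) :=
    Module.Projective.of_equiv'
      (LinearEquiv.ofBijective _ (mkQ_comp_map_inl_bijective hδ s.α))
  exact projective_of_module_projective _

theorem id_toStable_eq_zero {𝒜 : Type*} [Category* 𝒜] [Abelian 𝒜] (P : 𝒜) [Projective P] :
    𝟙 ((toStable 𝒜).obj P) = 0 := by
  rw [← (toStable 𝒜).map_id]
  exact toStable_map_eq_zero ⟨P, inferInstance, 𝟙 P, 𝟙 P, Category.comp_id _⟩

/-- Wakamatsu's functor vanishes on projective modules. -/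
theorem id_wakFunctor_obj_eq_zero (P : FGModuleCat.{u} (TrivExt R E A)) [Projective P] :
    𝟙 ((wakFunctor hδ hT hpair hadd α).obj P) = 0 := by
  let Λ : FGModuleCat.{u} (TrivExt R E A) := FGModuleCat.of _ (TrivExt R E A)
  let F := wakFunctor (R := R) (E := E) hδ hT hpair hadd α
  have hF : F.Additive := ⟨fun {X Y f g} => stableHom_add hδ hT hpair hadd α _ _ f g⟩
  have hΛ : 𝟙 (F.obj Λ) = 0 := by
    let s := (α (FGModuleCat.of A A)).regular R E hpair
    have := projective_coneObj_regular hδ hT hpair hadd (α (FGModuleCat.of A A))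
    -- The fixed preenvelope of $T(A)$ is arbitrary, but stably its cone agrees with that of the
    -- convenient one.
    let e : F.obj Λ ≅ (toStable _).obj (coneObj hδ s) := stableIso hδ hT hpair hadd α _ s
    rw [← e.hom_inv_id, ← Category.id_comp e.inv, id_toStable_eq_zero, Limits.zero_comp,
      Limits.comp_zero]
  obtain ⟨n, ⟨r⟩⟩ := exists_retract_freeObj P
  let pr (j : Fin n) : freeObj (TrivExt R E A) n ⟶ Λ := FGModuleCat.ofHom (LinearMap.proj j)
  let inc (j : Fin n) : Λ ⟶ freeObj (TrivExt R E A) n :=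
    FGModuleCat.ofHom (LinearMap.single _ (fun _ => TrivExt R E A) j)
  -- The identity of a free module is a sum of maps through $T(A)$, so an additive functor killing
  -- $T(A)$ kills free modules and their retracts.
  have hn : 𝟙 (freeObj (TrivExt R E A) n) = ∑ j, pr j ≫ inc j := by
    refine FGModuleCat.hom_ext (LinearMap.ext fun x : Fin n → TrivExt R E A => ?_)
    let φ : (freeObj (TrivExt R E A) n ⟶ freeObj (TrivExt R E A) n) →+ (Fin n → TrivExt R E A) :=
      AddMonoidHom.mk' (fun f => f.hom.hom x) fun _ _ => rfl
    refine Eq.trans ?_ (map_sum φ _ _).symm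
    exact (LinearMap.sum_single_apply (φ := fun _ : Fin n => TrivExt R E A) x).symm
  have hz (j : Fin n) : F.map (pr j) = 0 := by
    rw [← Category.comp_id (F.map _), hΛ, Limits.comp_zero]
  have hf : 𝟙 (F.obj (freeObj (TrivExt R E A) n)) = 0 := by
    rw [← F.map_id, hn, F.map_sum]
    refine Finset.sum_eq_zero fun j _ => ?_
    rw [F.map_comp, hz, Limits.zero_comp]
  change 𝟙 (F.obj P) = 0
  rw [← F.map_id, ← r.retract, F.map_comp, ← Category.id_comp (F.map r.r), hf, Limits.zero_comp,
    Limits.comp_zero]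

end Projective

end Wakamatsu

end

/-! ### The main theorem -/

open CategoryTheory

theorem theorem3p1 {R E A B T : Type u} [CommRing R] [IsArtinianRing R]
    [AddCommGroup E] [Module R E] [Wakamatsu.IsMinimalInjectiveCogenerator R E]
    [Ring A] [Algebra R A] [Module.Finite R A] [Ring B] [Algebra R B] [Module.Finite R B]
    [AddCommGroup T] [Module R T] [Module A T] [Module Bᵐᵒᵖ T]
    [IsScalarTower R A T] [IsScalarTower R Bᵐᵒᵖ T] [SMulCommClass A Bᵐᵒᵖ T] [Module.Finite A T]
    (hT : Wakamatsu.IsFaithfullyBalanced A B T)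
    (𝒲 𝒱 : ObjectProperty (FGModuleCat.{u} A))
    (hpair : Wakamatsu.IsCotorsionPair 𝒲 𝒱) (hcomplete : Wakamatsu.IsComplete 𝒱)
    (hhered : Wakamatsu.IsHereditary 𝒲 𝒱)
    (hadd : ∀ X : FGModuleCat.{u} A, (𝒲 X ∧ 𝒱 X) ↔ Wakamatsu.IsInAdd T X)
    (α : ∀ X : FGModuleCat.{u} A, Wakamatsu.SpecialPreenvelope 𝒱 X) :
    ∃ (hδ : Function.Bijective (Wakamatsu.delta R E A B T))
      (_ : Wakamatsu.IsFrobenius (FGModuleCat.{u} (Wakamatsu.TrivExt R E A)))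
      (_ : Wakamatsu.IsFrobenius (FGModuleCat.{u} (Wakamatsu.TrivExt R E B)))
      (S : FGModuleCat.{u} (Wakamatsu.TrivExt R E A) ⥤
        Wakamatsu.StableCat (FGModuleCat.{u} (Wakamatsu.TrivExt R E B))),
      Wakamatsu.IsWakamatsuFunctor α hδ S ∧
      Wakamatsu.IsDelFunctor S ∧
      ∃ S' : Wakamatsu.StableCat (FGModuleCat.{u} (Wakamatsu.TrivExt R E A)) ⥤
          Wakamatsu.StableCat (FGModuleCat.{u} (Wakamatsu.TrivExt R E B)),
        Wakamatsu.toStable _ ⋙ S' = S ∧ Wakamatsu.IsTriangleFunctor S' := by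
  have : IsNoetherianRing A := IsNoetherianRing.of_finite R A
  have hδ : Function.Bijective (Wakamatsu.delta R E A B T) :=
    Wakamatsu.delta_bijective Wakamatsu.IsMinimalInjectiveCogenerator.injective hT
  have hS := Wakamatsu.wakFunctor_isDelFunctor (R := R) (E := E) hδ hT hpair hhered hadd α
  refine ⟨hδ, inferInstance, inferInstance, Wakamatsu.wakFunctor hδ hT hpair hadd α,
    ⟨fun _ => rfl, fun X X' f fV h => ?_⟩, hS, hS.exists_triangleFunctor fun P _ =>
      Wakamatsu.id_wakFunctor_obj_eq_zero hδ hT hpair hadd α P⟩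
  -- The equality of objects holds by definition, so both `eqToHom` factors are identities.
  refine Eq.trans ?_ (Category.id_comp _).symm
  refine Eq.trans ?_ (Category.comp_id _).symm
  exact Wakamatsu.stableHom_eq hδ hT hpair hadd α h
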